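/- Let $d\ge 2$. For $n\in\mathbb R$ and $x\in\mathbb R^d$ put $Q_n(x)=\{y\in\mathbb R^d:\ |y_i-x_i|\le n/2 \text{ for } i=1,\dots,d\}$ (so $Q_n(x)=\emptyset$ for $n<0$) and $Q_n=Q_n(o)$, where $o$ is the origin. **Model.** Let $\Lambda$ be a stationary random measure on $\mathbb R^d$ with $\mathbb E[\Lambda([0,1]^d)]=1$. For $\lambda\ge 0$ let $X^\lambda$ be a Cox process with random intensity measure $\lambda\Lambda$, i.e. conditionally on $\Lambda$ it is a Poisson point process with intensity measure $\lambda\Lambda$. For $\lambda>0$ its Palm version $X^{\lambda,*}$ has the law given by $\mathbb E[f(X^{\lambda,*})]=\lambda^{-1}\,\mathbb E\big[\sum_{X_i\in X^\lambda\cap Q_1}f(X^\lambda-X_i)\big]$. For $r>0$ the Gilbert graph $g_r(X)$ has the points of $X$ as vertices, and two points are joined by an edge if their distance is less than $r$. Let $\theta(\lambda,r)$ be the probability that $o$ lies in an infinite connected component of $g_r(X^{\lambda,*})$, and for $a>0$ let $\theta_a(\lambda,r)$ be the probability that the set of vertices of the connected component of $o$ in $g_r(X^{\lambda,*})$ is not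 contained in $Q_{a-2r}$. **Stabilization.** $\Lambda$ is stabilizing if on the probability space of $\Lambda$ there is a random field $R=(R_x)_{x\in\mathbb R^d}$ with values in $[0,\infty]$ such that 1. $(\Lambda,R)$ is jointly stationary; 2. $\mathbb P\big(\sup_{y\in Q_n\cap\mathbb Q^d}R_y<n\big)\to1$ as $n\to\infty$; 3. for all integers $n\ge1$, all bounded measurable functions $f$ from the space of measures to $[0,\infty)$ and all finite $\varphi\subset\mathbb R^d$ whose points have mutual (Euclidean) distances greater than $3n$, the random variables $f(\Lambda|_{Q_n(x)})\,\mathbf 1\{\sup_{y\in Q_n(x)\cap\mathbb Q^d}R_y<n\}$, $x\in\varphi$, are independent. **Statement.** There is a constant $q_d\in(0,1)$, depending only on $d$, with the following property. Let $\Lambda$ be as above and stabilizing, with radii $R$. Let $\lambda:(0,\infty)\to[0,\infty)$ be monotone (non-decreasing or non-increasing), let $s:(0,\infty)\to[1,\infty)$ be non-decreasing, let $r_\infty\in\{0,\infty\}$, and let $(a_K)_{K>0}$ be non-increasing in $K$ and such that for every $K>0$ $$\lim_{r\to r_\infty}\theta_{Ks(r)}(\lambda(r),r)=a_K .$$ Regard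 $g_r(X^\lambda)$ also as a subset of $\mathbb R^d$, namely the union of its vertices and of the line segments between adjacent vertices. Let $E_r$ be the event that the set $g_r(X^{\lambda(r)})\cap Q_{5s(r)}$ has exactly one connected component which intersects both $\partial Q_{3s(r)}$ and $\partial Q_{5s(r)}$, and that this component also intersects $Q_{s(r)}$. If $$\min\Big\{\mathbb P\Big(\sup_{y\in Q_{5s(r)}\cap\mathbb Q^d}R_y<s(r)\Big),\ \mathbb P(E_r)\Big\}>q_d$$ for all $r>0$ sufficiently close to $r_\infty$ (i.e. all sufficiently large $r$ if $r_\infty=\infty$, all sufficiently small $r>0$ if $r_\infty=0$), then $\lim_{K\to\infty}a_K$ exists and $$\lim_{r\to r_\infty}\theta(\lambda(r),r)=\lim_{K\to\infty}a_K .$$ -/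

import Mathlib

open Set Filter Topology MeasureTheory ProbabilityTheory
open scoped NNReal ENNReal

noncomputable section

namespace CoxPercolation

/-- Euclidean space of dimension `d`. -/
abbrev E (d : ℕ) : Type := EuclideanSpace ℝ (Fin d)

/-- The cube `Q_n(x) = x + [-n/2, n/2]^d` (empty if `n < 0` and `d ≥ 1`). -/
def cube {d : ℕ} (n : ℝ) (x : E d) : Set (E d) :=
  {y | ∀ i, |y i - x i| ≤ n / 2}

/-- The points of Euclidean space all of whose coordinates are rational. -/
def ratPoints (d : ℕ) : Set (E d) :=
  {y | ∀ i, ∃ q : ℚ, y i = (q : ℝ)}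

/-- The translate `ν - t` of a measure: the mass of `ν` at `y` is moved to `y - t`. -/
def shift {d : ℕ} (t : E d) (ν : Measure (E d)) : Measure (E d) :=
  ν.map (fun y => y - t)

/-! ### The Gilbert graph -/

/-- The locations of the points of a point configuration, given as a counting measure. -/
def atoms {d : ℕ} (ν : Measure (E d)) : Set (E d) :=
  {x | ν {x} ≠ 0}

/-- The Gilbert graph on the vertex set `V` : distinct points are adjacent if their distance
is less than `r`. -/
def gilbertGraph {d : ℕ} (r : ℝ) (V : Set (E d)) : SimpleGraph V where
  Adj x y := x ≠ y ∧ dist (x : E d) (y : E d) < r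
  symm := ⟨fun x y h => ⟨h.1.symm, by rw [dist_comm]; exact h.2⟩⟩
  loopless := ⟨fun _ h => h.1 rfl⟩

/-- The vertex set of the connected component of `x` in the Gilbert graph on `V`
(empty if `x` is not a vertex). -/
def cluster {d : ℕ} (r : ℝ) (V : Set (E d)) (x : E d) : Set (E d) :=
  {y | ∃ (hx : x ∈ V) (hy : y ∈ V), (gilbertGraph r V).Reachable ⟨x, hx⟩ ⟨y, hy⟩}

/-- The origin belongs to an infinite connected component of the Gilbert graph of `ν`. -/
def ConnectedToInfinity {d : ℕ} (r : ℝ) (ν : Measure (E d)) : Prop :=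
  (cluster r (atoms ν) 0).Infinite

/-- The origin is connected to the boundary of `Q_a` in the Gilbert graph of `ν` : its connected
component is not contained in `Q_{a - 2r}`. -/
def ConnectedToBoundary {d : ℕ} (a r : ℝ) (ν : Measure (E d)) : Prop :=
  ¬ cluster r (atoms ν) 0 ⊆ cube (a - 2 * r) 0

/-- The Gilbert graph on `V` as a subset of space: the union of its vertices and of the line
segments that represent its edges (for `r > 0` the degenerate segments are the vertices). -/
def gilbertSet {d : ℕ} (r : ℝ) (V : Set (E d)) : Set (E d) :=
  {z | ∃ x ∈ V, ∃ y ∈ V, dist x y < r ∧ z ∈ segment ℝ x y}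

/-- `C` is a connected component of the set `G`. -/
def IsComponentOf {d : ℕ} (C G : Set (E d)) : Prop :=
  ∃ x ∈ G, C = connectedComponentIn G x

/-- `C` is a connected component of `g_r(ν) ∩ Q_{5s}` that meets both `∂Q_{3s}` and `∂Q_{5s}`. -/
def IsCrossing {d : ℕ} (r s : ℝ) (ν : Measure (E d)) (C : Set (E d)) : Prop :=
  IsComponentOf C (gilbertSet r (atoms ν) ∩ cube (5 * s) 0) ∧
    (C ∩ frontier (cube (3 * s) 0)).Nonempty ∧ (C ∩ frontier (cube (5 * s) 0)).Nonempty

/-- There is exactly one crossing component, and it meets `Q_s`. -/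
def CrossingEvent {d : ℕ} (r s : ℝ) (ν : Measure (E d)) : Prop :=
  ∃ C, IsCrossing r s ν C ∧ (∀ C', IsCrossing r s ν C' → C' = C) ∧ (C ∩ cube s 0).Nonempty

/-! ### Random measures, stabilization, Cox processes -/

/-- A stationary random measure of intensity one. -/
structure IsEnvironment {d : ℕ} {Ω : Type*} [MeasurableSpace Ω] (P : Measure Ω)
    (Lam : Ω → Measure (E d)) : Prop where
  measurable : Measurable Lam
  stationary : ∀ t : E d, IdentDistrib (fun ω => shift t (Lam ω)) Lam P P
  intensity : ∫⁻ ω, Lam ω {y | ∀ i, y i ∈ Icc (0 : ℝ) 1} ∂P = 1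

/-- The supremum of the field `R` over the points of `Q_n(x)` with rational coordinates. -/
def radiusSup {d : ℕ} {Ω : Type*} (R : E d → Ω → ℝ≥0∞) (n : ℝ) (x : E d) (ω : Ω) : ℝ≥0∞ :=
  ⨆ y ∈ cube n x ∩ ratPoints d, R y ω

/-- The event that all stabilization radii at rational points of `Q_n(x)` are, with a uniform
margin, smaller than `m` : their supremum is less than `m`. -/
def smallRadii {d : ℕ} {Ω : Type*} (R : E d → Ω → ℝ≥0∞) (n : ℝ) (x : E d) (m : ℝ) : Set Ω :=
  {ω | radiusSup R n x ω < ENNReal.ofReal m}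

/-- The random measure `Lam` is stabilizing, with the random field `R` of stabilization radii. -/
structure IsStabilizing {d : ℕ} {Ω : Type*} [MeasurableSpace Ω] (P : Measure Ω)
    (Lam : Ω → Measure (E d)) (R : E d → Ω → ℝ≥0∞) : Prop where
  measurable : ∀ x, Measurable (R x)
  jointly_stationary : ∀ t : E d,
    IdentDistrib (fun ω => (shift t (Lam ω), fun x => R (x + t) ω))
      (fun ω => (Lam ω, fun x => R x ω)) P P
  tendsto_one : Tendsto (fun n : ℕ => P.real (smallRadii R n (0 : E d) n)) atTop (𝓝 1)
  indep : ∀ n : ℕ, 1 ≤ n → ∀ f : Measure (E d) → ℝ≥0, Measurable f → (∃ c, ∀ ν, f ν ≤ c) →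
    ∀ φ : Finset (E d), (∀ x ∈ φ, ∀ y ∈ φ, x ≠ y → 3 * (n : ℝ) < dist x y) →
      iIndepFun (fun (x : φ) (ω : Ω) =>
        (smallRadii R n (x : E d) n).indicator
          (fun ω => f ((Lam ω).restrict (cube n (x : E d)))) ω) P

/-- `ν` is a locally finite counting measure. -/
def IsPointConfiguration {d : ℕ} (ν : Measure (E d)) : Prop :=
  ∀ B : Set (E d), MeasurableSet B → Bornology.IsBounded B → ∃ k : ℕ, ν B = k

/-- `X` is a Cox process with random intensity measure `l • Lam` : it is a point process, and,
conditionally on `Lam`, its numbers of points in disjoint bounded Borel sets are independent and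
Poisson distributed with means given by `l • Lam`. -/
structure IsCox {d : ℕ} {Ω : Type*} [MeasurableSpace Ω] (P : Measure Ω)
    (Lam : Ω → Measure (E d)) (l : ℝ) (X : Ω → Measure (E d)) : Prop where
  measurable : Measurable X
  counting : ∀ᵐ ω ∂P, IsPointConfiguration (X ω)
  law : ∀ (m : ℕ) (B : Fin m → Set (E d)) (k : Fin m → ℕ) (A : Set (Measure (E d))),
    (∀ i, MeasurableSet (B i)) → (∀ i, Bornology.IsBounded (B i)) →
    Pairwise (fun i j => Disjoint (B i) (B j)) → MeasurableSet A →
    P {ω | Lam ω ∈ A ∧ ∀ i, X ω (B i) = (k i : ℝ≥0∞)} =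
      ∫⁻ ω in Lam ⁻¹' A,
        ∏ i, poissonMeasure (l.toNNReal * (Lam ω (B i)).toNNReal) {k i} ∂P

/-- The expectation `𝔼[f(X^*)]` of a functional of the Palm version `X^*` of a stationary point
process `X` of intensity `l`, that is, `l⁻¹ 𝔼[∑_{X_i ∈ Q_1} f(X - X_i)]`, where points
are counted with multiplicity. -/
def palmExpectation {d : ℕ} {Ω : Type*} [MeasurableSpace Ω] (P : Measure Ω) (l : ℝ)
    (X : Ω → Measure (E d)) (f : Measure (E d) → ℝ≥0∞) : ℝ≥0∞ :=
  (ENNReal.ofReal l)⁻¹ * ∫⁻ ω, ∫⁻ x in cube 1 (0 : E d), f (shift x (X ω)) ∂(X ω) ∂P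

/-- The probability that the Palm version `X^*` has the property `A`. -/
def palmProb {d : ℕ} {Ω : Type*} [MeasurableSpace Ω] (P : Measure Ω) (l : ℝ)
    (X : Ω → Measure (E d)) (A : Set (Measure (E d))) : ℝ :=
  (palmExpectation P l X (A.indicator 1)).toReal

/-- The percolation probability `θ(l, r)` of the Cox process `X` of intensity `l`. -/
def theta {d : ℕ} {Ω : Type*} [MeasurableSpace Ω] (P : Measure Ω) (X : Ω → Measure (E d))
    (l r : ℝ) : ℝ :=
  palmProb P l X {ν | ConnectedToInfinity r ν}

/-- The finite-volume percolation probability `θ_a(l, r)`. -/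
def thetaBox {d : ℕ} {Ω : Type*} [MeasurableSpace Ω] (P : Measure Ω) (X : Ω → Measure (E d))
    (a l r : ℝ) : ℝ :=
  palmProb P l X {ν | ConnectedToBoundary a r ν}

end CoxPercolation

end

/-! An infinite cluster of a locally finite configuration leaves every cube, so `theta_le_thetaBox`
gives the upper bound on `θ`. The substance is the converse `exists_eventually_thetaBox_le`: for
every `ε > 0` there is a `K` with `θ_{K s(r)} ≤ θ + ε` for all `r` close to the limit.

The engine is a renormalization that works in every dimension at least two. `Uniq` says that
crossing clusters are unique at a given scale and place. If it holds at scale `g` at all sites of a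
large lattice cube, except near a single site, then a crossing cluster can be followed around the
exceptional site, and `Uniq` holds at scale `1000 g` (`GoodExcept.uniq_next`). So a bad site at the
larger scale has two well separated bad sites below it. Iterating, a bad site at scale `1000^n` is
the root of a binary tree with `2^n` separated bad leaves (`exists_tree_of_not_uniq`). There are at
most `N^(2^n)` such trees for some `N = N(d)`, and stabilization together with the conditional
independence of the Cox process bounds the probability of each by `p^(2^n)`
(`IsCox.measure_biInter_le`). Once `N p ≤ 1/2`, which is one of the conditions on `q_d`, the
probabilities are summable over the scales. Outside of a rare event, sites near the origin are good
at all scales from some `n₀` on, and then a cluster that leaves one large cube leaves all of them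
(`infinite_of_exits`).

A rare event may still be seen by many points, so small probability does not directly mean small
Palm probability. Uniform integrability of the masses of unit cubes bounds the mean number of points
in a large cube on a rare event, and a pigeonhole argument finds a position of the unit cube
relative to the event at which few points are affected (`exists_lintegral_count_shift_le`). This
needs the mean number of points per scale to be bounded below.

If `r ≤ s(r)/10`, the crossing event implies `Uniq` at the scale `s(r)/2` and the engine applies
directly. This covers `r → 0`. For `r → ∞` and `r > s(r)/10` the engine runs at scale `10 r`, with
full occupation of a fine grid as the good event (`window`). The crossing event forces points to
exist, hence `l r^d ≥ Y` with `Y = Y(d)` as large as required (`le_mul_pow_of_crossingEvent`), and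
stabilization makes occupation likely for large `r` (`eventually_lintegral_exp_neg_le`). This
compares `θ` with boxes of order `r`, which suffices if `r ≤ ρ s(r)`. If `r > ρ s(r)`, edges must
pass close to each of many points of a parabola of size `r` with high probability, while one segment
comes close to at most two of them. So there are very many points within distance of order `r`
(`exists_le_mul_pow_of_crossingEvent`), and `θ ≥ 1 - ε` outright. -/

namespace CoxPercolation

variable {d : ℕ}

/-! ### Chains of points, and unique crossing clusters -/

/-- The points `x` and `y` are joined by a chain of points of `V` with steps shorter than `r`. -/
def Linked (r : ℝ) (V : Set (E d)) : E d → E d → Prop :=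
  Relation.ReflTransGen (fun x y => x ∈ V ∧ y ∈ V ∧ dist x y < r)

/-- The closed cube with centre `z` and half side length `ρ`. -/
def box (ρ : ℝ) (z : E d) : Set (E d) := {y | ∀ i, |y i - z i| ≤ ρ}

/-- The open cube with centre `z` and half side length `ρ`. -/
def openBox (ρ : ℝ) (z : E d) : Set (E d) := {y | ∀ i, |y i - z i| < ρ}

/-- The cluster of `x` is not contained in the open cube with half side length `5 g`. -/
def Exits (r : ℝ) (V : Set (E d)) (g : ℝ) (z x : E d) : Prop :=
  ∃ y, Linked r V x y ∧ y ∉ openBox (5 * g) z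

/-- There is exactly one cluster that meets the cube with half side length `3 g` and leaves the
open cube with half side length `5 g`, and this cluster meets the cube with half side length
`6 g / 5`. -/
structure Uniq (r : ℝ) (V : Set (E d)) (g : ℝ) (z : E d) : Prop where
  exists_exits : ∃ x ∈ V, x ∈ box (6 / 5 * g) z ∧ Exits r V g z x
  linked : ∀ x ∈ V, ∀ x' ∈ V, x ∈ box (3 * g) z → x' ∈ box (3 * g) z →
    Exits r V g z x → Exits r V g z x' → Linked r V x x'

/-- The cluster of `v` meets the cube with half side length `3 g` and leaves the open cube with
half side length `5 g`. -/
def Crosses (r : ℝ) (V : Set (E d)) (g : ℝ) (z v : E d) : Prop :=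
  (∃ x, Linked r V v x ∧ x ∈ box (3 * g) z) ∧ Exits r V g z v

section Linked

variable {r : ℝ} {V : Set (E d)} {g : ℝ}

lemma Linked.symm {x y : E d} (h : Linked r V x y) : Linked r V y x :=
  (@Relation.ReflTransGen.stdSymm _ _
    ⟨fun _ _ h => ⟨h.2.1, h.1, by rw [dist_comm]; exact h.2.2⟩⟩).symm _ _ h

lemma Linked.mem {x y : E d} (h : Linked r V x y) (hx : x ∈ V) : y ∈ V := by
  induction h with
  | refl => exact hx
  | tail _ h _ => exact h.2.1

lemma Linked.trans {x y z : E d} (h : Linked r V x y) (h' : Linked r V y z) : Linked r V x z :=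
  Relation.ReflTransGen.trans h h'

lemma Linked.mono {V' : Set (E d)} {x y : E d} (hV : V ⊆ V') (h : Linked r V x y) :
    Linked r V' x y :=
  Relation.ReflTransGen.mono (fun _ _ h => ⟨hV h.1, hV h.2.1, h.2.2⟩) _ _ h

lemma Linked.single {x y : E d} (hx : x ∈ V) (hy : y ∈ V) (h : dist x y < r) : Linked r V x y :=
  Relation.ReflTransGen.single ⟨hx, hy, h⟩

lemma Exits.of_linked {z x y : E d} (h : Linked r V x y) (hx : Exits r V g z x) :
    Exits r V g z y := by
  obtain ⟨w, hw, hw'⟩ := hx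
  exact ⟨w, h.symm.trans hw, hw'⟩

lemma Uniq.linked_of_crosses {z v v' : E d} (h : Uniq r V g z) (hv : v ∈ V) (hv' : v' ∈ V)
    (hc : Crosses r V g z v) (hc' : Crosses r V g z v') : Linked r V v v' := by
  obtain ⟨⟨x, hx, hx3⟩, he⟩ := hc
  obtain ⟨⟨x', hx', hx3'⟩, he'⟩ := hc'
  exact (hx.trans (h.linked x (hx.mem hv) x' (hx'.mem hv') hx3 hx3' (he.of_linked hx)
    (he'.of_linked hx'))).trans hx'.symm

lemma box_subset {ρ ρ' : ℝ} (h : ρ ≤ ρ') (z : E d) : box ρ z ⊆ box ρ' z :=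
  fun _ hy i => (hy i).trans h

lemma Uniq.exists_linked (hg : 0 < g) {z v : E d} (h : Uniq r V g z) (hv : v ∈ V)
    (hc : Crosses r V g z v) : ∃ x, Linked r V v x ∧ x ∈ box (6 / 5 * g) z := by
  obtain ⟨x, hx, hx1, hxe⟩ := h.exists_exits
  refine ⟨x, h.linked_of_crosses hv hx hc
    ⟨⟨x, Relation.ReflTransGen.refl, box_subset (by linarith) _ hx1⟩, hxe⟩, hx1⟩

lemma abs_sub_le_dist (x y : E d) (i : Fin d) : |x i - y i| ≤ dist x y := by
  rw [dist_eq_norm]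
  exact PiLp.norm_apply_le (x - y) i

end Linked

/-! ### Lattice paths -/

/-- The site with index `j` of the lattice with spacing `g` through `b`. -/
def site (g : ℝ) (b : E d) (j : Fin d → ℤ) : E d := WithLp.toLp 2 (fun i => b i + g * j i)

@[simp] lemma site_apply (g : ℝ) (b : E d) (j : Fin d → ℤ) (i : Fin d) :
    site g b j i = b i + g * j i := rfl

/-- The points `a` and `b` are joined by a nearest-neighbour path in `S`. -/
def LatticePath (S : Set (Fin d → ℤ)) : (Fin d → ℤ) → (Fin d → ℤ) → Prop :=
  Relation.ReflTransGen (fun a b => a ∈ S ∧ b ∈ S ∧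
    ∃ (i : Fin d) (ε : ℤ), (ε = 1 ∨ ε = -1) ∧ b = a + Pi.single i ε)

lemma LatticePath.symm {S : Set (Fin d → ℤ)} {a b : Fin d → ℤ} (h : LatticePath S a b) :
    LatticePath S b a := by
  refine (@Relation.ReflTransGen.stdSymm _ _ ⟨?_⟩).symm _ _ h
  rintro a b ⟨ha, hb, i, ε, hε, rfl⟩
  refine ⟨hb, ha, i, -ε, by omega, ?_⟩
  rw [add_assoc, ← Pi.single_add]; simp

lemma latticePath_update_aux {S : Set (Fin d → ℤ)} (i : Fin d) (n : ℕ) :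
    ∀ (j : Fin d → ℤ) (t : ℤ), (t - j i).natAbs = n →
      (∀ u ∈ uIcc (j i) t, Function.update j i u ∈ S) →
      LatticePath S j (Function.update j i t) := by
  induction n with
  | zero =>
    intro j t ht _
    have : t = j i := by omega
    rw [this, Function.update_eq_self]
    exact Relation.ReflTransGen.refl
  | succ n ih =>
    intro j t ht h
    obtain ⟨ε, hε, hn⟩ : ∃ ε : ℤ, (ε = 1 ∨ ε = -1) ∧ (t - (j i + ε)).natAbs = n := by
      rcases le_total (j i) t with h' | h'
      · exact ⟨1, Or.inl rfl, by omega⟩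
      · exact ⟨-1, Or.inr rfl, by omega⟩
    have hj : j + Pi.single i ε = Function.update j i (j i + ε) := by
      ext k
      rcases eq_or_ne k i with rfl | hk
      · simp
      · simp [hk]
    have hsub : ∀ u, u ∈ uIcc (j i + ε) t → u ∈ uIcc (j i) t := by
      intro u hu
      rw [mem_uIcc] at hu ⊢
      omega
    have h0 : j ∈ S := by simpa using h (j i) left_mem_uIcc
    have h1 : Function.update j i (j i + ε) ∈ S := h _ (hsub _ left_mem_uIcc)
    have := ih (Function.update j i (j i + ε)) t (by simpa using hn)
      (fun u hu => by
        rw [Function.update_idem]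
        exact h u (hsub u (by simpa using hu)))
    rw [Function.update_idem] at this
    exact Relation.ReflTransGen.head ⟨h0, h1, i, ε, hε, hj.symm⟩ this

lemma latticePath_update {S : Set (Fin d → ℤ)} (i : Fin d) (j : Fin d → ℤ) (t : ℤ)
    (h : ∀ u ∈ uIcc (j i) t, Function.update j i u ∈ S) :
    LatticePath S j (Function.update j i t) :=
  latticePath_update_aux i _ j t rfl h

/-- The lattice cube of radius `J`, with the lattice cube of radius `c` around `j₀` removed. -/
def holed (J c : ℤ) (j₀ : Fin d → ℤ) : Set (Fin d → ℤ) :=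
  {j | (∀ i, |j i| ≤ J) ∧ ∃ i, c < |j i - j₀ i|}

/-- The coordinate in which `p` is far from `j₀` keeps the path out of the hole while all other
coordinates are moved to those of `q`. After that, any other coordinate protects the last move; this
second coordinate is where `2 ≤ d` enters. -/
lemma latticePath_holed_corner (hd : 2 ≤ d) {J c : ℤ} {j₀ q p : Fin d → ℤ} (hq : ∀ i, |q i| ≤ J)
    (hq' : ∀ i, c < |q i - j₀ i|) (hp : p ∈ holed J c j₀) :
    LatticePath (holed J c j₀) p q := by
  obtain ⟨hpJ, i, hi⟩ := hp
  have hmem : ∀ (k : Fin d) (j : Fin d → ℤ) (m : Fin d) , m ≠ k → (∀ i, |j i| ≤ J) →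
      c < |j m - j₀ m| → ∀ u ∈ uIcc (j k) (q k), Function.update j k u ∈ holed J c j₀ := by
    intro k j m hm hj hjm u hu
    refine ⟨fun l => ?_, m, by rwa [Function.update_of_ne hm]⟩
    rcases eq_or_ne l k with rfl | hl
    · rw [Function.update_self]
      have h1 := abs_le.1 (hj l); have h2 := abs_le.1 (hq l)
      rw [mem_uIcc] at hu; rw [abs_le]; omega
    · rw [Function.update_of_ne hl]; exact hj l
  have key : ∀ s : Finset (Fin d), i ∉ s → LatticePath (holed J c j₀) p (s.piecewise q p) := by
    intro s
    induction s using Finset.induction_on with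
    | empty => intro _; rw [Finset.piecewise_empty]; exact Relation.ReflTransGen.refl
    | insert k s hk ih =>
      intro his
      rw [Finset.mem_insert, not_or] at his
      rw [Finset.piecewise_insert]
      refine Relation.ReflTransGen.trans (ih his.2) (latticePath_update _ _ _ ?_)
      refine hmem k _ i his.1 (fun l => ?_) ?_
      · by_cases hl : l ∈ s
        · rw [Finset.piecewise_eq_of_mem _ _ _ hl]; exact hq l
        · rw [Finset.piecewise_eq_of_notMem _ _ _ hl]; exact hpJ l
      · rw [Finset.piecewise_eq_of_notMem _ _ _ his.2]; exact hi
  have h1 := key (Finset.univ.erase i) (by simp)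
  refine Relation.ReflTransGen.trans h1 ?_
  obtain ⟨m, hm⟩ : ∃ m : Fin d, m ≠ i := by
    have : Nontrivial (Fin d) := Fin.nontrivial_iff_two_le.2 hd
    exact exists_ne i
  have hq2 : q = Function.update ((Finset.univ.erase i).piecewise q p) i (q i) := by
    ext k
    rcases eq_or_ne k i with rfl | hk
    · simp
    · rw [Function.update_of_ne hk, Finset.piecewise_eq_of_mem _ _ _ (by simp [hk])]
  conv_rhs => rw [hq2]
  refine latticePath_update _ _ _ (hmem i _ m hm (fun l => ?_) ?_)
  · by_cases hl : l ∈ Finset.univ.erase i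
    · rw [Finset.piecewise_eq_of_mem _ _ _ hl]; exact hq l
    · rw [Finset.piecewise_eq_of_notMem _ _ _ hl]; exact hpJ l
  · rw [Finset.piecewise_eq_of_mem _ _ _ (by simp [hm])]; exact hq' m

/-- A lattice cube stays connected when a smaller lattice cube is removed. -/
lemma latticePath_holed (hd : 2 ≤ d) {J c : ℤ} (hJ : 0 ≤ J) (hcJ : c < J) (j₀ : Fin d → ℤ)
    {p p' : Fin d → ℤ} (hp : p ∈ holed J c j₀) (hp' : p' ∈ holed J c j₀) :
    LatticePath (holed J c j₀) p p' := by
  -- The corner pointing away from `j₀`: each of its coordinates differs from that of `j₀` by at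
  -- least `J > c`.
  have hq : ∀ i, |(fun i => if j₀ i ≤ 0 then J else -J) i| ≤ J := by
    intro i; dsimp only; split_ifs <;> simp [abs_of_nonneg hJ]
  have hq' : ∀ i, c < |(fun i => if j₀ i ≤ 0 then J else -J) i - j₀ i| := by
    intro i; dsimp only
    split_ifs with h
    · rw [abs_of_nonneg (by omega)]; omega
    · rw [abs_of_nonpos (by omega)]; omega
  exact Relation.ReflTransGen.trans (latticePath_holed_corner hd hq hq' hp)
    (latticePath_holed_corner hd hq hq' hp').symm

/-! ### From one scale to the next -/

section Step

variable {r : ℝ} {V : Set (E d)} {g : ℝ} {b : E d}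

/-- A cluster that crosses at a site crosses at the neighbouring site as well, if crossing clusters
are unique at the site and at the six sites behind it. -/
lemma Crosses.neighbour (hg : 0 < g) {j : Fin d → ℤ} {v : E d} (hv : v ∈ V) (i : Fin d) {ε : ℤ}
    (hε : ε = 1 ∨ ε = -1)
    (h : ∀ k : ℕ, k ≤ 6 → Uniq r V g (site g b (j - Pi.single i (k * ε))))
    (hc : Crosses r V g (site g b j) v) : Crosses r V g (site g b (j + Pi.single i ε)) v := by
  have hεε : (ε : ℝ) = 1 ∨ (ε : ℝ) = -1 := by
    rcases hε with rfl | rfl <;> simp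
  have hcast : ∀ (t : ℤ) (l : Fin d), (j + Pi.single i t : Fin d → ℤ) l =
      j l + if l = i then t else 0 := by
    intro t l; simp [Pi.single_apply]
  have hcast' : ∀ (t : ℤ) (l : Fin d), (j - Pi.single i t : Fin d → ℤ) l =
      j l - if l = i then t else 0 := by
    intro t l; simp [Pi.single_apply]
  have hx0 : ∃ x, Linked r V v x ∧ x ∈ box (6 / 5 * g) (site g b j) := by
    have := h 0 (by norm_num)
    simp only [Nat.cast_zero, zero_mul, Pi.single_zero, sub_zero] at this
    exact this.exists_linked hg hv hc
  obtain ⟨x0, hvx0, hx0⟩ := hx0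
  have hmeet : ∃ x, Linked r V v x ∧ x ∈ box (3 * g) (site g b (j + Pi.single i ε)) := by
    refine ⟨x0, hvx0, fun l => ?_⟩
    have := abs_le.1 (hx0 l)
    simp only [site_apply, hcast] at this ⊢
    rw [abs_le]
    split_ifs
    · push_cast; rcases hεε with h | h <;> rw [h] <;> constructor <;> nlinarith
    · push_cast; constructor <;> nlinarith
  refine ⟨hmeet, ?_⟩
  -- Otherwise the cluster is confined to the cube around the site in front. As it leaves the cube
  -- around `j`, it does so at the back, and uniqueness at the sites behind drags it further and
  -- further back.
  by_contra hne
  have hin : ∀ y, Linked r V v y → y ∈ openBox (5 * g) (site g b (j + Pi.single i ε)) := by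
    intro y hy
    by_contra hy'
    exact hne ⟨y, hy, hy'⟩
  have key : ∀ k : ℕ, k ≤ 6 → Crosses r V g (site g b (j - Pi.single i (k * ε))) v := by
    intro k
    induction k with
    | zero => intro _; simpa using hc
    | succ k ih =>
      intro hk
      have hck := ih (by omega)
      obtain ⟨x, hvx, hx⟩ := (h k (by omega)).exists_linked hg hv hck
      refine ⟨⟨x, hvx, fun l => ?_⟩, ?_⟩
      · have := abs_le.1 (hx l)
        simp only [site_apply, hcast'] at this ⊢
        rw [abs_le]
        split_ifs at this ⊢
        · push_cast at this ⊢
          rcases hεε with h | h <;> rw [h] at this ⊢ <;> constructor <;> nlinarith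
        · push_cast at this ⊢; constructor <;> nlinarith
      -- A point in the open cubes around both the front site and the site `k + 1` steps behind is
      -- also in the one around `j`, which lies between them. But the cluster leaves that cube.
      · by_contra hne'
        obtain ⟨y, hy, hy'⟩ := hc.2
        refine hy' fun l => ?_
        have h1 := abs_lt.1 (hin y hy l)
        have h2 : y ∈ openBox (5 * g) (site g b (j - Pi.single i ((k + 1 : ℕ) * ε))) := by
          by_contra hy2; exact hne' ⟨y, hy, hy2⟩
        have h2 := abs_lt.1 (h2 l)
        simp only [site_apply, hcast, hcast'] at h1 h2 ⊢
        rw [abs_lt]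
        have hgk : 0 ≤ g * (k : ℝ) := by positivity
        split_ifs at h1 h2 <;> push_cast at h1 h2
        · rcases hεε with h | h <;> rw [h] at h1 h2 <;> constructor <;> nlinarith
        · constructor <;> nlinarith
  -- Six steps back, the cluster has a point at least `6 - 6/5 = 4.8` spacings behind `j`, while the
  -- cube around the front site reaches only `4` spacings behind `j`. Five steps would give `3.8`,
  -- which is not enough.
  obtain ⟨x, hvx, hx⟩ := (h 6 le_rfl).exists_linked hg hv (key 6 le_rfl)
  have h1 := abs_le.1 (hx i)
  have h2 := abs_lt.1 (hin x hvx i)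
  simp only [site_apply, hcast, hcast', if_true] at h1 h2
  push_cast at h1 h2
  rcases hεε with h | h <;> rw [h] at h1 h2 <;> nlinarith

/-- All sites of a lattice cube except those near `j₀` are unique crossing sites. -/
def GoodExcept (r : ℝ) (V : Set (E d)) (g : ℝ) (b : E d) (j₀ : Fin d → ℤ) : Prop :=
  ∀ j : Fin d → ℤ, (∀ i, |j i| ≤ 7000) → (∃ i, 80 < |j i - j₀ i|) → Uniq r V g (site g b j)

variable {j₀ : Fin d → ℤ}

/-- The margins between `6990`, `90` and `7000`, `80` make room for the six sites behind that
`Crosses.neighbour` inspects. -/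
lemma GoodExcept.uniq_sub (h : GoodExcept r V g b j₀) {j : Fin d → ℤ}
    (hj : j ∈ holed 6990 90 j₀) (i : Fin d) {t : ℤ} (ht : |t| ≤ 6) :
    Uniq r V g (site g b (j - Pi.single i t)) := by
  obtain ⟨hJ, m, hm⟩ := hj
  have ht := abs_le.1 ht
  refine h _ (fun l => ?_) ⟨m, ?_⟩
  · have := abs_le.1 (hJ l)
    rw [abs_le]
    simp only [Pi.sub_apply, Pi.single_apply]
    split_ifs <;> omega
  · simp only [Pi.sub_apply, Pi.single_apply]
    rw [lt_abs] at hm ⊢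
    split_ifs <;> omega

lemma GoodExcept.uniq (h : GoodExcept r V g b j₀) {j : Fin d → ℤ}
    (hj : j ∈ holed 6990 90 j₀) : Uniq r V g (site g b j) := by
  obtain ⟨hJ, m, hm⟩ := hj
  exact h _ (fun l => (hJ l).trans (by norm_num)) ⟨m, by omega⟩

/-- Crossing is passed on along a lattice path around the exceptional region, one neighbour at a
time. -/
lemma GoodExcept.crosses (hd : 2 ≤ d) (hg : 0 < g) (h : GoodExcept r V g b j₀)
    {p p' : Fin d → ℤ} (hp : p ∈ holed 6990 90 j₀) (hp' : p' ∈ holed 6990 90 j₀) {v : E d}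
    (hv : v ∈ V) (hc : Crosses r V g (site g b p) v) : Crosses r V g (site g b p') v := by
  have hpath := latticePath_holed hd (by norm_num) (by norm_num) j₀ hp hp'
  induction hpath with
  | refl => exact hc
  | tail _ hstep ih =>
    obtain ⟨ha, hb, i, ε, hε, rfl⟩ := hstep
    refine (ih ha).neighbour hg hv i hε fun k hk => h.uniq_sub ha i ?_
    rcases hε with rfl | rfl <;> rw [abs_le] <;> omega

/-- A point of the cluster of a crossing point close to a site away from the exceptional one. -/
lemma GoodExcept.exists_crosses (hg : 0 < g) (hr : r ≤ g / 5)
    {x : E d} (hx : x ∈ box (3 * (1000 * g)) b)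
    (he : Exits r V (1000 * g) b x) : ∃ j ∈ holed 6990 90 j₀, Crosses r V g (site g b j) x := by
  obtain ⟨w, hw, hwb⟩ := he
  set ρ : E d → Fin d → ℤ := fun y i => round ((y i - b i) / g) with hρ
  have hround : ∀ y i, |y i - (b i + g * ρ y i)| ≤ g / 2 := by
    intro y i
    have := abs_sub_round ((y i - b i) / g)
    have h2 : y i - (b i + g * ρ y i) = g * ((y i - b i) / g - round ((y i - b i) / g)) := by
      simp only [hρ]; field_simp; ring
    rw [h2, abs_mul, abs_of_pos hg]
    nlinarith
  have hρbd : ∀ y, y ∈ box (4000 * g) b → ∀ i, |ρ y i| ≤ 4001 := by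
    intro y hy i
    have h1 := abs_le.1 (hround y i)
    have h2 := abs_le.1 (hy i)
    have h3 : (ρ y i : ℝ) < 4001 + 1 := by
      by_contra hcon; push Not at hcon; nlinarith
    have h4 : (-4001 - 1 : ℝ) < ρ y i := by
      by_contra hcon; push Not at hcon; nlinarith
    have h3' : ρ y i < 4001 + 1 := by exact_mod_cast h3
    have h4' : -4001 - 1 < ρ y i := by exact_mod_cast h4
    rw [abs_le]; omega
  -- Either the cluster visits a place away from the exceptional site and crosses there, or its part
  -- in the cube of half side `4000 g` stays within `91 g` of that site. In the second case it
  -- cannot bridge the gap from `3000 g` to `4000 g` with steps shorter than `g / 5`.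
  by_cases hex : ∃ y, Linked r V x y ∧ y ∈ box (4000 * g) b ∧ ∃ i, 90 < |ρ y i - j₀ i|
  · obtain ⟨y, hy, hyb, hyj⟩ := hex
    refine ⟨ρ y, ⟨fun i => (hρbd y hyb i).trans (by norm_num), hyj⟩, ⟨y, hy, fun i => ?_⟩, w, hw,
      fun hw' => hwb fun i => ?_⟩
    · rw [site_apply]; have := hround y i; linarith
    · have h1 := abs_le.1 (hround y i)
      have h2 := abs_le.1 (hyb i)
      have h3 := abs_lt.1 (hw' i)
      rw [site_apply] at h3
      rw [abs_lt]; constructor <;> nlinarith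
  · exfalso
    push Not at hex
    have hnear : ∀ y, Linked r V x y → y ∈ box (4000 * g) b →
        ∀ i, |y i - (b i + g * j₀ i)| ≤ 91 * g := by
      intro y hy hyb i
      have h1 := abs_le.1 (hround y i)
      have h2 := abs_le.1 (hex y hy hyb i)
      have h3 : ((ρ y i : ℝ) - j₀ i) ≤ 90 := by exact_mod_cast h2.2
      have h4 : (-90 : ℝ) ≤ (ρ y i : ℝ) - j₀ i := by exact_mod_cast h2.1
      rw [abs_le]; constructor <;> nlinarith
    have hx4 : x ∈ box (4000 * g) b := box_subset (by linarith) _ hx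
    have hall : ∀ y, Linked r V x y → y ∈ box (4000 * g) b := by
      intro y hy
      induction hy with
      | refl => exact hx4
      | tail hxy hstep ih =>
        rename_i u y'
        intro i
        have h1 := abs_le.1 (hnear u hxy ih i)
        have h2 := abs_le.1 (hnear x Relation.ReflTransGen.refl hx4 i)
        have h3 := abs_le.1 ((abs_sub_le_dist u y' i).trans hstep.2.2.le)
        have h4 := abs_le.1 (hx i)
        rw [abs_le]; constructor <;> linarith
    exact hwb fun i => lt_of_le_of_lt (hall w hw i) (by linarith)

/-- Unique crossing at all but a few neighbouring sites implies unique crossing at the next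
scale. -/
theorem GoodExcept.uniq_next (hd : 2 ≤ d) (hg : 0 < g) (hr : r ≤ g / 5)
    (h : GoodExcept r V g b j₀) : Uniq r V (1000 * g) b := by
  obtain ⟨i₀⟩ : Nonempty (Fin d) := ⟨⟨0, by omega⟩⟩
  -- A crossing cluster at the central site `p` meets the cube of half side `1200 g`; transported to
  -- the remote site `q` it leaves the cube of half side `5000 g`.
  obtain ⟨p, hp, hpn⟩ : ∃ p ∈ holed 6990 90 j₀, ∀ i, |p i| ≤ 200 := by
    by_cases h0 : 90 < |j₀ i₀|
    · exact ⟨0, ⟨by simp, i₀, by simpa using h0⟩, by simp⟩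
    · refine ⟨fun _ => 200, ⟨by simp, i₀, ?_⟩, by simp⟩
      rw [lt_abs] at h0 ⊢; push Not at h0; dsimp only; omega
  obtain ⟨q, hq, hqn⟩ : ∃ q ∈ holed 6990 90 j₀, 6000 ≤ |q i₀| := by
    by_cases h0 : j₀ i₀ ≤ 0
    · exact ⟨fun _ => 6000, ⟨by simp, i₀, by rw [lt_abs]; dsimp only; omega⟩, by simp⟩
    · exact ⟨fun _ => -6000, ⟨by simp, i₀, by rw [lt_abs]; dsimp only; omega⟩, by simp⟩
  constructor
  · obtain ⟨x, hx, hx1, hxe⟩ := (h.uniq hp).exists_exits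
    have hc : Crosses r V g (site g b p) x :=
      ⟨⟨x, Relation.ReflTransGen.refl, box_subset (by linarith) _ hx1⟩, hxe⟩
    refine ⟨x, hx, fun i => ?_, ?_⟩
    · have h1 := abs_le.1 (hx1 i)
      have h2 := abs_le.1 (hpn i)
      have h3 : (p i : ℝ) ≤ 200 := by exact_mod_cast h2.2
      have h4 : (-200 : ℝ) ≤ p i := by exact_mod_cast h2.1
      rw [site_apply] at h1
      rw [abs_le]; constructor <;> nlinarith
    · obtain ⟨y, hy, hy1⟩ := (h.uniq hq).exists_linked hg hx (h.crosses hd hg hp hq hx hc)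
      refine ⟨y, hy, fun hy' => ?_⟩
      have h1 := abs_le.1 (hy1 i₀)
      have h2 := abs_lt.1 (hy' i₀)
      rw [site_apply] at h1
      rcases le_abs.1 hqn with h3 | h3
      · have h4 : (6000 : ℝ) ≤ q i₀ := by exact_mod_cast h3
        nlinarith
      · have h4 : (6000 : ℝ) ≤ -q i₀ := by exact_mod_cast h3
        nlinarith
  · intro x hx x' hx' hxb hxb' he he'
    obtain ⟨j, hj, hc⟩ := GoodExcept.exists_crosses (j₀ := j₀) hg hr hxb he
    obtain ⟨j', hj', hc'⟩ := GoodExcept.exists_crosses (j₀ := j₀) hg hr hxb' he'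
    exact (h.uniq hj).linked_of_crosses hx hx' hc (h.crosses hd hg hj' hj hx' hc')

/-- If all sites are unique crossing sites, then a cluster that leaves the cube around the central
site also leaves the cube at the next scale. -/
theorem Exits.next (hd : 2 ≤ d) (hg : 0 < g)
    (h : ∀ j : Fin d → ℤ, (∀ i, |j i| ≤ 7000) → Uniq r V g (site g b j))
    {x : E d} (hx : x ∈ V) (hxb : x ∈ box (3 * g) b) (he : Exits r V g b x) :
    Exits r V (1000 * g) b x := by
  obtain ⟨i₀⟩ : Nonempty (Fin d) := ⟨⟨0, by omega⟩⟩
  -- No site is exceptional here. The value `100` is a dummy that keeps `0` and the remote site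
  -- outside of the hole of radius `90`.
  have h' : GoodExcept r V g b (fun _ => 100) := fun j hj _ => h j hj
  have hp : (0 : Fin d → ℤ) ∈ holed 6990 90 (fun _ : Fin d => (100 : ℤ)) :=
    ⟨by simp, i₀, by simp⟩
  have hq : (fun _ => 6000 : Fin d → ℤ) ∈ holed 6990 90 (fun _ : Fin d => (100 : ℤ)) :=
    ⟨by simp, i₀, by simp⟩
  have hb : site g b 0 = b := by ext i; simp
  have hc : Crosses r V g (site g b 0) x := by
    rw [hb]; exact ⟨⟨x, Relation.ReflTransGen.refl, hxb⟩, he⟩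
  obtain ⟨y, hy, hy1⟩ := (h'.uniq hq).exists_linked hg hx (h'.crosses hd hg hp hq hx hc)
  refine ⟨y, hy, fun hy' => ?_⟩
  have h1 := abs_le.1 (hy1 i₀)
  have h2 := abs_lt.1 (hy' i₀)
  rw [site_apply] at h1
  push_cast at h1
  nlinarith

end Step

/-! ### Trees of separated bad sites -/

/-- The indices of the sites in the neighbourhood of the origin. -/
noncomputable def offsets (d : ℕ) : Finset (Fin d → ℤ) :=
  Fintype.piFinset fun _ => Finset.Icc (-7000) 7000

lemma mem_offsets {j : Fin d → ℤ} : j ∈ offsets d ↔ ∀ i, |j i| ≤ 7000 := by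
  simp [offsets, abs_le]

lemma card_offsets : (offsets d).card = 14001 ^ d := by
  simp [offsets]

/-- The sets of leaves of the binary trees that have a root at `y` and whose vertices have two
well-separated children in their neighbourhood, with distances growing exponentially in the
height. -/
noncomputable def trees : ℕ → (Fin d → ℤ) → Finset (Finset (Fin d → ℤ))
  | 0, y => {{y}}
  | n + 1, y => ((offsets d ×ˢ offsets d).filter (fun p => ∃ i, 80 < |p.1 i - p.2 i|)).biUnion
      fun p => Finset.image₂ (· ∪ ·) (trees n (y + (1000 ^ n : ℤ) • p.1))
        (trees n (y + (1000 ^ n : ℤ) • p.2))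

lemma mem_trees_succ {n : ℕ} {y : Fin d → ℤ} {F : Finset (Fin d → ℤ)} :
    F ∈ trees (n + 1) y ↔ ∃ j j' : Fin d → ℤ, (∀ i, |j i| ≤ 7000) ∧ (∀ i, |j' i| ≤ 7000) ∧
      (∃ i, 80 < |j i - j' i|) ∧ ∃ F₁ ∈ trees n (y + (1000 ^ n : ℤ) • j),
      ∃ F₂ ∈ trees n (y + (1000 ^ n : ℤ) • j'), F₁ ∪ F₂ = F := by
  simp only [trees, Finset.mem_biUnion, Finset.mem_filter, Finset.mem_product, mem_offsets,
    Finset.mem_image₂, Prod.exists]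
  constructor
  · rintro ⟨j, j', ⟨⟨h1, h2⟩, h3⟩, h4⟩
    exact ⟨j, j', h1, h2, h3, h4⟩
  · rintro ⟨j, j', h1, h2, h3, h4⟩
    exact ⟨j, j', ⟨⟨h1, h2⟩, h3⟩, h4⟩

/-- The bound reproduces itself, since `7000 · 1000^n + 8 · 1000^n ≤ 8 · 1000^(n+1)`. -/
lemma abs_sub_le_of_mem_trees {n : ℕ} {y : Fin d → ℤ} {F : Finset (Fin d → ℤ)} (hF : F ∈ trees n y)
    {u : Fin d → ℤ} (hu : u ∈ F) (i : Fin d) : |u i - y i| ≤ 8 * 1000 ^ n := by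
  induction n generalizing y F with
  | zero =>
    simp only [trees, Finset.mem_singleton] at hF
    subst hF
    rw [Finset.mem_singleton] at hu
    subst hu
    simp
  | succ n ih =>
    obtain ⟨j, j', hj, hj', -, F₁, hF₁, F₂, hF₂, rfl⟩ := mem_trees_succ.1 hF
    have key : ∀ k : Fin d → ℤ, (∀ i, |k i| ≤ 7000) → |u i - (y + (1000 ^ n : ℤ) • k) i| ≤
        8 * 1000 ^ n → |u i - y i| ≤ 8 * 1000 ^ (n + 1) := by
      intro k hk h
      simp only [Pi.add_apply, Pi.smul_apply, smul_eq_mul] at h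
      have h1 := abs_le.1 h
      have h2 := abs_le.1 (hk i)
      have h3 : (0 : ℤ) < 1000 ^ n := by positivity
      rw [abs_le, pow_succ]
      constructor <;> nlinarith
    rcases Finset.mem_union.1 hu with hu | hu
    · exact key j hj (ih hF₁ hu)
    · exact key j' hj' (ih hF₂ hu)

/-- The two roots are more than `80 · 1000^n` apart and every leaf is within `8 · 1000^n` of its
root, which leaves `64 · 1000^n`. -/
lemma separated_children {n : ℕ} {y j j' : Fin d → ℤ} (hjj : ∃ i, 80 < |j i - j' i|)
    {F₁ F₂ : Finset (Fin d → ℤ)} (hF₁ : F₁ ∈ trees n (y + (1000 ^ n : ℤ) • j))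
    (hF₂ : F₂ ∈ trees n (y + (1000 ^ n : ℤ) • j')) {u v : Fin d → ℤ} (hu : u ∈ F₁) (hv : v ∈ F₂) :
    ∃ i, 64 ≤ |u i - v i| := by
  obtain ⟨i, hi⟩ := hjj
  refine ⟨i, ?_⟩
  have h1 := abs_le.1 (abs_sub_le_of_mem_trees hF₁ hu i)
  have h2 := abs_le.1 (abs_sub_le_of_mem_trees hF₂ hv i)
  simp only [Pi.add_apply, Pi.smul_apply, smul_eq_mul] at h1 h2
  have h3 : (1 : ℤ) ≤ 1000 ^ n := one_le_pow₀ (by norm_num)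
  rw [le_abs]
  rcases lt_abs.1 hi with h | h
  · left; nlinarith
  · right; nlinarith

lemma separated_of_mem_trees {n : ℕ} {y : Fin d → ℤ} {F : Finset (Fin d → ℤ)} (hF : F ∈ trees n y)
    {u v : Fin d → ℤ} (hu : u ∈ F) (hv : v ∈ F) (huv : u ≠ v) : ∃ i, 64 ≤ |u i - v i| := by
  induction n generalizing y F with
  | zero =>
    simp only [trees, Finset.mem_singleton] at hF
    subst hF
    rw [Finset.mem_singleton] at hu hv
    exact absurd (hu.trans hv.symm) huv
  | succ n ih =>
    obtain ⟨j, j', hj, hj', hjj, F₁, hF₁, F₂, hF₂, rfl⟩ := mem_trees_succ.1 hF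
    rcases Finset.mem_union.1 hu with hu | hu <;> rcases Finset.mem_union.1 hv with hv | hv
    · exact ih hF₁ hu hv
    · exact separated_children hjj hF₁ hF₂ hu hv
    · obtain ⟨i, hi⟩ := separated_children hjj hF₁ hF₂ hv hu
      exact ⟨i, by rwa [abs_sub_comm]⟩
    · exact ih hF₂ hu hv

lemma card_of_mem_trees {n : ℕ} {y : Fin d → ℤ} {F : Finset (Fin d → ℤ)} (hF : F ∈ trees n y) :
    F.card = 2 ^ n := by
  induction n generalizing y F with
  | zero =>
    simp only [trees, Finset.mem_singleton] at hF
    subst hF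
    simp
  | succ n ih =>
    obtain ⟨j, j', hj, hj', hjj, F₁, hF₁, F₂, hF₂, rfl⟩ := mem_trees_succ.1 hF
    rw [Finset.card_union_of_disjoint, ih hF₁, ih hF₂, pow_succ, mul_two]
    rw [Finset.disjoint_left]
    intro u hu hu'
    obtain ⟨i, hi⟩ := separated_children hjj hF₁ hF₂ hu hu'
    simp at hi

/-- With `N` bounding the number of pairs of children, the number of trees satisfies `t (n+1) ≤ N (t
n)^2`. The extra factor `N` on the left turns this recursion into plain squaring. -/
lemma card_trees_le (n : ℕ) (y : Fin d → ℤ) :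
    ((14001 ^ d) ^ 2) * (trees n y).card ≤ ((14001 ^ d) ^ 2) ^ (2 ^ n) := by
  induction n generalizing y with
  | zero => simp [trees]
  | succ n ih =>
    set N := (14001 ^ d) ^ 2 with hN
    have h1 : N * (trees (n + 1) y).card ≤
        N * ∑ p ∈ offsets d ×ˢ offsets d, (trees n (y + (1000 ^ n : ℤ) • p.1)).card *
          (trees n (y + (1000 ^ n : ℤ) • p.2)).card := by
      refine Nat.mul_le_mul_left _ ?_
      refine Finset.card_biUnion_le.trans ?_
      refine (Finset.sum_le_sum fun p _ => Finset.card_image₂_le _ _ _).trans ?_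
      exact Finset.sum_le_sum_of_subset (Finset.filter_subset _ _)
    refine h1.trans ?_
    rw [Finset.mul_sum]
    have h2 : ∀ p ∈ offsets d ×ˢ offsets d, N * ((trees n (y + (1000 ^ n : ℤ) • p.1)).card *
          (trees n (y + (1000 ^ n : ℤ) • p.2)).card) * N ≤ N ^ (2 ^ (n + 1)) := by
      intro p _
      calc _ = (N * (trees n (y + (1000 ^ n : ℤ) • p.1)).card) *
          (N * (trees n (y + (1000 ^ n : ℤ) • p.2)).card) := by ring
        _ ≤ N ^ 2 ^ n * N ^ 2 ^ n := Nat.mul_le_mul (ih _) (ih _)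
        _ = _ := by rw [← pow_add, pow_succ, mul_two]
    have hcard : (offsets d ×ˢ offsets d).card = N := by
      rw [Finset.card_product, card_offsets, hN, sq]
    have hNpos : 0 < N := by positivity
    refine Nat.le_of_mul_le_mul_right ?_ hNpos
    rw [Finset.sum_mul]
    refine (Finset.sum_le_sum h2).trans ?_
    rw [Finset.sum_const, hcard, smul_eq_mul, mul_comm]

section

variable {r : ℝ} {V : Set (E d)} {g : ℝ} {b : E d}

lemma site_site (g : ℝ) (b : E d) (n : ℕ) (y j : Fin d → ℤ) :
    site (g * 1000 ^ n) (site g b y) j = site g b (y + (1000 ^ n : ℤ) • j) := by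
  ext i; simp; ring

/-- A site that is not a unique crossing site at scale `1000 ^ n` is the root of a tree whose leaves
are not unique crossing sites at scale one. -/
theorem exists_tree_of_not_uniq (hd : 2 ≤ d) (hg : 0 < g) (hr : r ≤ g / 5) {n : ℕ}
    {y : Fin d → ℤ} (h : ¬ Uniq r V (g * 1000 ^ n) (site g b y)) :
    ∃ F ∈ trees n y, ∀ u ∈ F, ¬ Uniq r V g (site g b u) := by
  induction n generalizing y with
  | zero =>
    refine ⟨{y}, by simp [trees], fun u hu => ?_⟩
    rw [Finset.mem_singleton] at hu
    subst hu
    simpa using h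
  | succ n ih =>
    have hgn : g ≤ g * 1000 ^ n := le_mul_of_one_le_right hg.le (one_le_pow₀ (by norm_num))
    have hex : ∃ j j' : Fin d → ℤ, (∀ i, |j i| ≤ 7000) ∧ (∀ i, |j' i| ≤ 7000) ∧
        (∃ i, 80 < |j i - j' i|) ∧ ¬ Uniq r V (g * 1000 ^ n) (site g b (y + (1000 ^ n : ℤ) • j)) ∧
        ¬ Uniq r V (g * 1000 ^ n) (site g b (y + (1000 ^ n : ℤ) • j')) := by
      by_contra hcon
      push Not at hcon
      apply h
      -- If no two bad children are well separated, all of them are close to any one of them, which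
      -- then serves as the exceptional site.
      obtain ⟨j₀, hj₀⟩ : ∃ j₀, GoodExcept r V (g * 1000 ^ n) (site g b y) j₀ := by
        by_cases hall : ∃ j₀ : Fin d → ℤ, (∀ i, |j₀ i| ≤ 7000) ∧
            ¬ Uniq r V (g * 1000 ^ n) (site g b (y + (1000 ^ n : ℤ) • j₀))
        · obtain ⟨j₀, h1, h2⟩ := hall
          refine ⟨j₀, fun j hj hjj => ?_⟩
          rw [site_site]
          by_contra hbad
          exact h2 (hcon j j₀ hj h1 hjj hbad)
        · push Not at hall
          exact ⟨0, fun j hj _ => by rw [site_site]; exact hall j hj⟩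
      have := hj₀.uniq_next hd (lt_of_lt_of_le hg hgn) (by linarith)
      rw [pow_succ]
      convert this using 1
      ring
    obtain ⟨j, j', hj, hj', hjj, hb, hb'⟩ := hex
    obtain ⟨F₁, hF₁, h₁⟩ := ih hb
    obtain ⟨F₂, hF₂, h₂⟩ := ih hb'
    refine ⟨F₁ ∪ F₂, mem_trees_succ.2 ⟨j, j', hj, hj', hjj, F₁, hF₁, F₂, hF₂, rfl⟩, fun u hu => ?_⟩
    rcases Finset.mem_union.1 hu with hu | hu
    · exact h₁ u hu
    · exact h₂ u hu

/-- If crossing clusters are unique at all large scales, then the clusters that leave a large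
cube are infinite. -/
theorem infinite_of_exits (hd : 2 ≤ d) (hg : 0 < g) {n₀ : ℕ}
    (h : ∀ n, n₀ ≤ n → ∀ j : Fin d → ℤ, (∀ i, |j i| ≤ 7000) →
      Uniq r V (g * 1000 ^ n) (site (g * 1000 ^ n) b j))
    {x : E d} (hx : x ∈ V) (hxb : x ∈ box (3 * (g * 1000 ^ n₀)) b)
    (he : Exits r V (g * 1000 ^ n₀) b x) : {y | Linked r V x y}.Infinite := by
  have hall : ∀ k, x ∈ box (3 * (g * 1000 ^ (n₀ + k))) b ∧ Exits r V (g * 1000 ^ (n₀ + k)) b x := by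
    intro k
    induction k with
    | zero => exact ⟨hxb, he⟩
    | succ k ih =>
      have hpos : 0 < g * 1000 ^ (n₀ + k) := by positivity
      have heq : g * 1000 ^ (n₀ + (k + 1)) = 1000 * (g * 1000 ^ (n₀ + k)) := by ring
      rw [heq]
      refine ⟨box_subset (by nlinarith) _ ih.1, ih.2.next hd hpos (h _ (by omega)) hx ih.1⟩
  intro hfin
  obtain ⟨ρ, hρ⟩ := (Set.Finite.isBounded hfin).subset_closedBall b
  obtain ⟨k, hk⟩ := exists_nat_gt (ρ / g)
  obtain ⟨y, hy, hyb⟩ := (hall k).2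
  refine hyb fun i => ?_
  have h1 : dist y b ≤ ρ := hρ hy
  refine lt_of_le_of_lt ((abs_sub_le_dist y b i).trans h1) ?_
  rw [div_lt_iff₀ hg] at hk
  have h2 : (k : ℝ) ≤ 1000 ^ (n₀ + k) := by
    have : k ≤ 1000 ^ (n₀ + k) :=
      (Nat.lt_pow_self (by norm_num : 1 < 1000)).le.trans
        (Nat.pow_le_pow_right (by norm_num) (by omega))
    exact_mod_cast this
  have h3 : (0 : ℝ) < 1000 ^ (n₀ + k) := by positivity
  nlinarith

end

/-! ### Clusters of the Gilbert graph -/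

lemma mem_cluster_iff {r : ℝ} {V : Set (E d)} {x y : E d} :
    y ∈ cluster r V x ↔ x ∈ V ∧ Linked r V x y := by
  constructor
  · rintro ⟨hx, hy, h⟩
    refine ⟨hx, ?_⟩
    rw [SimpleGraph.reachable_iff_reflTransGen] at h
    exact Relation.ReflTransGen.lift Subtype.val (fun a b hab => ⟨a.2, b.2, hab.2⟩) _ _ h
  · rintro ⟨hx, h⟩
    refine ⟨hx, h.mem hx, ?_⟩
    induction h with
    | refl => exact SimpleGraph.Reachable.refl _
    | @tail b c hab hstep ih =>
      rcases eq_or_ne b c with rfl | hne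
      · exact ih
      · refine ih.trans (SimpleGraph.Adj.reachable ?_)
        exact ⟨fun h => hne (congrArg Subtype.val h), hstep.2.2⟩

lemma shift_apply (t : E d) (ν : Measure (E d)) (B : Set (E d)) :
    shift t ν B = ν ((fun y => y - t) ⁻¹' B) :=
  (MeasurableEquiv.subRight t).map_apply B

lemma mem_atoms_shift {t y : E d} {ν : Measure (E d)} :
    y ∈ atoms (shift t ν) ↔ y + t ∈ atoms ν := by
  unfold atoms
  rw [mem_ofPred_eq, mem_ofPred_eq, shift_apply]
  have : (fun z : E d => z - t) ⁻¹' {y} = {y + t} := by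
    ext z; simp [sub_eq_iff_eq_add]
  rw [this]

lemma linked_shift {r : ℝ} {t x y : E d} {ν : Measure (E d)} :
    Linked r (atoms (shift t ν)) x y ↔ Linked r (atoms ν) (x + t) (y + t) := by
  constructor
  · intro h
    exact Relation.ReflTransGen.lift (fun z => z + t) (fun a b hab =>
      ⟨mem_atoms_shift.1 hab.1, mem_atoms_shift.1 hab.2.1, by simpa using hab.2.2⟩) _ _ h
  · intro h
    have : Linked r (atoms (shift t ν)) (x + t - t) (y + t - t) :=
      Relation.ReflTransGen.lift (r := fun x y => x ∈ atoms ν ∧ y ∈ atoms ν ∧ dist x y < r)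
      (p := fun x y => x ∈ atoms (shift t ν) ∧ y ∈ atoms (shift t ν) ∧ dist x y < r)
      (fun z => z - t) (fun a b hab =>
      ⟨mem_atoms_shift.2 (by simpa using hab.1), mem_atoms_shift.2 (by simpa using hab.2.1),
        by simpa using hab.2.2⟩) _ _ h
    simpa using this

lemma connectedToInfinity_shift {r : ℝ} {x : E d} {ν : Measure (E d)} :
    ConnectedToInfinity r (shift x ν) ↔ x ∈ atoms ν ∧ {y | Linked r (atoms ν) x y}.Infinite := by
  unfold ConnectedToInfinity
  by_cases hx : x ∈ atoms ν
  · have : cluster r (atoms (shift x ν)) 0 = (fun y => y - x) '' {y | Linked r (atoms ν) x y} := by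
      ext y
      rw [mem_cluster_iff, mem_atoms_shift, linked_shift, zero_add]
      simp only [hx, true_and, mem_image, mem_ofPred_eq]
      constructor
      · intro h; exact ⟨y + x, h, by simp⟩
      · rintro ⟨z, hz, rfl⟩; simpa using hz
    rw [this, Set.infinite_image_iff (sub_left_injective.injOn)]
    simp [hx]
  · have : cluster r (atoms (shift x ν)) 0 = ∅ := by
      ext y
      rw [mem_cluster_iff, mem_atoms_shift, zero_add]
      simp [hx]
    rw [this]
    simp [hx]

lemma connectedToBoundary_shift {a r : ℝ} {x : E d} {ν : Measure (E d)} :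
    ConnectedToBoundary a r (shift x ν) ↔
      x ∈ atoms ν ∧ ∃ y, Linked r (atoms ν) x y ∧ y ∉ cube (a - 2 * r) x := by
  unfold ConnectedToBoundary
  rw [Set.not_subset]
  simp only [mem_cluster_iff, mem_atoms_shift, linked_shift, zero_add]
  constructor
  · rintro ⟨y, ⟨hx, hy⟩, hy'⟩
    exact ⟨hx, y + x, hy, fun h => hy' fun i => by simpa using h i⟩
  · rintro ⟨hx, y, hy, hy'⟩
    exact ⟨y - x, ⟨hx, by simpa using hy⟩, fun h => hy' fun i => by simpa using h i⟩

/-! ### The geometric crossing event -/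

lemma cube_eq_box (n : ℝ) (z : E d) : cube n z = box (n / 2) z := rfl

/-- Uniqueness of the crossing cluster can be checked locally. -/
lemma Uniq.of_inter {r : ℝ} {V W : Set (E d)} {g : ℝ} {z : E d} (hg : 0 < g) (hr : r ≤ g)
    (hW : box (6 * g) z ⊆ W) (h : Uniq r (V ∩ W) g z) : Uniq r V g z := by
  have hex : ∀ x ∈ V, x ∈ box (3 * g) z → Exits r V g z x → Exits r (V ∩ W) g z x := by
    rintro x hx hxb ⟨y, hy, hyb⟩
    by_contra hcon
    -- The path from `x` is followed until it first leaves the open cube. Up to and including that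
    -- step it stays within `5 g + r ≤ 6 g` of the centre, hence in `W`.
    have key : Linked r (V ∩ W) x y ∧ y ∈ openBox (5 * g) z := by
      clear hyb
      induction hy with
      | refl => exact ⟨Relation.ReflTransGen.refl, fun i => lt_of_le_of_lt (hxb i) (by linarith)⟩
      | @tail u v _ hstep ih =>
        have hu : u ∈ box (6 * g) z := fun i => (ih.2 i).le.trans (by linarith)
        have hv : v ∈ box (6 * g) z := fun i => by
          have h1 := abs_lt.1 (ih.2 i)
          have h2 := abs_le.1 ((abs_sub_le_dist u v i).trans hstep.2.2.le)
          rw [abs_le]; constructor <;> linarith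
        have hl : Linked r (V ∩ W) x v := ih.1.trans
          (Linked.single ⟨hstep.1, hW hu⟩ ⟨hstep.2.1, hW hv⟩ hstep.2.2)
        refine ⟨hl, ?_⟩
        by_contra hv'
        exact hcon ⟨v, hl, hv'⟩
    exact hyb key.2
  have hin : ∀ x, x ∈ box (3 * g) z → x ∈ W := fun x hx => hW (box_subset (by linarith) _ hx)
  constructor
  · obtain ⟨x, hx, hxb, y, hy, hyb⟩ := h.exists_exits
    exact ⟨x, hx.1, hxb, y, hy.mono inter_subset_left, hyb⟩
  · intro x hx x' hx' hxb hxb' he he'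
    exact (h.linked x ⟨hx, hin x hxb⟩ x' ⟨hx', hin x' hxb'⟩ hxb hxb' (hex x hx hxb he)
      (hex x' hx' hxb' he')).mono inter_subset_left

lemma isClosed_box (ρ : ℝ) (z : E d) : IsClosed (box ρ z) := by
  have : box ρ z = ⋂ i, {y | |y i - z i| ≤ ρ} := by ext; simp [box]
  rw [this]
  exact isClosed_iInter fun i => isClosed_le (by fun_prop) continuous_const

lemma isOpen_openBox (ρ : ℝ) (z : E d) : IsOpen (openBox ρ z) := by
  have : openBox ρ z = ⋂ i, {y | |y i - z i| < ρ} := by ext; simp [openBox]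
  rw [this]
  exact isOpen_iInter_of_finite fun i => isOpen_lt (by fun_prop) continuous_const

lemma convex_openBox (ρ : ℝ) (z : E d) : Convex ℝ (openBox ρ z) := by
  intro x hx y hy a b ha hb hab i
  have h1 := abs_lt.1 (hx i)
  have h2 := abs_lt.1 (hy i)
  have h3 : (a • x + b • y) i - z i = a * (x i - z i) + b * (y i - z i) := by
    simp only [PiLp.add_apply, PiLp.smul_apply, smul_eq_mul]
    linear_combination (z i) * hab
  rw [h3, abs_lt]
  rcases eq_or_lt_of_le ha with rfl | ha'
  · have : b = 1 := by linarith
    subst this; constructor <;> nlinarith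
  · constructor <;> nlinarith

lemma frontier_box {ρ : ℝ} (hρ : 0 < ρ) : frontier (box ρ (0 : E d)) = box ρ 0 \ openBox ρ 0 := by
  rw [(isClosed_box ρ 0).frontier_eq]
  congr 1
  refine Subset.antisymm ?_ (interior_maximal (fun y hy i => (hy i).le) (isOpen_openBox ρ 0))
  intro y hy i
  by_contra hcon
  push Not at hcon
  -- An interior point stays in the closed cube when scaled by `1 + ε` for small `ε > 0`, so none of
  -- its coordinates attains `ρ`.
  have hc : Tendsto (fun ε : ℝ => (1 + ε) • y) (𝓝[>] 0) (𝓝 y) := by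
    have : Tendsto (fun ε : ℝ => (1 + ε) • y) (𝓝 0) (𝓝 ((1 + 0 : ℝ) • y)) :=
      (by fun_prop : Continuous fun ε : ℝ => (1 + ε) • y).tendsto 0
    simp only [add_zero, one_smul] at this
    exact this.mono_left nhdsWithin_le_nhds
  have h1 := hc.eventually (mem_interior_iff_mem_nhds.1 hy)
  obtain ⟨ε, hε, hε0⟩ := (h1.and self_mem_nhdsWithin).exists
  have h2 := hε i
  replace hε0 : 0 < ε := hε0
  simp only [PiLp.smul_apply, smul_eq_mul, PiLp.zero_apply, sub_zero, abs_mul] at h2 hcon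
  rw [abs_of_pos (by linarith : 0 < 1 + ε)] at h2
  nlinarith

section

variable {r : ℝ} {V : Set (E d)}

/-- If two edges of a Gilbert graph meet, then their endpoints are in the same cluster. -/
lemma linked_of_segments_meet {x y u w z : E d} (hx : x ∈ V) (hy : y ∈ V) (hu : u ∈ V)
    (hw : w ∈ V) (hxy : dist x y < r) (huw : dist u w < r) (hz : z ∈ segment ℝ x y)
    (hz' : z ∈ segment ℝ u w) : Linked r V x u := by
  have h1 := dist_add_dist_of_mem_segment hz
  have h2 := dist_add_dist_of_mem_segment hz'
  have hxy' : Linked r V x y := Linked.single hx hy hxy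
  have huw' : Linked r V w u := Linked.single hw hu (by rwa [dist_comm])
  -- The four distances from `z` to the endpoints sum to less than `2 r`, so `dist x u` and `dist y
  -- w` cannot both be at least `r`.
  by_cases h : dist x u < r
  · exact Linked.single hx hu h
  · have h3 := dist_triangle x z u
    have h4 := dist_triangle y z w
    rw [dist_comm z u] at h3
    rw [dist_comm y z] at h4
    exact (hxy'.trans (Linked.single hy hw (by linarith))).trans huw'

lemma isClosed_gilbertSet (hV : V.Finite) : IsClosed (gilbertSet r V) := by
  have : gilbertSet r V = ⋃ x ∈ V, ⋃ y ∈ {y ∈ V | dist x y < r}, segment ℝ x y := by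
    ext z
    simp only [gilbertSet, mem_iUnion, mem_ofPred_eq]
    constructor
    · rintro ⟨x, hx, y, hy, hxy, hz⟩; exact ⟨x, hx, y, ⟨hy, hxy⟩, hz⟩
    · rintro ⟨x, hx, y, ⟨hy, hxy⟩, hz⟩; exact ⟨x, hx, y, hy, hxy, hz⟩
  rw [this]
  refine hV.isClosed_biUnion fun x _ => (hV.subset (sep_subset _ _)).isClosed_biUnion fun y _ => ?_
  have : IsCompact (segment ℝ x y) := by
    rw [segment_eq_image_lineMap]
    exact isCompact_Icc.image (by fun_prop)
  exact this.isClosed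

lemma mem_gilbertSet_self (hr : 0 < r) {x : E d} (hx : x ∈ V) : x ∈ gilbertSet r V :=
  ⟨x, hx, x, hx, by simpa using hr, left_mem_segment ℝ x x⟩

/-- The union of the edges of the cluster of `v`. -/
def clusterSet (r : ℝ) (V : Set (E d)) (v : E d) : Set (E d) :=
  gilbertSet r {y | y ∈ V ∧ Linked r V v y}

lemma linked_of_mem_clusterSet {v w z : E d} (hz : z ∈ clusterSet r V v)
    (hz' : z ∈ clusterSet r V w) : Linked r V v w := by
  obtain ⟨x, hx, y, hy, hxy, hz⟩ := hz
  obtain ⟨x', hx', y', hy', hxy', hz'⟩ := hz'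
  exact (hx.2.trans (linked_of_segments_meet hx.1 hy.1 hx'.1 hy'.1 hxy hxy' hz hz')).trans
    hx'.2.symm

/-- Edges of different clusters never meet. So the edges of the cluster of `v` and the remaining
edges form two disjoint sets that cover `C`, both closed because `V` is finite. -/
lemma subset_clusterSet_of_isPreconnected (hV : V.Finite) {C : Set (E d)}
    (hC : IsPreconnected C)
    (hCG : C ⊆ gilbertSet r V) {v : E d} (hv : (C ∩ clusterSet r V v).Nonempty) :
    C ⊆ clusterSet r V v := by
  set T' := gilbertSet r {y | y ∈ V ∧ ¬ Linked r V v y} with hT'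
  have hcover : C ⊆ clusterSet r V v ∪ T' := by
    intro z hz
    obtain ⟨x, hx, y, hy, hxy, hz⟩ := hCG hz
    have hl : Linked r V x y := Linked.single hx hy hxy
    by_cases h : Linked r V v x
    · exact Or.inl ⟨x, ⟨hx, h⟩, y, ⟨hy, h.trans hl⟩, hxy, hz⟩
    · exact Or.inr ⟨x, ⟨hx, h⟩, y, ⟨hy, fun h' => h (h'.trans hl.symm)⟩, hxy, hz⟩
  by_cases hne : (C ∩ T').Nonempty
  · exfalso
    obtain ⟨z, -, hz1, hz2⟩ := isPreconnected_closed_iff.1 hC _ _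
      (isClosed_gilbertSet (hV.subset (sep_subset _ _)))
      (isClosed_gilbertSet (hV.subset (sep_subset _ _))) hcover hv hne
    obtain ⟨x, hx, y, hy, hxy, hz⟩ := hz1
    obtain ⟨x', hx', y', hy', hxy', hz'⟩ := hz2
    exact hx'.2 (hx.2.trans (linked_of_segments_meet hx.1 hy.1 hx'.1 hy'.1 hxy hxy' hz hz'))
  · intro z hz
    exact (hcover hz).resolve_right fun h => hne ⟨z, hz, h⟩

lemma joinedIn_clusterSet (hr : 0 < r) {v y : E d} (hv : v ∈ V) (h : Linked r V v y) :
    JoinedIn (clusterSet r V v) v y := by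
  induction h with
  | refl =>
    exact JoinedIn.refl (mem_gilbertSet_self hr ⟨hv, Relation.ReflTransGen.refl⟩)
  | @tail u w hvu hstep ih =>
    refine ih.trans (JoinedIn.of_segment_subset fun z hz => ?_)
    exact ⟨u, ⟨hstep.1, hvu⟩, w, ⟨hstep.2.1, hvu.trans (Linked.single hstep.1 hstep.2.1 hstep.2.2)⟩,
      hstep.2.2, hz⟩

end

lemma mem_box_zero_iff {ρ : ℝ} (hρ : 0 ≤ ρ) {y : E d} : y ∈ box ρ 0 ↔ ‖y.ofLp‖ ≤ ρ := by
  rw [pi_norm_le_iff_of_nonneg hρ]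
  simp [box]

lemma mem_openBox_zero_iff {ρ : ℝ} (hρ : 0 < ρ) {y : E d} : y ∈ openBox ρ 0 ↔ ‖y.ofLp‖ < ρ := by
  rw [pi_norm_lt_iff hρ]
  simp [openBox]

/-- A cluster that crosses the shell contains points of a crossing component. -/
lemma exists_isCrossing {r s : ℝ} {ν : Measure (E d)} (hr : 0 < r) (hs : 0 < s) {W : Set (E d)}
    {x : E d} (hx : x ∈ atoms ν ∩ W) (hxb : x ∈ box (3 * (s / 2)) 0)
    (he : Exits r (atoms ν ∩ W) (s / 2) 0 x) :
    ∃ C, IsCrossing r s ν C ∧ (C ∩ clusterSet r (atoms ν ∩ W) x).Nonempty := by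
  obtain ⟨y, hy, hyb⟩ := he
  obtain ⟨γ, hγ⟩ := joinedIn_clusterSet hr hx hy
  -- The sup norm along a path inside the cluster. Until the first time `t₁` at which it reaches `5
  -- s / 2`, the path stays in `Q_{5s}`, and it meets `∂Q_{3s}` on the way; so this piece lies in a
  -- single crossing component.
  set f : ℝ → ℝ := fun t => ‖(γ.extend t).ofLp‖ with hf
  have hfc : Continuous f := by fun_prop
  have h0 : f 0 ≤ 3 * (s / 2) := by
    rw [hf]; simp only [Path.extend_zero]
    exact (mem_box_zero_iff (by positivity)).1 hxb
  have h1 : 5 * (s / 2) ≤ f 1 := by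
    rw [hf]; simp only [Path.extend_one]
    rw [mem_openBox_zero_iff (by positivity)] at hyb
    exact not_lt.1 hyb
  have hne : (Icc (0 : ℝ) 1 ∩ {t | 5 * (s / 2) ≤ f t}).Nonempty :=
    ⟨1, ⟨by norm_num, h1⟩⟩
  have hcomp : IsCompact (Icc (0 : ℝ) 1 ∩ {t | 5 * (s / 2) ≤ f t}) :=
    isCompact_Icc.inter_right (isClosed_le continuous_const hfc)
  obtain ⟨t₁, ⟨ht₁, hft₁⟩, hmin⟩ := hcomp.exists_isLeast hne
  have hft₁ : 5 * (s / 2) ≤ f t₁ := hft₁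
  have heq : f t₁ = 5 * (s / 2) := by
    obtain ⟨t, ht, htf⟩ := intermediate_value_Icc ht₁.1 hfc.continuousOn
      (⟨h0.trans (by linarith), hft₁⟩ : 5 * (s / 2) ∈ Icc (f 0) (f t₁))
    have : t₁ ≤ t := hmin ⟨⟨ht.1, ht.2.trans ht₁.2⟩, htf.ge⟩
    rwa [le_antisymm ht.2 this] at htf
  have hle : ∀ t ∈ Icc 0 t₁, f t ≤ 5 * (s / 2) := by
    intro t ht
    rcases eq_or_lt_of_le ht.2 with rfl | hlt
    · exact heq.le
    · by_contra hcon
      push Not at hcon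
      exact absurd (hmin ⟨⟨ht.1, ht.2.trans ht₁.2⟩, hcon.le⟩) (not_le.2 hlt)
  obtain ⟨t₀, ht₀, hft₀⟩ := intermediate_value_Icc ht₁.1 hfc.continuousOn
      (⟨h0, by linarith⟩ : 3 * (s / 2) ∈ Icc (f 0) (f t₁))
  set K := γ.extend '' Icc 0 t₁ with hK
  have hKpre : IsPreconnected K := isPreconnected_Icc.image _ γ.continuous_extend.continuousOn
  have hKT : K ⊆ clusterSet r (atoms ν ∩ W) x := by
    rintro _ ⟨t, ht, rfl⟩
    have : γ.extend t ∈ range γ := by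
      rw [← γ.extend_range]; exact mem_range_self t
    obtain ⟨t', ht'⟩ := this
    rw [← ht']; exact hγ t'
  have hKG : K ⊆ gilbertSet r (atoms ν) ∩ cube (5 * s) 0 := by
    intro z hz
    refine ⟨?_, ?_⟩
    · obtain ⟨a, ha, b, hb, h⟩ := hKT hz
      exact ⟨a, ha.1.1, b, hb.1.1, h⟩
    · obtain ⟨t, ht, rfl⟩ := hz
      rw [cube_eq_box, mem_box_zero_iff (by positivity)]
      exact (hle t ht).trans (by linarith)
  have hmem₀ : γ.extend t₀ ∈ K := mem_image_of_mem _ ht₀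
  have hmem₁ : γ.extend t₁ ∈ K := mem_image_of_mem _ ⟨ht₁.1, le_rfl⟩
  have hKC := hKpre.subset_connectedComponentIn hmem₀ hKG
  refine ⟨connectedComponentIn (gilbertSet r (atoms ν) ∩ cube (5 * s) 0) (γ.extend t₀),
    ⟨⟨_, hKG hmem₀, rfl⟩, ⟨_, hKC hmem₀, ?_⟩, ⟨_, hKC hmem₁, ?_⟩⟩, ⟨_, hKC hmem₀, hKT hmem₀⟩⟩
  · rw [cube_eq_box, frontier_box (by positivity), Set.mem_sdiff, mem_box_zero_iff (by positivity),
      mem_openBox_zero_iff (by positivity)]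
    have : ‖(γ.extend t₀).ofLp‖ = 3 * (s / 2) := hft₀
    rw [this]; constructor <;> linarith
  · rw [cube_eq_box, frontier_box (by positivity), Set.mem_sdiff, mem_box_zero_iff (by positivity),
      mem_openBox_zero_iff (by positivity)]
    have : ‖(γ.extend t₁).ofLp‖ = 5 * (s / 2) := heq
    rw [this]; constructor <;> linarith

/-- The crossing event implies local uniqueness of the crossing cluster. -/
theorem CrossingEvent.uniq {r s : ℝ} {ν : Measure (E d)} (hr : 0 < r) (hrs : r ≤ s / 10)
    (hfin : (atoms ν ∩ box (6 * (s / 2)) 0).Finite) (h : CrossingEvent r s ν) :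
    Uniq r (atoms ν ∩ box (6 * (s / 2)) 0) (s / 2) 0 := by
  have hs : 0 < s := by linarith
  obtain ⟨C, hC, huniq, hCs⟩ := h
  set V := atoms ν ∩ box (6 * (s / 2)) 0 with hV
  -- An edge that meets `Q_{5s}` has both endpoints within `5 s / 2 + s / 10 ≤ 3 s` of the origin in
  -- every coordinate.
  have hsub : gilbertSet r (atoms ν) ∩ cube (5 * s) 0 ⊆ gilbertSet r V := by
    rintro z ⟨⟨x, hx, y, hy, hxy, hz⟩, hzQ⟩
    have hd := dist_add_dist_of_mem_segment hz
    have hin : ∀ u, dist u z < r → u ∈ box (6 * (s / 2)) 0 := by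
      intro u hu i
      have h1 := abs_le.1 ((abs_sub_le_dist u z i).trans hu.le)
      have h2 := abs_le.1 (hzQ i)
      simp only [PiLp.zero_apply] at h2 ⊢
      rw [abs_le]; constructor <;> linarith
    refine ⟨x, ⟨hx, hin x ?_⟩, y, ⟨hy, hin y ?_⟩, hxy, hz⟩
    · have := dist_nonneg (x := z) (y := y); linarith
    · have := dist_nonneg (x := x) (y := z); rw [dist_comm]; linarith
  obtain ⟨⟨p, hp, hCp⟩, hC3, hC5⟩ := hC
  have hCG : C ⊆ gilbertSet r V := by
    rw [hCp]; exact (connectedComponentIn_subset _ _).trans hsub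
  have hCpre : IsPreconnected C := by rw [hCp]; exact isPreconnected_connectedComponentIn
  constructor
  · obtain ⟨z, hzC, hzs⟩ := hCs
    obtain ⟨x, hx, y, hy, hxy, hz⟩ := hCG hzC
    have hd := dist_add_dist_of_mem_segment hz
    have hCT : C ⊆ clusterSet r V x :=
      subset_clusterSet_of_isPreconnected hfin hCpre hCG ⟨z, hzC, x,
      ⟨hx, Relation.ReflTransGen.refl⟩, y, ⟨hy, Linked.single hx hy hxy⟩, hxy, hz⟩
    -- The origin of the factor `6 / 5` in `Uniq`: the component meets `Q_s` on an edge shorter than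
    -- `s / 10`, and `s / 2 + s / 10 = (6 / 5) (s / 2)`.
    refine ⟨x, hx, fun i => ?_, ?_⟩
    · have hxz : dist x z ≤ r := by have := dist_nonneg (x := z) (y := y); linarith
      have h1 := abs_le.1 ((abs_sub_le_dist x z i).trans hxz)
      have h2 := abs_le.1 (hzs i)
      simp only [PiLp.zero_apply] at h2 ⊢
      rw [abs_le]; constructor <;> linarith
    · obtain ⟨z', hz'C, hz'F⟩ := hC5
      obtain ⟨u, hu, w, hw, huw, hz'⟩ := hCT hz'C
      rw [cube_eq_box, frontier_box (by positivity)] at hz'F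
      -- If all vertices of the cluster were in the open cube, convexity would keep the edges there
      -- as well, away from `∂Q_{5s}`.
      by_contra hne
      have hin : ∀ u, u ∈ V ∧ Linked r V x u → u ∈ openBox (5 * s / 2) 0 := by
        intro u hu
        by_contra hu'
        exact hne ⟨u, hu.2, by rwa [show 5 * (s / 2) = 5 * s / 2 by ring]⟩
      exact hz'F.2 ((convex_openBox _ _).segment_subset (hin u hu) (hin w hw) hz')
  · intro x hx x' hx' hxb hxb' he he'
    obtain ⟨C₁, hC₁, z₁, hz₁, hz₁'⟩ := exists_isCrossing hr hs hx hxb he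
    obtain ⟨C₂, hC₂, z₂, hz₂, hz₂'⟩ := exists_isCrossing hr hs hx' hxb' he'
    rw [huniq C₁ hC₁] at hz₁
    rw [huniq C₂ hC₂] at hz₂
    have h1 := subset_clusterSet_of_isPreconnected hfin hCpre hCG ⟨z₁, hz₁, hz₁'⟩
    have h2 := subset_clusterSet_of_isPreconnected hfin hCpre hCG ⟨z₂, hz₂, hz₂'⟩
    exact linked_of_mem_clusterSet (h1 hz₁) (h2 hz₁)

/-! ### Point configurations -/

lemma measurableSet_box (ρ : ℝ) (z : E d) : MeasurableSet (box ρ z) :=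
  (isClosed_box ρ z).measurableSet

lemma isBounded_box (ρ : ℝ) (z : E d) : Bornology.IsBounded (box ρ z) := by
  rw [Metric.isBounded_iff_subset_closedBall z]
  refine ⟨√(∑ _i : Fin d, ρ ^ 2), fun y hy => ?_⟩
  rw [Metric.mem_closedBall, EuclideanSpace.dist_eq]
  refine Real.sqrt_le_sqrt (Finset.sum_le_sum fun i _ => ?_)
  rw [Real.dist_eq]
  exact pow_le_pow_left₀ (abs_nonneg _) (hy i) 2

namespace IsPointConfiguration

variable {ν : Measure (E d)}

lemma measure_ne_top (h : IsPointConfiguration ν) {B : Set (E d)} (hB : Bornology.IsBounded B) :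
    ν B ≠ ∞ := by
  obtain ⟨ρ, hρ⟩ := hB.subset_closedBall 0
  obtain ⟨k, hk⟩ := h (Metric.closedBall 0 ρ) measurableSet_closedBall Metric.isBounded_closedBall
  exact ne_top_of_le_ne_top (by rw [hk]; exact ENNReal.natCast_ne_top k) (measure_mono hρ)

lemma one_le_of_mem_atoms (h : IsPointConfiguration ν) {x : E d} (hx : x ∈ atoms ν) :
    1 ≤ ν {x} := by
  obtain ⟨k, hk⟩ := h {x} (measurableSet_singleton x) Bornology.isBounded_singleton
  have hx : ν {x} ≠ 0 := hx
  rw [hk] at hx ⊢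
  have : k ≠ 0 := by rintro rfl; simp at hx
  exact_mod_cast Nat.one_le_iff_ne_zero.2 this

/-- The counts of small balls around a non-atom decrease to zero and are integers, so some ball has
count zero; locally null sets are null. `B` need not be measurable, which is used for sets of atoms.
-/
lemma exists_atom (h : IsPointConfiguration ν) {B : Set (E d)} (hB : ν B ≠ 0) :
    ∃ x ∈ atoms ν, x ∈ B := by
  by_contra hcon
  push Not at hcon
  refine hB (measure_null_of_locally_null B fun x hx => ?_)
  have hx0 : ν {x} = 0 := by
    by_contra h0; exact hcon x h0 hx
  have hlim : Tendsto (fun n : ℕ => ν (Metric.closedBall x (1 / ((n : ℝ) + 1)))) atTop (𝓝 0) := by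
    have hInter : ⋂ n : ℕ, Metric.closedBall x (1 / ((n : ℝ) + 1)) = {x} := by
      ext y
      simp only [mem_iInter, Metric.mem_closedBall, mem_singleton_iff]
      constructor
      · intro hy
        refine dist_le_zero.1 (ge_of_tendsto' tendsto_one_div_add_atTop_nhds_zero_nat hy)
      · rintro rfl n; rw [dist_self]; positivity
    rw [← hx0, ← hInter]
    refine tendsto_measure_iInter_atTop (fun n => measurableSet_closedBall.nullMeasurableSet) ?_
      ⟨0, h.measure_ne_top Metric.isBounded_closedBall⟩
    intro m n hmn
    refine Metric.closedBall_subset_closedBall ?_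
    exact one_div_le_one_div_of_le (by positivity) (by exact_mod_cast Nat.succ_le_succ hmn)
  obtain ⟨n, hn⟩ := (hlim.eventually (gt_mem_nhds (zero_lt_one))).exists
  refine ⟨Metric.closedBall x (1 / ((n : ℝ) + 1)), mem_nhdsWithin_of_mem_nhds
    (Metric.closedBall_mem_nhds x (by positivity)), ?_⟩
  obtain ⟨k, hk⟩ := h (Metric.closedBall x (1 / ((n : ℝ) + 1))) measurableSet_closedBall
    Metric.isBounded_closedBall
  rw [hk] at hn ⊢
  have : k < 1 := by exact_mod_cast hn
  simp [Nat.lt_one_iff.1 this]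

lemma exists_atom_iff (h : IsPointConfiguration ν) {B : Set (E d)} :
    ν B ≠ 0 ↔ ∃ x ∈ atoms ν, x ∈ B := by
  refine ⟨h.exists_atom, ?_⟩
  rintro ⟨x, hx, hxB⟩ h0
  exact hx (measure_mono_null (singleton_subset_iff.2 hxB) h0)

lemma finite_atoms (h : IsPointConfiguration ν) {B : Set (E d)} (hB : Bornology.IsBounded B) :
    (atoms ν ∩ B).Finite := by
  by_contra hinf
  obtain ⟨ρ, hρ⟩ := hB.subset_closedBall 0
  obtain ⟨k, hk⟩ := h (Metric.closedBall 0 ρ) measurableSet_closedBall Metric.isBounded_closedBall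
  obtain ⟨F, hF, hcard⟩ := Set.Infinite.exists_subset_card_eq hinf (k + 1)
  have h1 : ((k + 1 : ℕ) : ℝ≥0∞) ≤ ν F := by
    rw [← hcard, ← sum_measure_singleton, Finset.card_eq_sum_ones, Nat.cast_sum]
    exact Finset.sum_le_sum fun x hx => by
      simpa using h.one_le_of_mem_atoms (hF hx).1
  have h2 : ν F ≤ k := hk ▸ measure_mono fun x hx => hρ (hF hx).2
  have : k + 1 ≤ k := by exact_mod_cast h1.trans h2
  omega

lemma restrict (h : IsPointConfiguration ν) {W : Set (E d)} (hW : MeasurableSet W) :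
    IsPointConfiguration (ν.restrict W) := by
  intro B hB hBb
  rw [Measure.restrict_apply hB]
  exact h _ (hB.inter hW) (hBb.subset inter_subset_left)

lemma shift (h : IsPointConfiguration ν) (t : E d) : IsPointConfiguration (shift t ν) := by
  intro B hB hBb
  rw [shift_apply]
  refine h _ (hB.preimage (by fun_prop)) ?_
  have : (fun y => y - t) ⁻¹' B = (fun y => y + t) '' B := by
    ext y; simp [sub_eq_add_neg]
  rw [this]
  exact (IsometryEquiv.addRight t).isometry.lipschitz.isBounded_image hBb

end IsPointConfiguration

lemma atoms_restrict {ν : Measure (E d)} {W : Set (E d)} :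
    atoms (ν.restrict W) = atoms ν ∩ W := by
  ext x
  unfold atoms
  rw [mem_ofPred_eq, Measure.restrict_apply (measurableSet_singleton x)]
  by_cases hx : x ∈ W
  · rw [inter_eq_left.2 (singleton_subset_iff.2 hx)]; simp [hx]
  · rw [singleton_inter_eq_empty.2 hx]; simp [hx]

lemma measurable_shift (t : E d) : Measurable (shift t : Measure (E d) → Measure (E d)) :=
  Measure.measurable_map _ (by fun_prop)

lemma measurable_restrict {W : Set (E d)} (hW : MeasurableSet W) :
    Measurable (fun ν : Measure (E d) => ν.restrict W) :=
  Measure.measurable_of_measurable_coe _ fun s hs => by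
    simp only [Measure.restrict_apply hs]
    exact Measure.measurable_coe (hs.inter hW)

lemma box_shift (ρ : ℝ) (z : E d) : (fun y => y - z) ⁻¹' (box ρ 0) = box ρ z := by
  ext y; simp [box]

lemma uniq_shift {r g : ℝ} {z : E d} {ν : Measure (E d)} :
    Uniq r (atoms (shift z ν)) g 0 ↔ Uniq r (atoms ν) g z := by
  have hb : ∀ ρ (y : E d), y ∈ box ρ 0 ↔ y + z ∈ box ρ z := by intro ρ y; simp [box]
  have ho : ∀ ρ (y : E d), y ∈ openBox ρ 0 ↔ y + z ∈ openBox ρ z := by intro ρ y; simp [openBox]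
  have he : ∀ x, Exits r (atoms (shift z ν)) g 0 x ↔ Exits r (atoms ν) g z (x + z) := by
    intro x
    simp only [Exits, linked_shift, ho]
    constructor
    · rintro ⟨y, hy⟩; exact ⟨y + z, hy⟩
    · rintro ⟨y, hy⟩; exact ⟨y - z, by simpa using hy⟩
  constructor
  · rintro ⟨⟨x, hx, hxb, hxe⟩, h⟩
    refine ⟨⟨x + z, mem_atoms_shift.1 hx, (hb _ _).1 hxb, (he x).1 hxe⟩, ?_⟩
    intro x hx x' hx' hxb hxb' hxe hxe'
    have := h (x - z) (mem_atoms_shift.2 (by simpa using hx)) (x' - z)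
      (mem_atoms_shift.2 (by simpa using hx')) ((hb _ _).2 (by simpa using hxb))
      ((hb _ _).2 (by simpa using hxb')) ((he _).2 (by simpa using hxe))
      ((he _).2 (by simpa using hxe'))
    rw [linked_shift] at this
    simpa using this
  · rintro ⟨⟨x, hx, hxb, hxe⟩, h⟩
    refine ⟨⟨x - z, mem_atoms_shift.2 (by simpa using hx), (hb _ _).2 (by simpa using hxb),
      (he _).2 (by simpa using hxe)⟩, ?_⟩
    intro x hx x' hx' hxb hxb' hxe hxe'
    rw [linked_shift]
    exact h _ (mem_atoms_shift.1 hx) _ (mem_atoms_shift.1 hx') ((hb _ _).1 hxb) ((hb _ _).1 hxb')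
      ((he _).1 hxe) ((he _).1 hxe')

/-! ### Measurability of properties of the points -/

/-- The normalized restriction of a measure to `W`. -/
noncomputable def normRestrict (W : Set (E d)) (ν : Measure (E d)) : Measure (E d) :=
  (ν W)⁻¹ • ν.restrict W

lemma measurable_normRestrict {W : Set (E d)} (hW : MeasurableSet W) :
    Measurable (normRestrict W) := by
  refine Measure.measurable_of_measurable_coe _ fun s hs => ?_
  simp only [normRestrict, Measure.smul_apply, smul_eq_mul, Measure.restrict_apply hs]
  exact (Measure.measurable_coe hW).inv.mul (Measure.measurable_coe (hs.inter hW))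

lemma normRestrict_univ_le (W : Set (E d)) (ν : Measure (E d)) : normRestrict W ν univ ≤ 1 := by
  simp only [normRestrict, Measure.smul_apply, smul_eq_mul, Measure.restrict_apply_univ]
  exact ENNReal.inv_mul_le_one _

/-- Masses of sections are measurable for a finite kernel, and the normalization by `ν W` provides a
uniform bound on the total mass. It does not affect which sets have mass zero when `ν W` is finite.
-/
lemma measurableSet_normRestrict_ne_zero {α : Type*} [MeasurableSpace α] {W : Set (E d)}
    (hW : MeasurableSet W) {f : α → Measure (E d)} (hf : Measurable f) {B : Set (α × E d)}
    (hB : MeasurableSet B) : MeasurableSet {a | normRestrict W (f a) {y | (a, y) ∈ B} ≠ 0} := by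
  let κ : Kernel α (E d) := ⟨fun a => normRestrict W (f a), (measurable_normRestrict hW).comp hf⟩
  have : IsFiniteKernel κ := ⟨1, ENNReal.one_lt_top, fun a => normRestrict_univ_le W (f a)⟩
  exact (Kernel.measurable_kernel_prodMk_left (κ := κ) hB) (measurableSet_singleton 0).compl

/-- Quantifiers over points of the configuration become statements about vanishing mass. In this
form `Uniq` is seen to be measurable, one quantifier at a time. -/
lemma IsPointConfiguration.normRestrict_ne_zero {ν : Measure (E d)} (h : IsPointConfiguration ν)
    {W : Set (E d)} (hW : MeasurableSet W) (hWb : Bornology.IsBounded W) {S : Set (E d)} :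
    normRestrict W ν S ≠ 0 ↔ ∃ x ∈ atoms ν ∩ W, x ∈ S := by
  have h1 : (ν W)⁻¹ ≠ 0 := ENNReal.inv_ne_zero.2 (h.measure_ne_top hWb)
  simp only [normRestrict, Measure.smul_apply, smul_eq_mul, mul_ne_zero_iff]
  rw [and_iff_right h1, (h.restrict hW).exists_atom_iff, atoms_restrict]

/-- The triples `(ν, x, y)` such that `x` is linked to `y` by `k` steps between points of `ν`
in `W`. -/
def reach (r : ℝ) (W : Set (E d)) : ℕ → Set ((Measure (E d) × E d) × E d)
  | 0 => {p | p.1.2 = p.2}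
  | k + 1 => {p | normRestrict W p.1.1 {z | (p.1, z) ∈ reach r W k ∧ dist z p.2 < r} ≠ 0}

lemma measurableSet_reach {r : ℝ} {W : Set (E d)} (hW : MeasurableSet W) (k : ℕ) :
    MeasurableSet (reach r W k) := by
  induction k with
  | zero =>
    exact measurableSet_eq_fun (f := fun p : (Measure (E d) × E d) × E d => p.1.2)
      (g := fun p => p.2) (by fun_prop) (by fun_prop)
  | succ k ih =>
    refine measurableSet_normRestrict_ne_zero (α := (Measure (E d) × E d) × E d)
      (B := {q | (q.1.1, q.2) ∈ reach r W k ∧ dist q.2 q.1.2 < r}) hW (by fun_prop) ?_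
    exact (ih.preimage (by fun_prop)).inter (measurableSet_lt
      (f := fun q : ((Measure (E d) × E d) × E d) × E d => dist q.2 q.1.2) (g := fun _ => r)
      (by fun_prop) (by fun_prop))

lemma linked_iff_reach {r : ℝ} {W : Set (E d)} (hW : MeasurableSet W)
    (hWb : Bornology.IsBounded W) {ν : Measure (E d)} (h : IsPointConfiguration ν) {x y : E d}
    (hy : y ∈ atoms ν ∩ W) :
    Linked r (atoms ν ∩ W) x y ↔ ((ν, x), y) ∈ ⋃ k, reach r W k := by
  rw [mem_iUnion]
  constructor
  · intro hl
    clear hy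
    induction hl with
    | refl => exact ⟨0, rfl⟩
    | @tail u v _ hstep ih =>
      obtain ⟨k, hk⟩ := ih
      exact ⟨k + 1, (h.normRestrict_ne_zero hW hWb).2 ⟨u, hstep.1, hk, hstep.2.2⟩⟩
  · rintro ⟨k, hk⟩
    induction k generalizing y with
    | zero =>
      obtain rfl : x = y := hk
      exact Relation.ReflTransGen.refl
    | succ k ih =>
      obtain ⟨z, hz, hz', hzy⟩ := (h.normRestrict_ne_zero hW hWb).1 hk
      exact (ih hz hz').trans (Linked.single hz hy hzy)

/-- The pairs `(ν, x)` such that the cluster of `x` leaves the open cube. -/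
def exitsSet (r g : ℝ) (W : Set (E d)) : Set (Measure (E d) × E d) :=
  {p | normRestrict W p.1 {y | (p, y) ∈ ⋃ k, reach r W k ∧ y ∉ openBox (5 * g) 0} ≠ 0}

lemma measurableSet_exitsSet {r g : ℝ} {W : Set (E d)} (hW : MeasurableSet W) :
    MeasurableSet (exitsSet r g W) := by
  refine measurableSet_normRestrict_ne_zero (α := Measure (E d) × E d)
      (B := {q | q ∈ ⋃ k, reach r W k ∧ q.2 ∉ openBox (5 * g) 0}) hW (by fun_prop) ?_
  exact (MeasurableSet.iUnion fun k => measurableSet_reach hW k).inter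
    ((isOpen_openBox _ _).measurableSet.compl.preimage measurable_snd)

lemma exits_iff_exitsSet {r g : ℝ} {W : Set (E d)} (hW : MeasurableSet W)
    (hWb : Bornology.IsBounded W) {ν : Measure (E d)} (h : IsPointConfiguration ν) {x : E d}
    (hx : x ∈ atoms ν ∩ W) : Exits r (atoms ν ∩ W) g 0 x ↔ (ν, x) ∈ exitsSet r g W := by
  unfold exitsSet Exits
  rw [mem_ofPred_eq, h.normRestrict_ne_zero hW hWb]
  constructor
  · rintro ⟨y, hy, hyb⟩
    exact ⟨y, hy.mem hx, (linked_iff_reach hW hWb h (hy.mem hx)).1 hy, hyb⟩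
  · rintro ⟨y, hy, hy', hyb⟩
    exact ⟨y, (linked_iff_reach hW hWb h hy).2 hy', hyb⟩

/-- The configurations with a unique crossing cluster in `W`. -/
def uniqEvent (r g : ℝ) (W : Set (E d)) : Set (Measure (E d)) :=
  {ν | normRestrict W ν {x | x ∈ box (6 / 5 * g) 0 ∧ (ν, x) ∈ exitsSet r g W} ≠ 0 ∧
    ¬ normRestrict W ν {x | (x ∈ box (3 * g) 0 ∧ (ν, x) ∈ exitsSet r g W) ∧
      normRestrict W ν {x' | (x' ∈ box (3 * g) 0 ∧ (ν, x') ∈ exitsSet r g W) ∧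
        ((ν, x), x') ∉ ⋃ k, reach r W k} ≠ 0} ≠ 0}

lemma measurableSet_uniqEvent {r g : ℝ} {W : Set (E d)} (hW : MeasurableSet W) :
    MeasurableSet (uniqEvent r g W) := by
  refine MeasurableSet.inter ?_ (MeasurableSet.compl ?_)
  · refine measurableSet_normRestrict_ne_zero (α := Measure (E d))
      (B := {q | q.2 ∈ box (6 / 5 * g) 0 ∧ q ∈ exitsSet r g W}) hW measurable_id ?_
    exact ((measurableSet_box _ _).preimage measurable_snd).inter (measurableSet_exitsSet hW)
  · refine measurableSet_normRestrict_ne_zero (α := Measure (E d))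
      (B := {q | (q.2 ∈ box (3 * g) 0 ∧ q ∈ exitsSet r g W) ∧
        normRestrict W q.1 {x' | (x' ∈ box (3 * g) 0 ∧ (q.1, x') ∈ exitsSet r g W) ∧
        (q, x') ∉ ⋃ k, reach r W k} ≠ 0}) hW measurable_id ?_
    refine MeasurableSet.inter
      (((measurableSet_box _ _).preimage measurable_snd).inter (measurableSet_exitsSet hW)) ?_
    refine measurableSet_normRestrict_ne_zero (α := Measure (E d) × E d)
      (B := {q | (q.2 ∈ box (3 * g) 0 ∧ (q.1.1, q.2) ∈ exitsSet r g W) ∧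
        q ∉ ⋃ k, reach r W k}) hW measurable_fst ?_
    refine (((measurableSet_box _ _).preimage measurable_snd).inter
      ((measurableSet_exitsSet hW).preimage (by fun_prop))).inter ?_
    exact (MeasurableSet.iUnion fun k => measurableSet_reach hW k).compl

lemma uniq_iff_uniqEvent {r g : ℝ} {W : Set (E d)} (hW : MeasurableSet W)
    (hWb : Bornology.IsBounded W) {ν : Measure (E d)} (h : IsPointConfiguration ν) :
    Uniq r (atoms ν ∩ W) g 0 ↔ ν ∈ uniqEvent r g W := by
  unfold uniqEvent
  rw [mem_ofPred_eq, h.normRestrict_ne_zero hW hWb, h.normRestrict_ne_zero hW hWb]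
  constructor
  · rintro ⟨⟨x, hx, hxb, hxe⟩, hl⟩
    refine ⟨⟨x, hx, hxb, (exits_iff_exitsSet hW hWb h hx).1 hxe⟩, ?_⟩
    rintro ⟨x, hx, ⟨hxb, hxe⟩, hne⟩
    rw [h.normRestrict_ne_zero hW hWb] at hne
    obtain ⟨x', hx', ⟨hxb', hxe'⟩, hn⟩ := hne
    exact hn ((linked_iff_reach hW hWb h hx').1 (hl x hx x' hx' hxb hxb'
      ((exits_iff_exitsSet hW hWb h hx).2 hxe) ((exits_iff_exitsSet hW hWb h hx').2 hxe')))
  · rintro ⟨⟨x, hx, hxb, hxe⟩, hn⟩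
    refine ⟨⟨x, hx, hxb, (exits_iff_exitsSet hW hWb h hx).2 hxe⟩, ?_⟩
    intro x hx x' hx' hxb hxb' hxe hxe'
    by_contra hcon
    refine hn ⟨x, hx, ⟨hxb, (exits_iff_exitsSet hW hWb h hx).1 hxe⟩, ?_⟩
    rw [h.normRestrict_ne_zero hW hWb]
    exact ⟨x', hx', ⟨hxb', (exits_iff_exitsSet hW hWb h hx').1 hxe'⟩,
      fun hr => hcon ((linked_iff_reach hW hWb h hx').2 hr)⟩

/-! ### Point processes are determined by their counts -/

/-- The bounded measurable sets. -/
def boundedSets (d : ℕ) : Set (Set (E d)) := {B | MeasurableSet B ∧ Bornology.IsBounded B}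

/-- The mass of any set is the increasing limit of masses of bounded pieces. Only bounded sets have
counts that are certain to be finite. -/
lemma measurableSpace_measure_eq :
    (Measure.instMeasurableSpace : MeasurableSpace (Measure (E d))) =
      ⨆ B ∈ boundedSets d, (borel ℝ≥0∞).comap fun ν : Measure (E d) => ν B := by
  refine le_antisymm ?_ (iSup₂_le fun B hB => ?_)
  · refine iSup₂_le fun s hs => ?_
    have heq : (fun ν : Measure (E d) => ν s) =
        fun ν => ⨆ n : ℕ, ν (s ∩ Metric.closedBall 0 n) := by
      ext ν
      have hmono : Monotone fun n : ℕ => s ∩ Metric.closedBall (0 : E d) n := fun m n hmn =>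
        inter_subset_inter_right _ (Metric.closedBall_subset_closedBall (by exact_mod_cast hmn))
      rw [← hmono.measure_iUnion, ← inter_iUnion, Metric.iUnion_closedBall_nat, inter_univ]
    have : Measurable[⨆ B ∈ boundedSets d, (borel ℝ≥0∞).comap fun ν : Measure (E d) => ν B]
        (fun ν : Measure (E d) => ν s) := by
      rw [heq]
      refine @Measurable.iSup _ _ _ _ _ (_) _ _ _ _ _ _ fun n => ?_
      have hB : s ∩ Metric.closedBall (0 : E d) n ∈ boundedSets d :=
        ⟨hs.inter measurableSet_closedBall, Metric.isBounded_closedBall.subset inter_subset_right⟩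
      exact measurable_iff_comap_le.2 (le_iSup₂_of_le (f := fun B (_ : B ∈ boundedSets d) =>
        (borel ℝ≥0∞).comap fun ν : Measure (E d) => ν B) _ hB le_rfl)
    exact measurable_iff_comap_le.1 this
  · exact le_iSup₂_of_le (f := fun s (_ : MeasurableSet s) =>
      (borel ℝ≥0∞).comap fun ν : Measure (E d) => ν s) B hB.1 le_rfl

/-- The cells of the partition of `W` that is generated by a finite family of sets. -/
def cell (t : Finset (Set (E d))) (W : Set (E d)) (σ : t → Bool) : Set (E d) :=
  {x ∈ W | ∀ B : t, x ∈ (B : Set (E d)) ↔ σ B = true}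

lemma measurableSet_cell {t : Finset (Set (E d))} (ht : ∀ B ∈ t, MeasurableSet B) {W : Set (E d)}
    (hW : MeasurableSet W) (σ : t → Bool) : MeasurableSet (cell t W σ) := by
  have : cell t W σ = W ∩ ⋂ B : t, {x | x ∈ (B : Set (E d)) ↔ σ B = true} := by
    ext x; simp [cell]
  rw [this]
  refine hW.inter (MeasurableSet.iInter fun B => ?_)
  cases h : σ B
  · convert (ht B B.2).compl using 1
    ext; simp
  · convert ht B B.2 using 1
    ext; simp

lemma disjoint_cell (t : Finset (Set (E d))) (W : Set (E d)) {σ τ : t → Bool} (h : σ ≠ τ) :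
    Disjoint (cell t W σ) (cell t W τ) := by
  rw [Set.disjoint_left]
  intro x hx hx'
  refine h (funext fun B => ?_)
  have := (hx.2 B).symm.trans (hx'.2 B)
  exact Bool.eq_iff_iff.2 this

/-- The cell outside of all members of `t` is left out: the others are contained in some member of
`t`, so they are bounded when the members are. -/
lemma measure_eq_sum_cell {t : Finset (Set (E d))} (ht : ∀ B ∈ t, MeasurableSet B) {W : Set (E d)}
    (hW : MeasurableSet W) (ν : Measure (E d)) (B : t) :
    ν (B ∩ W) = ∑ σ : {σ : t → Bool // ∃ B, σ B = true},
      if σ.1 B = true then ν (cell t W σ.1) else 0 := by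
  classical
  rw [← Finset.sum_filter]
  rw [← measure_biUnion_finset]
  · congr 1
    ext x
    simp only [mem_inter_iff, Finset.mem_filter, Finset.mem_univ, true_and, mem_iUnion, exists_prop]
    constructor
    · rintro ⟨hxB, hxW⟩
      refine ⟨⟨fun B' => decide (x ∈ (B' : Set (E d))), ⟨B, by simpa using hxB⟩⟩,
        by simpa using hxB, hxW, fun B' => by simp⟩
    · rintro ⟨σ, hσ, hx⟩
      exact ⟨(hx.2 B).2 hσ, hx.1⟩
  · intro σ _ τ _ hστ
    exact disjoint_cell t W fun h => hστ (Subtype.ext h)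
  · exact fun σ _ => measurableSet_cell ht hW σ.1

/-- Two point processes with the same joint laws of the counts in disjoint bounded subsets of `W`
have the same law in `W`. -/
theorem map_restrict_eq {Ω : Type*} [MeasurableSpace Ω] {μ₁ μ₂ : Measure Ω}
    [IsFiniteMeasure μ₁] {X₁ X₂ : Ω → Measure (E d)} (hX₁ : Measurable X₁) (hX₂ : Measurable X₂)
    (hc₁ : ∀ ω, IsPointConfiguration (X₁ ω)) (hc₂ : ∀ ω, IsPointConfiguration (X₂ ω))
    {W : Set (E d)} (hW : MeasurableSet W)
    (h : ∀ (ι : Type) [Fintype ι] (B : ι → Set (E d)) (k : ι → ℕ), (∀ i, MeasurableSet (B i)) →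
      (∀ i, Bornology.IsBounded (B i)) → (∀ i, B i ⊆ W) →
      Pairwise (fun i j => Disjoint (B i) (B j)) →
      μ₁ {ω | ∀ i, X₁ ω (B i) = k i} = μ₂ {ω | ∀ i, X₂ ω (B i) = k i}) :
    μ₁.map (fun ω => (X₁ ω).restrict W) = μ₂.map (fun ω => (X₂ ω).restrict W) := by
  have hm₁ : Measurable (fun ω => (X₁ ω).restrict W) := (measurable_restrict hW).comp hX₁
  have hm₂ : Measurable (fun ω => (X₂ ω).restrict W) := (measurable_restrict hW).comp hX₂
  refine ext_of_generate_finite (piiUnionInter (fun B : Set (E d) => {s | MeasurableSet[(borel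
    ℝ≥0∞).comap fun ν : Measure (E d) => ν B] s}) (boundedSets d)) ?_ ?_ ?_ ?_
  · exact measurableSpace_measure_eq.trans (generateFrom_piiUnionInter_measurableSet
      (fun B => (borel ℝ≥0∞).comap fun ν : Measure (E d) => ν B) (boundedSets d)).symm
  · exact isPiSystem_piiUnionInter _ (fun B => @MeasurableSpace.isPiSystem_measurableSet _ (_)) _
  · rintro s ⟨t, ht, f, hf, rfl⟩
    have hSex : ∀ B, ∃ S : Set ℝ≥0∞, MeasurableSet S ∧
        (B ∈ t → (fun ν : Measure (E d) => ν B) ⁻¹' S = f B) := by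
      intro B
      by_cases hB : B ∈ t
      · obtain ⟨S, hS, hSf⟩ := hf B hB
        exact ⟨S, hS, fun _ => hSf⟩
      · exact ⟨∅, MeasurableSet.empty, fun h => absurd h hB⟩
    choose S hS hSf using hSex
    have htm : ∀ B ∈ t, MeasurableSet B := fun B hB => (ht hB).1
    have hfm : MeasurableSet (⋂ B ∈ t, f B) := by
      refine Finset.measurableSet_biInter t fun B hB => ?_
      rw [← hSf B hB]
      exact Measure.measurable_coe (htm B hB) (hS B)
    rw [Measure.map_apply hm₁ hfm, Measure.map_apply hm₂ hfm]
    -- The sets in `t` may overlap, but their counts are sums of counts of disjoint cells. The event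
    -- thus splits into countably many disjoint events that prescribe all cell counts, and these are
    -- covered by `h`.
    let ι := {σ : t → Bool // ∃ B, σ B = true}
    let K := {κ : ι → ℕ // ∀ B : t, (∑ σ : ι, if σ.1 B = true then (κ σ : ℝ≥0∞) else 0) ∈ S B}
    have hbdd : ∀ σ : ι, Bornology.IsBounded (cell t W σ.1) := by
      rintro ⟨σ, B, hσ⟩
      exact (ht B.2).2.subset fun x hx => (hx.2 B).2 hσ
    have key : ∀ (μ : Measure Ω) (X : Ω → Measure (E d)),
        Measurable X → (∀ ω, IsPointConfiguration (X ω)) →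
        μ ((fun ω => (X ω).restrict W) ⁻¹' ⋂ B ∈ t, f B) =
          ∑' κ : K, μ {ω | ∀ σ : ι, X ω (cell t W σ.1) = κ.1 σ} := by
      intro μ X hX hc
      rw [← measure_iUnion]
      · congr 1
        ext ω
        simp only [mem_preimage, mem_iInter, mem_iUnion, mem_ofPred_eq]
        have hiff : (∀ B ∈ t, (X ω).restrict W ∈ f B) ↔ ∀ B : t, X ω (B ∩ W) ∈ S B := by
          constructor
          · intro h B
            have := h B B.2
            rw [← hSf B B.2, mem_preimage, Measure.restrict_apply (htm B B.2)] at this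
            exact this
          · intro h B hB
            rw [← hSf B hB, mem_preimage, Measure.restrict_apply (htm B hB)]
            exact h ⟨B, hB⟩
        rw [hiff]
        constructor
        · intro hB
          choose κ hκ using fun σ : ι => hc ω _ (measurableSet_cell htm hW σ.1) (hbdd σ)
          refine ⟨⟨κ, fun B => ?_⟩, hκ⟩
          have := hB B
          rw [measure_eq_sum_cell htm hW] at this
          convert this using 1
          exact Finset.sum_congr rfl fun σ _ => by rw [hκ σ]
        · rintro ⟨κ, hκ⟩ B
          rw [measure_eq_sum_cell htm hW]
          convert κ.2 B using 1
          exact Finset.sum_congr rfl fun σ _ => by rw [hκ σ]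
      · intro κ κ' hκ
        rw [Function.onFun, Set.disjoint_left]
        intro ω h1 h2
        refine hκ (Subtype.ext (funext fun σ => ?_))
        have := (h1 σ).symm.trans (h2 σ)
        exact_mod_cast this
      · intro κ
        have : {ω | ∀ σ : ι, X ω (cell t W σ.1) = κ.1 σ} =
            ⋂ σ : ι, (fun ω => X ω (cell t W σ.1)) ⁻¹' {(κ.1 σ : ℝ≥0∞)} := by
          ext; simp
        rw [this]
        exact MeasurableSet.iInter fun σ =>
          ((Measure.measurable_coe (measurableSet_cell htm hW σ.1)).comp hX)
            (measurableSet_singleton _)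
    rw [key μ₁ X₁ hX₁ hc₁, key μ₂ X₂ hX₂ hc₂]
    refine tsum_congr fun κ => ?_
    have e := Fintype.equivFin ι
    have := h (Fin (Fintype.card ι)) (fun i => cell t W (e.symm i).1) (fun i => κ.1 (e.symm i))
      (fun i => measurableSet_cell htm hW _) (fun i => hbdd _) (fun i x hx => hx.1)
      (fun i j hij => disjoint_cell t W fun h => hij (e.symm.injective (Subtype.ext h)))
    convert this using 2
    · ext ω
      exact ⟨fun h i => h _, fun h σ => by simpa using h (e σ)⟩
    · ext ω
      exact ⟨fun h i => h _, fun h σ => by simpa using h (e σ)⟩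
  · rw [Measure.map_apply hm₁ MeasurableSet.univ, Measure.map_apply hm₂ MeasurableSet.univ]
    -- The empty family of sets gives equality of the total masses.
    have := h Empty (fun i => i.elim) (fun i => i.elim) (fun i => i.elim) (fun i => i.elim)
      (fun i => i.elim) (fun i => i.elim)
    simpa using this

/-! ### The law of a Cox process -/

section Cox

variable {Ω : Type*} [MeasurableSpace Ω] {P : Measure Ω} {Lam : Ω → Measure (E d)} {l : ℝ}
  {X : Ω → Measure (E d)}

/-- A Cox process can be modified on a null set to be a point configuration everywhere. -/
lemma IsCox.exists_regular (h : IsCox P Lam l X) :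
    ∃ X', X' =ᵐ[P] X ∧ IsCox P Lam l X' ∧ ∀ ω, IsPointConfiguration (X' ω) := by
  classical
  obtain ⟨N, hN, hNm, hN0⟩ := exists_measurable_superset_of_null (ae_iff.1 h.counting)
  have hae : Nᶜ.piecewise X (fun _ => 0) =ᵐ[P] X := by
    have : ∀ᵐ ω ∂P, ω ∉ N := measure_eq_zero_iff_ae_notMem.1 hN0
    filter_upwards [this] with ω hω
    exact Set.piecewise_eq_of_mem _ _ _ hω
  have hpc : ∀ ω, IsPointConfiguration (Nᶜ.piecewise X (fun _ => 0) ω) := by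
    intro ω
    by_cases hω : ω ∈ N
    · rw [Set.piecewise_eq_of_notMem _ _ _ (by simpa using hω)]
      exact fun B _ _ => ⟨0, by simp⟩
    · rw [Set.piecewise_eq_of_mem _ _ _ (by simpa using hω)]
      by_contra hcon
      exact hω (hN hcon)
  refine ⟨_, hae, ⟨Measurable.piecewise hNm.compl h.measurable measurable_const,
    Eventually.of_forall hpc, fun m B k A hB hBb hd hA => ?_⟩, hpc⟩
  rw [← h.law m B k A hB hBb hd hA]
  refine measure_congr ?_
  filter_upwards [hae] with ω hω
  show (_ ∧ _) = (_ ∧ _)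
  rw [hω]

/-- The probability that a Poisson variable with mean `l ν(B)` equals `k`. -/
noncomputable def poissonWeight (l : ℝ) (B : Set (E d)) (k : ℕ) (ν : Measure (E d)) : ℝ≥0∞ :=
  poissonMeasure (l.toNNReal * (ν B).toNNReal) {k}

lemma measurable_poissonWeight (l : ℝ) {B : Set (E d)} (hB : MeasurableSet B) (k : ℕ) :
    Measurable (poissonWeight l B k) := by
  unfold poissonWeight
  simp only [poissonMeasure_singleton]
  have : Measurable fun ν : Measure (E d) => (ν B).toNNReal :=
    (Measure.measurable_coe hB).ennreal_toNNReal
  fun_prop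

lemma IsCox.law_fintype (h : IsCox P Lam l X) {ι : Type*} [Fintype ι] (B : ι → Set (E d))
    (k : ι → ℕ) {A : Set (Measure (E d))} (hB : ∀ i, MeasurableSet (B i))
    (hBb : ∀ i, Bornology.IsBounded (B i)) (hd : Pairwise (fun i j => Disjoint (B i) (B j)))
    (hA : MeasurableSet A) :
    P (Lam ⁻¹' A ∩ {ω | ∀ i, X ω (B i) = k i}) =
      ∫⁻ ω in Lam ⁻¹' A, ∏ i, poissonWeight l (B i) (k i) (Lam ω) ∂P := by
  have e := Fintype.equivFin ι
  have := h.law (Fintype.card ι) (fun i => B (e.symm i)) (fun i => k (e.symm i)) A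
    (fun i => hB _) (fun i => hBb _) (fun i j hij => hd fun h => hij (e.symm.injective h)) hA
  convert this using 2
  · ext ω
    exact ⟨fun h => ⟨h.1, fun i => h.2 _⟩, fun h => ⟨h.1, fun σ => by simpa using h.2 (e σ)⟩⟩
  · ext ω
    exact (Equiv.prod_comp e.symm fun i => poissonWeight l (B i) (k i) (Lam ω)).symm

end Cox

section Cox

variable {Ω : Type*} [MeasurableSpace Ω] {P : Measure Ω} {Lam : Ω → Measure (E d)} {l : ℝ}
  {X : Ω → Measure (E d)}

lemma measurableSet_counts {ι : Type*} [Fintype ι] (hX : Measurable X) {B : ι → Set (E d)}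
    (hB : ∀ i, MeasurableSet (B i)) (k : ι → ℕ) : MeasurableSet {ω | ∀ i, X ω (B i) = k i} := by
  have : {ω | ∀ i, X ω (B i) = k i} = ⋂ i, (fun ω => X ω (B i)) ⁻¹' {(k i : ℝ≥0∞)} := by
    ext; simp
  rw [this]
  exact MeasurableSet.iInter fun i =>
    ((Measure.measurable_coe (hB i)).comp hX) (measurableSet_singleton _)

/-- The Cox process of a stationary random measure is stationary. -/
theorem IsCox.map_shift [IsProbabilityMeasure P] (h : IsCox P Lam l X)
    (hc : ∀ ω, IsPointConfiguration (X ω)) (hL : IsEnvironment P Lam) (t : E d) :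
    P.map (fun ω => shift t (X ω)) = P.map X := by
  have := map_restrict_eq (μ₁ := P) (μ₂ := P) (X₁ := fun ω => shift t (X ω)) (X₂ := X)
    ((measurable_shift t).comp h.measurable) h.measurable (fun ω => (hc ω).shift t) hc
    MeasurableSet.univ ?_
  · simpa using this
  · intro ι _ B k hB hBb _ hd
    have hB' : ∀ i, MeasurableSet ((fun y : E d => y - t) ⁻¹' B i) := fun i =>
      (hB i).preimage (by fun_prop)
    have h1 := h.law_fintype (fun i => (fun y : E d => y - t) ⁻¹' B i) k (A := univ) hB'
      (fun i => by
        have : (fun y => y - t) ⁻¹' B i = (fun y => y + t) '' B i := by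
          ext y; simp [sub_eq_add_neg]
        rw [this]
        exact (IsometryEquiv.addRight t).isometry.lipschitz.isBounded_image (hBb i))
      (fun i j hij => (hd hij).preimage _) MeasurableSet.univ
    have h2 := h.law_fintype B k (A := univ) hB hBb hd MeasurableSet.univ
    simp only [preimage_univ, univ_inter, Measure.restrict_univ] at h1 h2
    simp only [shift_apply]
    rw [h1, h2]
    have h3 : Measurable fun ν : Measure (E d) => ∏ i, poissonWeight l (B i) (k i) ν :=
      Finset.measurable_prod _ fun i _ => measurable_poissonWeight l (hB i) (k i)
    have h4 := ((hL.stationary t).comp h3).lintegral_eq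
    refine Eq.trans (lintegral_congr fun ω => ?_) h4
    simp [poissonWeight, shift_apply]

/-- The function `f` is the conditional probability of `C` given the random measure in `W`. -/
def IsCondProb (P : Measure Ω) (Lam : Ω → Measure (E d)) (W : Set (E d)) (C : Set Ω)
    (f : Measure (E d) → ℝ≥0∞) : Prop :=
  Measurable f ∧ (P.restrict C).map (fun ω => (Lam ω).restrict W) =
    (P.map (fun ω => (Lam ω).restrict W)).withDensity f

/-- A Radon–Nikodym density, capped at `1` so that the bound holds everywhere and not only almost
everywhere. -/
lemma exists_isCondProb [IsProbabilityMeasure P] (hLam : Measurable Lam) {W : Set (E d)}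
    (hW : MeasurableSet W) (C : Set Ω) : ∃ f, IsCondProb P Lam W C f ∧ ∀ ν, f ν ≤ 1 := by
  have hm : Measurable (fun ω => (Lam ω).restrict W) := (measurable_restrict hW).comp hLam
  set μ := (P.restrict C).map (fun ω => (Lam ω).restrict W)
  set ν := P.map (fun ω => (Lam ω).restrict W)
  have : IsProbabilityMeasure ν := Measure.isProbabilityMeasure_map hm.aemeasurable
  have : IsFiniteMeasure μ := Measure.isFiniteMeasure_map _ _
  have hle : μ ≤ ν := Measure.map_mono Measure.restrict_le_self hm
  have h1 : μ.rnDeriv ν ≤ᵐ[ν] 1 := Measure.rnDeriv_le_one_of_le hle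
  refine ⟨fun x => min (μ.rnDeriv ν x) 1, ⟨(Measure.measurable_rnDeriv _ _).min measurable_const,
    ?_⟩, fun x => min_le_right _ _⟩
  rw [withDensity_congr_ae (g := μ.rnDeriv ν)]
  · exact (Measure.withDensity_rnDeriv_eq _ _ (Measure.absolutelyContinuous_of_le hle)).symm
  · filter_upwards [h1] with x hx
    exact min_eq_left hx

/-- Both sides are the mean of the product of the two conditional probabilities given the random
measure in `W`. -/
lemma IsCondProb.setLIntegral_eq (hLam : Measurable Lam) {W : Set (E d)}
    (hW : MeasurableSet W) {C H : Set Ω} {f h : Measure (E d) → ℝ≥0∞} (hf : IsCondProb P Lam W C f)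
    (hh : IsCondProb P Lam W H h) :
    ∫⁻ ω in H, f ((Lam ω).restrict W) ∂P = ∫⁻ ω in C, h ((Lam ω).restrict W) ∂P := by
  have hm : Measurable (fun ω => (Lam ω).restrict W) := (measurable_restrict hW).comp hLam
  rw [← lintegral_map hf.1 hm, ← lintegral_map hh.1 hm, hf.2, hh.2,
    lintegral_withDensity_eq_lintegral_mul _ hh.1 hf.1,
    lintegral_withDensity_eq_lintegral_mul _ hf.1 hh.1, mul_comm]

lemma IsCondProb.apply (hLam : Measurable Lam) {W : Set (E d)}
    (hW : MeasurableSet W) {C : Set Ω} {f : Measure (E d) → ℝ≥0∞} (hf : IsCondProb P Lam W C f)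
    {A : Set (Measure (E d))} (hA : MeasurableSet A) :
    P ((fun ω => (Lam ω).restrict W) ⁻¹' A ∩ C) =
      ∫⁻ ω in (fun ω => (Lam ω).restrict W) ⁻¹' A, f ((Lam ω).restrict W) ∂P := by
  have hm : Measurable (fun ω => (Lam ω).restrict W) := (measurable_restrict hW).comp hLam
  have := congrArg (fun μ => μ A) hf.2
  simp only [Measure.map_apply hm hA, withDensity_apply _ hA] at this
  rw [Measure.restrict_apply (hm hA)] at this
  rw [this, setLIntegral_map hA hf.1 hm]

lemma poissonWeight_restrict {B W : Set (E d)} (hB : MeasurableSet B) (hBW : B ⊆ W) (k : ℕ)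
    (ν : Measure (E d)) : poissonWeight l B k (ν.restrict W) = poissonWeight l B k ν := by
  rw [poissonWeight, poissonWeight, Measure.restrict_apply hB, inter_eq_left.2 hBW]

lemma IsCox.isCondProb_counts (h : IsCox P Lam l X) (hLam : Measurable Lam) {W : Set (E d)}
    (hW : MeasurableSet W) {ι : Type*} [Fintype ι] {B : ι → Set (E d)} (k : ι → ℕ)
    (hB : ∀ i, MeasurableSet (B i)) (hBb : ∀ i, Bornology.IsBounded (B i)) (hBW : ∀ i, B i ⊆ W)
    (hd : Pairwise (fun i j => Disjoint (B i) (B j))) :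
    IsCondProb P Lam W {ω | ∀ i, X ω (B i) = k i}
      (fun ν => ∏ i, poissonWeight l (B i) (k i) ν) := by
  have hm : Measurable (fun ω => (Lam ω).restrict W) := (measurable_restrict hW).comp hLam
  have hf : Measurable fun ν : Measure (E d) => ∏ i, poissonWeight l (B i) (k i) ν :=
    Finset.measurable_prod _ fun i _ => measurable_poissonWeight l (hB i) (k i)
  refine ⟨hf, Measure.ext fun A hA => ?_⟩
  rw [Measure.map_apply hm hA, withDensity_apply _ hA, setLIntegral_map hA hf hm,
    Measure.restrict_apply (hm hA)]
  have := h.law_fintype B k (A := (fun ν => ν.restrict W) ⁻¹' A) hB hBb hd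
    (measurable_restrict hW hA)
  refine this.trans (lintegral_congr fun ω => ?_)
  simp only [poissonWeight_restrict (hB _) (hBW _)]

variable [IsProbabilityMeasure P]

/-- Given the random measure, the part of the Cox process in `W` depends neither on the random
measure nor on the Cox process outside of `W`. -/
theorem IsCox.condIndep (h : IsCox P Lam l X) (hc : ∀ ω, IsPointConfiguration (X ω))
    (hLam : Measurable Lam) {W : Set (E d)} (hW : MeasurableSet W) {C₀ D₀ A : Set (Measure (E d))}
    (hC₀ : MeasurableSet C₀) (hD₀ : MeasurableSet D₀) (hA : MeasurableSet A)
    {f : Measure (E d) → ℝ≥0∞}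
    (hf : IsCondProb P Lam W ((fun ω => (X ω).restrict W) ⁻¹' C₀) f) :
    P ((fun ω => (X ω).restrict W) ⁻¹' C₀ ∩ (Lam ⁻¹' A ∩ (fun ω => (X ω).restrict Wᶜ) ⁻¹' D₀)) =
      ∫⁻ ω in Lam ⁻¹' A ∩ (fun ω => (X ω).restrict Wᶜ) ⁻¹' D₀, f ((Lam ω).restrict W) ∂P := by
  have hmL : Measurable (fun ω => (Lam ω).restrict W) := (measurable_restrict hW).comp hLam
  have hmX : Measurable (fun ω => (X ω).restrict W) := (measurable_restrict hW).comp h.measurable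
  have hmX' : Measurable (fun ω => (X ω).restrict Wᶜ) :=
    (measurable_restrict hW.compl).comp h.measurable
  -- the counts outside of `W`
  have step1 : ∀ (κ : Type) [Fintype κ] (B' : κ → Set (E d)) (k' : κ → ℕ),
      (∀ i, MeasurableSet (B' i)) → (∀ i, Bornology.IsBounded (B' i)) → (∀ i, B' i ⊆ Wᶜ) →
      Pairwise (fun i j => Disjoint (B' i) (B' j)) →
      P ((fun ω => (X ω).restrict W) ⁻¹' C₀ ∩ (Lam ⁻¹' A ∩ {ω | ∀ i, X ω (B' i) = k' i})) =
      ∫⁻ ω in Lam ⁻¹' A ∩ {ω | ∀ i, X ω (B' i) = k' i}, f ((Lam ω).restrict W) ∂P := by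
    intro κ _ B' k' hB' hBb' hBW' hd'
    set D := {ω | ∀ i, X ω (B' i) = k' i} with hD
    have hDm : MeasurableSet D := measurableSet_counts h.measurable hB' k'
    set H := Lam ⁻¹' A ∩ D with hH
    have hHm : MeasurableSet H := (hLam hA).inter hDm
    obtain ⟨g, hg, -⟩ := exists_isCondProb (P := P) hLam hW H
    have hgm : Measurable fun ω => g ((Lam ω).restrict W) := hg.1.comp hmL
    have hDlaw : (P.restrict D).map Lam =
        (P.withDensity fun ω => ∏ i, poissonWeight l (B' i) (k' i) (Lam ω)).map Lam := by
      refine Measure.ext fun A' hA' => ?_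
      rw [Measure.map_apply hLam hA', Measure.map_apply hLam hA', withDensity_apply _ (hLam hA'),
        Measure.restrict_apply (hLam hA')]
      exact h.law_fintype B' k' hB' hBb' hd' hA'
    -- By `map_restrict_eq` it is enough to compare counts in `W`. For these, the joint law with the
    -- counts outside factorizes given `Lam`.
    have hlaw : (P.restrict H).map (fun ω => (X ω).restrict W) =
        (P.withDensity fun ω => g ((Lam ω).restrict W)).map (fun ω => (X ω).restrict W) := by
      refine map_restrict_eq h.measurable h.measurable hc hc hW ?_
      intro ι _ B k hB hBb hBW hd
      have hC0m := measurableSet_counts h.measurable hB k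
      have hC0 := h.isCondProb_counts hLam hW k hB hBb hBW hd
      rw [withDensity_apply _ hC0m, ← hC0.setLIntegral_eq hLam hW hg]
      simp only [poissonWeight_restrict (hB _) (hBW _)]
      have h1 := h.law_fintype (ι := ι ⊕ κ) (Sum.elim B B') (Sum.elim k k') (A := A)
        (by rintro (i | i); exacts [hB i, hB' i]) (by rintro (i | i); exacts [hBb i, hBb' i])
        (by
          rintro (i | i) (j | j) hij
          · exact hd fun h => hij (by rw [h])
          · exact Set.disjoint_of_subset (hBW i) (hBW' j) disjoint_compl_right
          · exact Set.disjoint_of_subset (hBW' i) (hBW j) disjoint_compl_left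
          · exact hd' fun h => hij (by rw [h])) hA
      simp only [Sum.forall, Sum.elim_inl, Sum.elim_inr, Fintype.prod_sum_type] at h1
      rw [Measure.restrict_apply hC0m]
      have h2 : {ω | ∀ i, X ω (B i) = k i} ∩ H = Lam ⁻¹' A ∩ {ω | (∀ i, X ω (B i) = k i) ∧
          ∀ i, X ω (B' i) = k' i} := by
        ext ω; simp only [hH, hD, mem_inter_iff, mem_ofPred_eq]; tauto
      have hφ : Measurable fun ν : Measure (E d) => ∏ i, poissonWeight l (B i) (k i) ν :=
        Finset.measurable_prod _ fun i _ => measurable_poissonWeight l (hB i) (k i)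
      have hφ' : Measurable fun ν : Measure (E d) => ∏ i, poissonWeight l (B' i) (k' i) ν :=
        Finset.measurable_prod _ fun i _ => measurable_poissonWeight l (hB' i) (k' i)
      rw [h2, h1, hH, ← Measure.restrict_restrict (hLam hA),
        ← setLIntegral_map (μ := P.restrict D) hA hφ hLam, hDlaw,
        setLIntegral_map hA hφ hLam]
      refine ((setLIntegral_withDensity_eq_setLIntegral_mul _ (hφ'.comp hLam) (hφ.comp hLam)
        (hLam hA)).trans (lintegral_congr fun ω => ?_)).symm
      exact mul_comm _ _
    have := congrArg (fun μ => μ C₀) hlaw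
    simp only [Measure.map_apply hmX hC₀, withDensity_apply _ (hmX hC₀),
      Measure.restrict_apply (hmX hC₀)] at this
    rw [this, hf.setLIntegral_eq hLam hW hg]
  have hCm := hmX hC₀
  set C := (fun ω => (X ω).restrict W) ⁻¹' C₀ with hC
  -- The same extension from counts to general events, now for the process outside of `W`.
  have hlaw : (P.restrict (C ∩ Lam ⁻¹' A)).map (fun ω => (X ω).restrict Wᶜ) =
      ((P.restrict (Lam ⁻¹' A)).withDensity fun ω => f ((Lam ω).restrict W)).map
        (fun ω => (X ω).restrict Wᶜ) := by
    refine map_restrict_eq h.measurable h.measurable hc hc hW.compl ?_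
    intro κ _ B' k' hB' hBb' hBW' hd'
    have hDm := measurableSet_counts h.measurable hB' k'
    rw [Measure.restrict_apply hDm, withDensity_apply _ hDm, Measure.restrict_restrict hDm,
      inter_comm, inter_assoc, step1 κ B' k' hB' hBb' hBW' hd', inter_comm]
  have := congrArg (fun μ => μ D₀) hlaw
  simp only [Measure.map_apply hmX' hD₀, withDensity_apply _ (hmX' hD₀),
      Measure.restrict_apply (hmX' hD₀), Measure.restrict_restrict (hmX' hD₀)] at this
  rw [← inter_assoc, inter_comm (C ∩ Lam ⁻¹' A), this, inter_comm]

/-- Given the random measure, the parts of the Cox process in disjoint windows are independent. -/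
theorem IsCox.prod_condProb (h : IsCox P Lam l X) (hc : ∀ ω, IsPointConfiguration (X ω))
    (hLam : Measurable Lam) {ι : Type*} (s : Finset ι) {W : ι → Set (E d)}
    (hW : ∀ i, MeasurableSet (W i)) (hd : ∀ i ∈ s, ∀ j ∈ s, i ≠ j → Disjoint (W i) (W j))
    {C₀ : ι → Set (Measure (E d))} (hC₀ : ∀ i, MeasurableSet (C₀ i))
    {f : ι → Measure (E d) → ℝ≥0∞}
    (hf : ∀ i, IsCondProb P Lam (W i) ((fun ω => (X ω).restrict (W i)) ⁻¹' C₀ i) (f i))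
    {A : Set (Measure (E d))} (hA : MeasurableSet A) :
    P (Lam ⁻¹' A ∩ ⋂ i ∈ s, (fun ω => (X ω).restrict (W i)) ⁻¹' C₀ i) =
      ∫⁻ ω in Lam ⁻¹' A, ∏ i ∈ s, f i ((Lam ω).restrict (W i)) ∂P := by
  classical
  induction s using Finset.induction_on generalizing A with
  | empty => simp
  | insert k s hk ih =>
    have ih := fun {A : Set (Measure (E d))} (hA : MeasurableSet A) =>
      ih (fun i hi j hj => hd i (Finset.mem_insert_of_mem hi) j (Finset.mem_insert_of_mem hj)) hA
    set D := ⋂ i ∈ s, (fun ω => (X ω).restrict (W i)) ⁻¹' C₀ i with hD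
    have hsub : ∀ i ∈ s, W i ⊆ (W k)ᶜ := fun i hi => by
      refine subset_compl_iff_disjoint_right.2 (hd i (Finset.mem_insert_of_mem hi) k
        (Finset.mem_insert_self k s) ?_)
      rintro rfl; exact hk hi
    have hDeq : D = (fun ω => (X ω).restrict (W k)ᶜ) ⁻¹'
        ⋂ i ∈ s, (fun ν => ν.restrict (W i)) ⁻¹' C₀ i := by
      rw [hD]
      ext ω
      simp only [mem_iInter, mem_preimage]
      refine forall₂_congr fun i hi => ?_
      rw [Measure.restrict_restrict (hW i), inter_eq_left.2 (hsub i hi)]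
    have hD₀ : MeasurableSet (⋂ i ∈ s, (fun ν : Measure (E d) => ν.restrict (W i)) ⁻¹' C₀ i) :=
      Finset.measurableSet_biInter s fun i _ => measurable_restrict (hW i) (hC₀ i)
    have hDm : MeasurableSet D := by
      rw [hDeq]; exact ((measurable_restrict (hW k).compl).comp h.measurable) hD₀
    have hfm : ∀ i, Measurable fun ν : Measure (E d) => f i (ν.restrict (W i)) := fun i =>
      (hf i).1.comp (measurable_restrict (hW i))
    have hφ : Measurable fun ν : Measure (E d) => ∏ i ∈ s, f i (ν.restrict (W i)) :=
      Finset.measurable_prod _ fun i _ => hfm i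
    have hDlaw : (P.restrict D).map Lam =
        (P.withDensity fun ω => ∏ i ∈ s, f i ((Lam ω).restrict (W i))).map Lam := by
      refine Measure.ext fun A' hA' => ?_
      rw [Measure.map_apply hLam hA', Measure.map_apply hLam hA', withDensity_apply _ (hLam hA'),
        Measure.restrict_apply (hLam hA')]
      exact ih hA'
    have h1 := h.condIndep hc hLam (hW k) (hC₀ k) hD₀ hA (hf k)
    rw [← hDeq] at h1
    rw [Finset.set_biInter_insert, ← hD, inter_left_comm, h1, ← Measure.restrict_restrict (hLam hA),
      ← setLIntegral_map (μ := P.restrict D) hA (hfm k) hLam, hDlaw,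
      setLIntegral_map hA (hfm k) hLam]
    refine (setLIntegral_withDensity_eq_setLIntegral_mul _ (hφ.comp hLam) ((hfm k).comp hLam)
      (hLam hA)).trans (lintegral_congr fun ω => ?_)
    rw [Finset.prod_insert hk]
    exact mul_comm _ _

end Cox

/-! ### Simultaneous bad events at distant sites -/

lemma countable_ratPoints (d : ℕ) : (ratPoints d).Countable := by
  have : ratPoints d ⊆ range fun q : Fin d → ℚ => (WithLp.toLp 2 fun i => (q i : ℝ) : E d) := by
    intro y hy
    choose q hq using hy
    exact ⟨q, by ext i; exact (hq i).symm⟩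
  exact (countable_range _).mono this

section

variable {Ω : Type*} [MeasurableSpace Ω] {P : Measure Ω} {Lam : Ω → Measure (E d)} {l : ℝ}
  {X : Ω → Measure (E d)} {R : E d → Ω → ℝ≥0∞}

lemma measurable_radiusSup (hR : ∀ x, Measurable (R x)) (n : ℝ) (x : E d) :
    Measurable (radiusSup R n x) := by
  unfold radiusSup
  exact Measurable.biSup _ ((countable_ratPoints d).mono inter_subset_right) fun y _ => hR y

lemma measurableSet_smallRadii (hR : ∀ x, Measurable (R x)) (n : ℝ) (x : E d) (m : ℝ) :
    MeasurableSet (smallRadii R n x m) :=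
  measurableSet_lt (measurable_radiusSup hR n x) measurable_const

variable [IsProbabilityMeasure P]

/-- A Poisson variable with mean zero vanishes almost surely. -/
lemma IsCox.measure_counts_pos (h : IsCox P Lam l X) (hLam : Measurable Lam)
    {B : Set (E d)} (hB : MeasurableSet B) (hBb : Bornology.IsBounded B) :
    P {ω | Lam ω B = 0 ∧ X ω B ≠ 0} = 0 := by
  have hA : MeasurableSet {ν : Measure (E d) | ν B = 0} :=
    Measure.measurable_coe hB (measurableSet_singleton 0)
  have h1 := h.law_fintype (ι := Unit) (fun _ => B) (fun _ => 0) (fun _ => hB) (fun _ => hBb)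
    (fun i j hij => absurd rfl hij) hA
  set Z := Lam ⁻¹' {ν : Measure (E d) | ν B = 0} with hZ
  have hZm : MeasurableSet Z := hLam hA
  have h2 : ∫⁻ ω in Z, ∏ _i : Unit, poissonWeight l B 0 (Lam ω) ∂P = P Z := by
    rw [← setLIntegral_one]
    refine setLIntegral_congr_fun hZm fun ω hω => ?_
    have hω : Lam ω B = 0 := hω
    simp [poissonWeight, poissonMeasure_singleton, hω]
  rw [h2] at h1
  have h0 : MeasurableSet {ω | ∀ _i : Unit, X ω B = (0 : ℕ)} :=
    measurableSet_counts h.measurable (fun _ => hB) fun _ => 0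
  have h3 := measure_inter_add_sdiff (μ := P) Z h0
  rw [h1] at h3
  have h4 : P (Z \ {ω | ∀ _i : Unit, X ω B = (0 : ℕ)}) = 0 := by
    have hfin : P Z ≠ ∞ := measure_ne_top P Z
    exact (ENNReal.add_right_inj hfin).1 (h3.trans (add_zero _).symm)
  refine measure_mono_null ?_ h4
  rintro ω ⟨hω, hω'⟩
  exact ⟨hω, fun h => hω' (by simpa using h ())⟩

open Classical in
/-- Under stabilization, the probability that bad events occur at all of a family of distant sites
is exponentially small. -/
theorem IsCox.measure_biInter_le (h : IsCox P Lam l X) (hc : ∀ ω, IsPointConfiguration (X ω))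
    (hL : IsEnvironment P Lam) (hR : IsStabilizing P Lam R) {n : ℕ} (hn : 1 ≤ n)
    {φ : Finset (E d)} (hφ : ∀ x ∈ φ, ∀ y ∈ φ, x ≠ y → 3 * (n : ℝ) < dist x y)
    (hdisj : ∀ x ∈ φ, ∀ y ∈ φ, x ≠ y → Disjoint (cube (n : ℝ) x) (cube (n : ℝ) y))
    {C₀ : E d → Set (Measure (E d))} (hC₀ : ∀ x, MeasurableSet (C₀ x)) (hC0 : ∀ x, 0 ∉ C₀ x)
    {p : ℝ≥0∞} (hp : ∀ x ∈ φ, P {ω | (X ω).restrict (cube (n : ℝ) x) ∉ C₀ x} +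
      P (smallRadii R n x n)ᶜ ≤ p) :
    P (⋂ x ∈ φ, {ω | (X ω).restrict (cube (n : ℝ) x) ∉ C₀ x}) ≤ p ^ φ.card := by
  have hLam := hL.measurable
  have hW : ∀ x : E d, MeasurableSet (cube (n : ℝ) x) := fun x => measurableSet_box _ x
  have hWb : ∀ x : E d, Bornology.IsBounded (cube (n : ℝ) x) := fun x => isBounded_box _ x
  have hmL : ∀ x, Measurable fun ω => (Lam ω).restrict (cube (n : ℝ) x) := fun x =>
    (measurable_restrict (hW x)).comp hLam
  have hmX : ∀ x, Measurable fun ω => (X ω).restrict (cube (n : ℝ) x) := fun x =>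
    (measurable_restrict (hW x)).comp h.measurable
  choose f hf hf1 using fun x : E d => exists_isCondProb (P := P) hLam (hW x)
    ((fun ω => (X ω).restrict (cube (n : ℝ) x)) ⁻¹' (C₀ x)ᶜ)
  have hprod := h.prod_condProb hc hLam φ hW hdisj (fun x => (hC₀ x).compl) hf MeasurableSet.univ
  simp only [preimage_univ, univ_inter, Measure.restrict_univ] at hprod
  have hsets : ⋂ x ∈ φ, {ω | (X ω).restrict (cube (n : ℝ) x) ∉ C₀ x} =
      ⋂ x ∈ φ, (fun ω => (X ω).restrict (cube (n : ℝ) x)) ⁻¹' (C₀ x)ᶜ := rfl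
  rw [hsets, hprod]
  -- a single function that applies the right conditional probability at each site
  set S : E d → Set (Measure (E d)) := fun x => {ν | ν (cube (n : ℝ) x)ᶜ = 0 ∧ ν univ ≠ 0} with hS
  have hSm : ∀ x, MeasurableSet (S x) := fun x =>
    (Measure.measurable_coe (hW x).compl (measurableSet_singleton 0)).inter
      (Measure.measurable_coe MeasurableSet.univ (measurableSet_singleton 0).compl)
  -- Stabilization yields independence only for one function common to all sites. As the cubes are
  -- disjoint, a nonzero restricted measure reveals its site, so `F` can select the right term. The
  -- complement `1 - f x` is used because the indicator of small radii gives `0` elsewhere, which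
  -- has to become the trivial bound `1` for the bad event.
  set F : Measure (E d) → ℝ≥0∞ := fun ν => ∑ x ∈ φ, (S x).indicator (fun ν => 1 - f x ν) ν with hF
  have hFm : Measurable F := Finset.measurable_sum _ fun x _ =>
    ((measurable_const.sub (hf x).1).indicator (hSm x))
  have hFle : ∀ ν, F ν ≤ φ.card := by
    intro ν
    refine (Finset.sum_le_card_nsmul φ _ 1 fun x _ => ?_).trans (by simp)
    refine (indicator_le_self _ _ _).trans tsub_le_self
  have hFtop : ∀ ν, F ν ≠ ∞ := fun ν => ne_top_of_le_ne_top (ENNReal.natCast_ne_top _) (hFle ν)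
  have hF0 : ∀ ν : Measure (E d), ν univ = 0 → F ν = 0 := by
    intro ν hν
    refine Finset.sum_eq_zero fun x _ => indicator_of_notMem ?_ _
    exact fun h => h.2 hν
  have hF1 : ∀ x ∈ φ, ∀ ν : Measure (E d), (ν.restrict (cube (n : ℝ) x)) univ ≠ 0 →
      F (ν.restrict (cube (n : ℝ) x)) = 1 - f x (ν.restrict (cube (n : ℝ) x)) := by
    intro x hx ν hν
    have hxS : ν.restrict (cube (n : ℝ) x) ∈ S x := by
      refine ⟨?_, hν⟩
      rw [Measure.restrict_apply (hW x).compl, compl_inter_self, measure_empty]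
    show ∑ y ∈ φ, _ = _
    rw [Finset.sum_eq_single_of_mem x hx, indicator_of_mem hxS]
    intro y hy hyx
    refine indicator_of_notMem ?_ _
    rintro ⟨h0, -⟩
    rw [Measure.restrict_apply (hW y).compl, inter_eq_right.2] at h0
    · rw [Measure.restrict_apply_univ] at hν
      exact hν h0
    · exact subset_compl_iff_disjoint_right.2 (hdisj x hx y hy hyx.symm)
  have hind := hR.indep n hn (fun ν => (F ν).toNNReal) hFm.ennreal_toNNReal
    ⟨φ.card, fun ν => by
      rw [← ENNReal.coe_le_coe, ENNReal.coe_toNNReal (hFtop ν)]; exact_mod_cast hFle ν⟩ φ hφ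
  have hind' := hind.comp (fun _ (t : ℝ≥0) => 1 - (t : ℝ≥0∞)) fun _ =>
    measurable_const.sub measurable_coe_nnreal_ennreal
  -- An upper bound for the conditional probability of the bad event at `x`, independent over the
  -- sites: it equals `f x` if the radii are small and the cube is charged by `Lam`, and `1`
  -- otherwise.
  set G : E d → Ω → ℝ≥0∞ := fun x ω => 1 - (((smallRadii R n x n).indicator
    (fun ω => (F ((Lam ω).restrict (cube (n : ℝ) x))).toNNReal) ω : ℝ≥0) : ℝ≥0∞) with hG
  have hGm : ∀ x, Measurable (G x) := fun x => measurable_const.sub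
    (((hFm.comp (hmL x)).ennreal_toNNReal.indicator
      (measurableSet_smallRadii hR.measurable _ _ _)).coe_nnreal_ennreal)
  have hGin : ∀ x ω, ω ∈ smallRadii R n x n → G x ω =
      1 - F ((Lam ω).restrict (cube (n : ℝ) x)) := by
    intro x ω hω
    simp only [hG]
    rw [indicator_of_mem hω, ENNReal.coe_toNNReal (hFtop _)]
  have hGout : ∀ x ω, ω ∉ smallRadii R n x n → G x ω = 1 := by
    intro x ω hω
    simp only [hG]
    rw [indicator_of_notMem hω]; simp
  have hFle' : ∀ x ∈ φ, ∀ ν : Measure (E d),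
      F (ν.restrict (cube (n : ℝ) x)) ≤ 1 - f x (ν.restrict (cube (n : ℝ) x)) := by
    intro x hx ν
    by_cases h0 : (ν.restrict (cube (n : ℝ) x)) univ = 0
    · rw [hF0 _ h0]; exact zero_le
    · rw [hF1 x hx ν h0]
  have hfG : ∀ x ∈ φ, ∀ ω, f x ((Lam ω).restrict (cube (n : ℝ) x)) ≤ G x ω := by
    intro x hx ω
    by_cases hω : ω ∈ smallRadii R n x n
    · rw [hGin x ω hω]
      calc f x ((Lam ω).restrict (cube (n : ℝ) x))
          = 1 - (1 - f x ((Lam ω).restrict (cube (n : ℝ) x))) :=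
            (ENNReal.sub_sub_cancel ENNReal.one_ne_top (hf1 x _)).symm
        _ ≤ _ := tsub_le_tsub_left (hFle' x hx _) _
    · rw [hGout x ω hω]; exact hf1 x _
  have hGint : ∀ x ∈ φ, ∫⁻ ω, G x ω ∂P ≤ p := by
    intro x hx
    refine le_trans ?_ (hp x hx)
    set B := {ω | (X ω).restrict (cube (n : ℝ) x) ∉ C₀ x} with hB
    set Z := (fun ω => (Lam ω).restrict (cube (n : ℝ) x)) ⁻¹' {ν | ν univ = 0} with hZ
    have hZ₀ : MeasurableSet {ν : Measure (E d) | ν univ = 0} :=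
      Measure.measurable_coe MeasurableSet.univ (measurableSet_singleton 0)
    have hZm : MeasurableSet Z := hmL x hZ₀
    -- Nothing is lost by `G x = 1` on `Z`: where `Lam` does not charge the cube, the process is
    -- almost surely empty there, and the empty configuration is bad by `hC0`.
    have hZB : P Z ≤ ∫⁻ ω in Z, f x ((Lam ω).restrict (cube (n : ℝ) x)) ∂P := by
      rw [← (hf x).apply hLam (hW x) hZ₀]
      have h0 := h.measure_counts_pos hLam (hW x) (hWb x)
      have hsub : Z ⊆ (Z ∩ (fun ω => (X ω).restrict (cube (n : ℝ) x)) ⁻¹' (C₀ x)ᶜ) ∪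
          {ω | Lam ω (cube (n : ℝ) x) = 0 ∧ X ω (cube (n : ℝ) x) ≠ 0} := by
        intro ω hω
        by_cases hωB : (X ω).restrict (cube (n : ℝ) x) ∈ C₀ x
        · right
          refine ⟨by simpa [hZ] using hω, fun h0 => hC0 x ?_⟩
          rwa [Measure.restrict_eq_zero.2 h0] at hωB
        · exact Or.inl ⟨hω, hωB⟩
      exact (measure_mono hsub).trans ((measure_union_le _ _).trans (by rw [h0, add_zero]))
    have hbd : ∫⁻ ω, G x ω ∂P ≤ ∫⁻ ω, (f x ((Lam ω).restrict (cube (n : ℝ) x)) +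
        (smallRadii R n x n)ᶜ.indicator 1 ω) ∂P := by
      rw [← lintegral_add_compl (G x) hZm,
        ← lintegral_add_compl (fun ω => f x ((Lam ω).restrict (cube (n : ℝ) x)) +
        (smallRadii R n x n)ᶜ.indicator 1 ω) hZm]
      refine add_le_add ?_ ?_
      · calc ∫⁻ ω in Z, G x ω ∂P ≤ ∫⁻ ω in Z, 1 ∂P := lintegral_mono fun ω => tsub_le_self
          _ = P Z := setLIntegral_one _
          _ ≤ _ := hZB
          _ ≤ _ := lintegral_mono fun ω => le_self_add
      · refine setLIntegral_mono' hZm.compl fun ω hω => ?_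
        by_cases hω' : ω ∈ smallRadii R n x n
        · rw [hGin x ω hω', hF1 x hx _ hω, ENNReal.sub_sub_cancel ENNReal.one_ne_top (hf1 x _)]
          exact le_self_add
        · rw [hGout x ω hω', indicator_of_mem (by exact hω')]
          exact le_add_self
    refine hbd.trans ?_
    have hfmx : Measurable fun ω => f x ((Lam ω).restrict (cube (n : ℝ) x)) :=
      (hf x).1.comp (hmL x)
    rw [lintegral_add_left hfmx, lintegral_indicator_one
      (measurableSet_smallRadii hR.measurable _ _ _).compl]
    gcongr
    have := (hf x).apply hLam (hW x) MeasurableSet.univ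
    simp only [preimage_univ, univ_inter, Measure.restrict_univ] at this
    rw [← this]
    rfl
  calc ∫⁻ ω, ∏ x ∈ φ, f x ((Lam ω).restrict (cube (n : ℝ) x)) ∂P
      ≤ ∫⁻ ω, ∏ x ∈ φ, G x ω ∂P :=
        lintegral_mono fun ω => Finset.prod_le_prod' fun x hx => hfG x hx ω
    _ = ∫⁻ ω, ∏ x : φ, G x ω ∂P := lintegral_congr fun ω =>
        (Finset.prod_coe_sort φ fun x => G x ω).symm
    _ = ∏ x : φ, ∫⁻ ω, G x ω ∂P :=
        lintegral_prod_eq_prod_lintegral_of_indepFun _ _ hind' fun x => hGm x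
    _ ≤ ∏ _x : φ, p := Finset.prod_le_prod' fun x _ => hGint x x.2
    _ = p ^ φ.card := by simp

end

/-! ### Moments of the Poisson distribution -/

section Poisson

lemma tsum_poissonMeasure (μ : ℝ≥0) : ∑' k : ℕ, poissonMeasure μ {k} = 1 := by
  have := measure_univ (μ := poissonMeasure μ)
  rwa [← lintegral_one, lintegral_countable', ← tsum_congr fun k => (one_mul _).symm] at this

lemma succ_mul_poissonMeasure (μ : ℝ≥0) (k : ℕ) :
    ((k + 1 : ℕ) : ℝ≥0∞) * poissonMeasure μ {k + 1} = μ * poissonMeasure μ {k} := by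
  rw [poissonMeasure_singleton, poissonMeasure_singleton, ← ENNReal.ofReal_natCast,
    ← ENNReal.ofReal_coe_nnreal, ← ENNReal.ofReal_mul (by positivity),
    ← ENNReal.ofReal_mul (by positivity)]
  congr 1
  rw [Nat.factorial_succ]
  push_cast
  field_simp
  exact (pow_succ' _ _)

lemma tsum_mul_poissonMeasure (μ : ℝ≥0) :
    ∑' k : ℕ, (k : ℝ≥0∞) * poissonMeasure μ {k} = μ := by
  rw [tsum_eq_zero_add' ENNReal.summable]
  simp only [succ_mul_poissonMeasure, ENNReal.tsum_mul_left, tsum_poissonMeasure]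
  simp

lemma tsum_sq_mul_poissonMeasure (μ : ℝ≥0) :
    ∑' k : ℕ, (k : ℝ≥0∞) ^ 2 * poissonMeasure μ {k} = μ ^ 2 + μ := by
  rw [tsum_eq_zero_add' ENNReal.summable]
  have (k : ℕ) : ((k + 1 : ℕ) : ℝ≥0∞) ^ 2 * poissonMeasure μ {k + 1} =
      μ * (k * poissonMeasure μ {k}) + μ * poissonMeasure μ {k} := by
    rw [sq, mul_assoc, succ_mul_poissonMeasure]
    push_cast
    ring
  simp only [this, ENNReal.tsum_add, ENNReal.tsum_mul_left, tsum_poissonMeasure,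
    tsum_mul_poissonMeasure]
  simp [sq]

end Poisson

/-! ### Counts of the Cox process and masses of cubes -/

section

variable {Ω : Type*} [MeasurableSpace Ω] {P : Measure Ω} {Lam : Ω → Measure (E d)} {l : ℝ}
  {X : Ω → Measure (E d)} {R : E d → Ω → ℝ≥0∞}

/-- Summation over the integer values of the count. Only the values of `φ` at integers matter, so
`φ` need not be measurable. -/
lemma IsCox.lintegral_comp_count (h : IsCox P Lam l X) (hL : Measurable Lam)
    {B : Set (E d)} (hB : MeasurableSet B) (hBb : Bornology.IsBounded B) {A : Set (Measure (E d))}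
    (hA : MeasurableSet A) (φ : ℝ≥0∞ → ℝ≥0∞) :
    ∫⁻ ω in Lam ⁻¹' A, φ (X ω B) ∂P =
      ∫⁻ ω in Lam ⁻¹' A, ∑' k : ℕ, φ k * poissonWeight l B k (Lam ω) ∂P := by
  have hm (k : ℕ) : MeasurableSet {ω | X ω B = k} := by
    simpa using measurableSet_counts (ι := Unit) h.measurable (fun _ => hB) fun _ => k
  have h1 : ∫⁻ ω in Lam ⁻¹' A, φ (X ω B) ∂P =
      ∫⁻ ω in Lam ⁻¹' A, ∑' k : ℕ, φ k * {ω | X ω B = k}.indicator 1 ω ∂P := by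
    refine lintegral_congr_ae (ae_restrict_of_ae ?_)
    filter_upwards [h.counting] with ω hω
    obtain ⟨k, hk⟩ := hω B hB hBb
    rw [tsum_eq_single k, indicator_of_mem (by exact hk), hk]
    · simp
    · intro k' hk'
      rw [indicator_of_notMem, mul_zero]
      show ¬ X ω B = _
      rw [hk]
      exact_mod_cast hk'.symm
  rw [h1, lintegral_tsum fun k => ((measurable_one.indicator (hm k)).const_mul _).aemeasurable,
    lintegral_tsum fun k : ℕ =>
      (show Measurable fun ω => φ k * poissonWeight l B k (Lam ω) from
        ((measurable_poissonWeight l hB k).comp hL).const_mul (φ k)).aemeasurable]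
  refine tsum_congr fun k => ?_
  rw [lintegral_const_mul _ (measurable_one.indicator (hm k)),
    lintegral_const_mul _ (show Measurable fun ω => poissonWeight l B k (Lam ω) from
      (measurable_poissonWeight l hB k).comp hL),
    lintegral_indicator_one (hm k), Measure.restrict_apply (hm k), inter_comm]
  congr 1
  have := h.law_fintype (ι := Unit) (fun _ => B) (fun _ => k) (fun _ => hB) (fun _ => hBb)
    (fun i j hij => absurd rfl hij) hA
  simpa using this

lemma coe_mean_le (l : ℝ) (a : ℝ≥0∞) :
    ((l.toNNReal * a.toNNReal : ℝ≥0) : ℝ≥0∞) ≤ ENNReal.ofReal l * a := by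
  rw [ENNReal.coe_mul]
  exact mul_le_mul_right ENNReal.coe_toNNReal_le_self _

lemma IsCox.setLIntegral_count_le (h : IsCox P Lam l X) (hL : Measurable Lam)
    {B : Set (E d)} (hB : MeasurableSet B) (hBb : Bornology.IsBounded B) {A : Set (Measure (E d))}
    (hA : MeasurableSet A) :
    ∫⁻ ω in Lam ⁻¹' A, X ω B ∂P ≤ ENNReal.ofReal l * ∫⁻ ω in Lam ⁻¹' A, Lam ω B ∂P := by
  have hLB : Measurable fun ω => Lam ω B := (Measure.measurable_coe hB).comp hL
  rw [h.lintegral_comp_count hL hB hBb hA fun x => x, ← lintegral_const_mul _ hLB]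
  refine lintegral_mono fun ω => ?_
  simp only [poissonWeight, tsum_mul_poissonMeasure]
  exact coe_mean_le l _

lemma IsCox.setLIntegral_count_sq_le (h : IsCox P Lam l X) (hL : Measurable Lam)
    {B : Set (E d)} (hB : MeasurableSet B) (hBb : Bornology.IsBounded B) {A : Set (Measure (E d))}
    (hA : MeasurableSet A) :
    ∫⁻ ω in Lam ⁻¹' A, X ω B ^ 2 ∂P ≤
      ∫⁻ ω in Lam ⁻¹' A, (ENNReal.ofReal l * Lam ω B) ^ 2 + ENNReal.ofReal l * Lam ω B ∂P := by
  rw [h.lintegral_comp_count hL hB hBb hA fun x => x ^ 2]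
  refine lintegral_mono fun ω => ?_
  simp only [poissonWeight, tsum_sq_mul_poissonMeasure]
  gcongr <;> exact coe_mean_le l _

lemma IsCox.measure_count_eq_zero (h : IsCox P Lam l X)
    {B : Set (E d)} (hB : MeasurableSet B) (hBb : Bornology.IsBounded B) :
    P {ω | X ω B = 0} =
      ∫⁻ ω, ENNReal.ofReal (Real.exp (-(l.toNNReal * (Lam ω B).toNNReal : ℝ≥0))) ∂P := by
  have := h.law_fintype (ι := Unit) (fun _ => B) (fun _ => 0) (fun _ => hB) (fun _ => hBb)
    (fun i j hij => absurd rfl hij) MeasurableSet.univ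
  simpa [poissonWeight, poissonMeasure_singleton] using this

lemma lintegral_shift (hL : IsEnvironment P Lam) {φ : Measure (E d) → ℝ≥0∞} (hφ : Measurable φ)
    (t : E d) : ∫⁻ ω, φ (shift t (Lam ω)) ∂P = ∫⁻ ω, φ (Lam ω) ∂P :=
  ((hL.stationary t).comp hφ).lintegral_eq

lemma shift_box (t z : E d) (ρ : ℝ) (ν : Measure (E d)) :
    shift t ν (box ρ z) = ν (box ρ (z + t)) := by
  rw [shift, Measure.map_apply (by fun_prop) (measurableSet_box _ _)]
  congr 1
  ext y
  simp only [box, mem_preimage, Set.mem_ofPred_eq, PiLp.sub_apply, PiLp.add_apply]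
  refine forall_congr' fun i => ?_
  rw [sub_sub, add_comm]

lemma lintegral_unit_box (hL : IsEnvironment P Lam) (t : E d) :
    ∫⁻ ω, Lam ω (box (1 / 2) t) ∂P = 1 := by
  have key (t : E d) : ∫⁻ ω, Lam ω (box (1 / 2) t) ∂P = ∫⁻ ω, Lam ω (box (1 / 2) 0) ∂P := by
    rw [← lintegral_shift hL (Measure.measurable_coe (measurableSet_box (1 / 2) (0 : E d))) t]
    simp only [shift_box, zero_add]
  rw [key, ← key (WithLp.toLp 2 fun _ => 1 / 2), ← hL.intensity]
  refine lintegral_congr fun ω => ?_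
  congr 1
  ext y
  simp only [box, Set.mem_ofPred_eq, mem_Icc, abs_le]
  refine forall_congr' fun i => ?_
  constructor <;> rintro ⟨h1, h2⟩ <;> constructor <;> linarith

/-- The masses of the unit cubes are uniformly integrable. -/
lemma exists_setLIntegral_unit_box_le (hL : IsEnvironment P Lam) {ε : ℝ} (hε : 0 < ε) :
    ∃ η : ℝ, 0 < η ∧ ∀ (A : Set Ω) (t : E d), P A ≤ ENNReal.ofReal η →
      ∫⁻ ω in A, Lam ω (box (1 / 2) t) ∂P ≤ ENNReal.ofReal ε := by
  set f : Measure (E d) → ℝ≥0∞ := fun ν => ν (box (1 / 2) 0) with hf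
  have hfm : Measurable f := Measure.measurable_coe (measurableSet_box _ _)
  have hfL : Measurable fun ω => f (Lam ω) := hfm.comp hL.measurable
  have hfi : ∫⁻ ω, f (Lam ω) ∂P = 1 := lintegral_unit_box hL 0
  have htend : Tendsto (fun n : ℕ => ∫⁻ ω, (f (Lam ω) - n) ∂P) atTop (𝓝 (∫⁻ _, 0 ∂P)) := by
    refine tendsto_lintegral_of_dominated_convergence (fun ω => f (Lam ω))
      (fun n => hfL.sub_const _) (fun n => Eventually.of_forall fun ω => tsub_le_self)
      (by rw [hfi]; exact ENNReal.one_ne_top) ?_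
    filter_upwards [ae_lt_top hfL (by rw [hfi]; exact ENNReal.one_ne_top)] with ω hω
    obtain ⟨N, hN⟩ := ENNReal.exists_nat_gt hω.ne
    refine tendsto_const_nhds.congr' ?_
    filter_upwards [eventually_ge_atTop N] with n hn
    rw [tsub_eq_zero_of_le]
    exact hN.le.trans (by exact_mod_cast hn)
  rw [lintegral_zero] at htend
  obtain ⟨b, hb⟩ := ((tendsto_order.1 htend).2 (ENNReal.ofReal (ε / 2))
    (ENNReal.ofReal_pos.2 (by positivity))).exists
  refine ⟨ε / 2 / (b + 1), by positivity, fun A t hA => ?_⟩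
  -- By stationarity the mean excess over the level `b` does not depend on `t`, so one `η` serves
  -- all unit cubes.
  have h1 : ∫⁻ ω, (Lam ω (box (1 / 2) t) - b) ∂P = ∫⁻ ω, (f (Lam ω) - b) ∂P := by
    rw [← lintegral_shift hL (φ := fun ν => f ν - b) (hfm.sub_const _) t]
    simp only [hf, shift_box, zero_add]
  calc ∫⁻ ω in A, Lam ω (box (1 / 2) t) ∂P
      ≤ ∫⁻ ω in A, ((Lam ω (box (1 / 2) t) - b) + b) ∂P := lintegral_mono fun ω => le_tsub_add
    _ = ∫⁻ ω in A, (Lam ω (box (1 / 2) t) - b) ∂P + b * P A := by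
        rw [lintegral_add_right _ measurable_const, setLIntegral_const]
    _ ≤ ENNReal.ofReal (ε / 2) + ENNReal.ofReal (ε / 2) := by
        gcongr
        · exact (setLIntegral_le_lintegral _ _).trans (h1.trans_le hb.le)
        · calc (b : ℝ≥0∞) * P A ≤ ENNReal.ofReal b * ENNReal.ofReal (ε / 2 / (b + 1)) := by
                rw [ENNReal.ofReal_natCast]; gcongr
            _ = ENNReal.ofReal (b * (ε / 2 / (b + 1))) := (ENNReal.ofReal_mul (by positivity)).symm
            _ ≤ _ := by
                refine ENNReal.ofReal_le_ofReal ?_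
                rw [mul_div_assoc', div_le_iff₀ (by positivity)]
                nlinarith
    _ = ENNReal.ofReal ε := by
        rw [← ENNReal.ofReal_add (by positivity) (by positivity), add_halves]

/-- The lattice points of `ℤ^d` with coordinates bounded by `J`. -/
noncomputable def latticeBox (d J : ℕ) : Finset (Fin d → ℤ) :=
  Fintype.piFinset fun _ => Finset.Icc (-J : ℤ) J

lemma mem_latticeBox {J : ℕ} {j : Fin d → ℤ} : j ∈ latticeBox d J ↔ ∀ i, |j i| ≤ J := by
  simp [latticeBox, abs_le]

lemma card_latticeBox (d J : ℕ) : (latticeBox d J).card = (2 * J + 1) ^ d := by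
  simp only [latticeBox, Fintype.card_piFinset, Int.card_Icc, Finset.prod_const, Finset.card_univ,
    Fintype.card_fin]
  congr 1
  omega

lemma box_subset_iUnion_unit_box {ρ : ℝ} {J : ℕ} (hJ : ρ + 1 / 2 ≤ J) (z : E d) :
    box ρ z ⊆ ⋃ j ∈ latticeBox d J, box (1 / 2) (site 1 z j) := by
  intro y hy
  have h1 (i) := abs_sub_round (y i - z i)
  refine mem_iUnion₂.2 ⟨fun i => round (y i - z i), mem_latticeBox.2 fun i => ?_, fun i => ?_⟩
  · have h2 := abs_le.1 (hy i)
    have h3 := abs_le.1 (h1 i)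
    have : |(round (y i - z i) : ℝ)| ≤ J := by rw [abs_le]; constructor <;> linarith
    exact_mod_cast this
  · rw [site_apply]
    have h4 := h1 i
    rwa [sub_sub, ← one_mul (round (y i - z i) : ℝ)] at h4

/-- A cube of side `m ≥ 1` is covered by at most `(6 m)^d` unit cubes. -/
lemma setLIntegral_box_le {c : ℝ≥0∞} {A : Set Ω} (hL : Measurable Lam)
    (hA : ∀ t, ∫⁻ ω in A, Lam ω (box (1 / 2) t) ∂P ≤ c) {m : ℝ} (hm : 1 ≤ m) (z : E d) :
    ∫⁻ ω in A, Lam ω (box (m / 2) z) ∂P ≤ ENNReal.ofReal ((6 * m) ^ d) * c := by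
  obtain ⟨J, hJ1, hJ2⟩ : ∃ J : ℕ, m / 2 + 1 / 2 ≤ J ∧ (J : ℝ) < m / 2 + 1 / 2 + 1 :=
    ⟨⌈m / 2 + 1 / 2⌉₊, Nat.le_ceil _, Nat.ceil_lt_add_one (by positivity)⟩
  calc ∫⁻ ω in A, Lam ω (box (m / 2) z) ∂P
      ≤ ∫⁻ ω in A, ∑ j ∈ latticeBox d J, Lam ω (box (1 / 2) (site 1 z j)) ∂P :=
        lintegral_mono fun ω => (measure_mono (box_subset_iUnion_unit_box hJ1 z)).trans
          (measure_biUnion_finset_le _ _)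
    _ = ∑ j ∈ latticeBox d J, ∫⁻ ω in A, Lam ω (box (1 / 2) (site 1 z j)) ∂P :=
        lintegral_finsetSum _ fun j _ => (Measure.measurable_coe (measurableSet_box _ _)).comp hL
    _ ≤ ∑ j ∈ latticeBox d J, c := Finset.sum_le_sum fun j _ => hA _
    _ = ((2 * J + 1 : ℕ) : ℝ≥0∞) ^ d * c := by
        rw [Finset.sum_const, card_latticeBox, nsmul_eq_mul]; push_cast; rfl
    _ ≤ _ := by
        gcongr
        rw [ENNReal.ofReal_pow (by positivity), ← ENNReal.ofReal_natCast]
        gcongr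
        push_cast
        linarith

lemma lintegral_box_le (hL : IsEnvironment P Lam) {m : ℝ} (hm : 1 ≤ m) (z : E d) :
    ∫⁻ ω, Lam ω (box (m / 2) z) ∂P ≤ ENNReal.ofReal ((6 * m) ^ d) := by
  have := setLIntegral_box_le (P := P) (A := univ) hL.measurable
    (fun t => by rw [Measure.restrict_univ, lintegral_unit_box hL t]) hm z
  simpa using this

end

/-! ### From small probability to small Palm probability -/

section

variable {Ω : Type*} [MeasurableSpace Ω] {P : Measure Ω} {Lam : Ω → Measure (E d)}

/-- On events of small probability, the number of points in a large cube has a small mean,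
relative to its intensity; this is uniform in the intensity and the size of the cube as long
as the mean number of points stays away from zero. -/
lemma exists_setLIntegral_count_le [IsProbabilityMeasure P] (hL : IsEnvironment P Lam)
    {ε c : ℝ} (hε : 0 < ε) (hc : 0 < c) :
    ∃ η : ℝ, 0 < η ∧ ∀ (m l : ℝ) (X : Ω → Measure (E d)) (A : Set Ω), 1 ≤ m → 0 ≤ l →
      c ≤ l * m ^ d → IsCox P Lam l X → P A ≤ ENNReal.ofReal η →
      ∫⁻ ω in A, X ω (box (m / 2) 0) ∂P ≤ ENNReal.ofReal (ε * (l * m ^ d)) := by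
  obtain ⟨η₁, hη₁, h1⟩ := exists_setLIntegral_unit_box_le hL (ε := ε / 2 / 6 ^ d) (by positivity)
  -- By Markov's inequality, `Lam Q > M m^d` has probability at most `η₁`, and there the first
  -- moment is small by uniform integrability. On the complement the second moment of the count is
  -- at most `M² y² + M y`, and `x ≤ β y + x² / (β y)` with large `β` controls the mean on `A`.
  set M : ℝ := 6 ^ d / η₁ with hM
  have hMpos : 0 < M := by positivity
  set β : ℝ := 1 + 8 * M ^ 2 / ε + 8 * M / (c * ε) with hβ
  have hβpos : 1 ≤ β := by
    have : 0 ≤ 8 * M ^ 2 / ε := by positivity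
    have : 0 ≤ 8 * M / (c * ε) := by positivity
    linarith
  refine ⟨ε / (4 * β), by positivity, fun m l X A hm hl hcl hX hA => ?_⟩
  have hm0 : 0 < m := by linarith
  set y := l * m ^ d with hy
  have hy0 : 0 < y := by linarith
  set Q : Set (E d) := box (m / 2) 0 with hQ
  have hQm : MeasurableSet Q := measurableSet_box _ _
  have hQb : Bornology.IsBounded Q := isBounded_box _ _
  set G : Set (Measure (E d)) := {ν | ν Q ≤ ENNReal.ofReal (M * m ^ d)} with hG
  have hGm : MeasurableSet G := measurableSet_le (Measure.measurable_coe hQm) measurable_const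
  have hLQ : Measurable fun ω => Lam ω Q := (Measure.measurable_coe hQm).comp hL.measurable
  have hPG : P (Lam ⁻¹' Gᶜ) ≤ ENNReal.ofReal η₁ := by
    have hmark := meas_ge_le_lintegral_div (μ := P) hLQ.aemeasurable
      (ε := ENNReal.ofReal (M * m ^ d)) (ENNReal.ofReal_pos.2 (by positivity)).ne'
      ENNReal.ofReal_ne_top
    refine (measure_mono fun ω hω => ?_).trans (hmark.trans ?_)
    · have hω' : ¬ Lam ω Q ≤ ENNReal.ofReal (M * m ^ d) := hω
      exact (not_le.1 hω').le
    · rw [ENNReal.div_le_iff (ENNReal.ofReal_pos.2 (by positivity)).ne' ENNReal.ofReal_ne_top,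
        ← ENNReal.ofReal_mul hη₁.le]
      refine (lintegral_box_le hL hm 0).trans (ENNReal.ofReal_le_ofReal (le_of_eq ?_))
      rw [hM, mul_pow]
      field_simp
  have hGc : ∫⁻ ω in Lam ⁻¹' Gᶜ, X ω Q ∂P ≤ ENNReal.ofReal (ε / 2 * y) := by
    refine (hX.setLIntegral_count_le hL.measurable hQm hQb hGm.compl).trans ?_
    refine (mul_le_mul_right (setLIntegral_box_le (c := ENNReal.ofReal (ε / 2 / 6 ^ d))
      hL.measurable (fun t => h1 _ t hPG) hm 0) _).trans ?_
    rw [← ENNReal.ofReal_mul (by positivity), ← ENNReal.ofReal_mul hl]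
    refine ENNReal.ofReal_le_ofReal (le_of_eq ?_)
    rw [hy, mul_pow]
    field_simp
  have hGsq : ∫⁻ ω in Lam ⁻¹' G, X ω Q ^ 2 ∂P ≤ ENNReal.ofReal (M ^ 2 * y ^ 2 + M * y) := by
    refine (hX.setLIntegral_count_sq_le hL.measurable hQm hQb hGm).trans ?_
    calc _ ≤ ∫⁻ ω in Lam ⁻¹' G, ENNReal.ofReal (M ^ 2 * y ^ 2 + M * y) ∂P := by
          refine setLIntegral_mono' (hL.measurable hGm) fun ω hω => ?_
          have h2 : ENNReal.ofReal l * Lam ω Q ≤ ENNReal.ofReal (M * y) := by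
            refine (mul_le_mul_right (show Lam ω Q ≤ _ from hω) _).trans ?_
            rw [← ENNReal.ofReal_mul hl]
            refine ENNReal.ofReal_le_ofReal (le_of_eq ?_)
            rw [hy]; ring
          refine (add_le_add (pow_le_pow_left' h2 2) h2).trans ?_
          rw [← ENNReal.ofReal_pow (by positivity), ← ENNReal.ofReal_add (by positivity)
            (by positivity), mul_pow]
      _ ≤ _ := by
          rw [setLIntegral_const]
          exact (mul_le_mul_right prob_le_one _).trans (mul_one _).le
  have hb0 : ENNReal.ofReal (β * y) ≠ 0 := (ENNReal.ofReal_pos.2 (by positivity)).ne'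
  have hpt (x : ℝ≥0∞) : x ≤ ENNReal.ofReal (β * y) + (ENNReal.ofReal (β * y))⁻¹ * x ^ 2 := by
    rcases le_or_gt x (ENNReal.ofReal (β * y)) with h | h
    · exact h.trans le_self_add
    · refine le_trans ?_ le_add_self
      rw [mul_comm, ← div_eq_mul_inv,
        ENNReal.le_div_iff_mul_le (Or.inl hb0) (Or.inl ENNReal.ofReal_ne_top), sq]
      gcongr
  have hXQ : Measurable fun ω => X ω Q := (Measure.measurable_coe hQm).comp hX.measurable
  calc ∫⁻ ω in A, X ω Q ∂P
      ≤ ∫⁻ ω in A ∩ Lam ⁻¹' G, X ω Q ∂P + ∫⁻ ω in Lam ⁻¹' Gᶜ, X ω Q ∂P := by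
        refine (lintegral_mono_set (t := A ∩ Lam ⁻¹' G ∪ Lam ⁻¹' Gᶜ) fun ω hω => ?_).trans
          (lintegral_union_le _ _ _)
        by_cases h : Lam ω ∈ G
        · exact Or.inl ⟨hω, h⟩
        · exact Or.inr h
    _ ≤ (∫⁻ ω in A ∩ Lam ⁻¹' G, ENNReal.ofReal (β * y) ∂P +
          ∫⁻ ω in Lam ⁻¹' G, (ENNReal.ofReal (β * y))⁻¹ * X ω Q ^ 2 ∂P) +
          ENNReal.ofReal (ε / 2 * y) := by
        gcongr
        refine (lintegral_mono fun ω => hpt _).trans ?_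
        rw [lintegral_add_left measurable_const]
        gcongr
        exact inter_subset_right
    _ ≤ (ENNReal.ofReal (β * y) * ENNReal.ofReal (ε / (4 * β)) +
          ENNReal.ofReal ((β * y)⁻¹) * ENNReal.ofReal (M ^ 2 * y ^ 2 + M * y)) +
          ENNReal.ofReal (ε / 2 * y) := by
        rw [setLIntegral_const, lintegral_const_mul _ (hXQ.pow_const 2),
          ENNReal.ofReal_inv_of_pos (by positivity)]
        gcongr
        exact (measure_mono inter_subset_left).trans hA
    _ = ENNReal.ofReal (β * y * (ε / (4 * β)) + (β * y)⁻¹ * (M ^ 2 * y ^ 2 + M * y) +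
          ε / 2 * y) := by
        rw [← ENNReal.ofReal_mul (by positivity), ← ENNReal.ofReal_mul (by positivity),
          ← ENNReal.ofReal_add (by positivity) (by positivity),
          ← ENNReal.ofReal_add (by positivity) (by positivity)]
    _ ≤ ENNReal.ofReal (ε * y) := by
        refine ENNReal.ofReal_le_ofReal ?_
        have e1 : β * y * (ε / (4 * β)) = ε / 4 * y := by field_simp
        have e2 : (β * y)⁻¹ * (M ^ 2 * y ^ 2 + M * y) = (M ^ 2 * y + M) / β := by field_simp
        have e3 : (M ^ 2 * y + M) / β ≤ ε / 4 * y := by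
          rw [div_le_iff₀ (by positivity)]
          have h3 : ε / 4 * y * (8 * M ^ 2 / ε) = 2 * (M ^ 2 * y) := by field_simp; ring
          have h4 : ε / 4 * y * (8 * M / (c * ε)) = 2 * (M * (y / c)) := by field_simp; ring
          have h5 : 1 ≤ y / c := by rw [le_div_iff₀ hc]; linarith
          have h6 : M * 1 ≤ M * (y / c) := by gcongr
          have h7 : 0 ≤ M ^ 2 * y := by positivity
          have h8 : 0 ≤ ε / 4 * y := by positivity
          rw [hβ, mul_add, mul_add, h3, h4]
          linarith
        rw [e1, e2]
        linarith

lemma IsCox.lintegral_shift {l : ℝ} {X : Ω → Measure (E d)} [IsProbabilityMeasure P]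
    (hX : IsCox P Lam l X) (hc : ∀ ω, IsPointConfiguration (X ω)) (hL : IsEnvironment P Lam)
    {φ : Measure (E d) → ℝ≥0∞} (hφ : Measurable φ) (t : E d) :
    ∫⁻ ω, φ (shift t (X ω)) ∂P = ∫⁻ ω, φ (X ω) ∂P := by
  have h := hX.map_shift hc hL t
  have h1 := lintegral_map (μ := P) hφ hX.measurable
  have h2 := lintegral_map (μ := P) hφ ((measurable_shift t).comp hX.measurable)
  rw [← h1, ← h]
  exact h2.symm

/-- Unit cubes at the sites of the lattice with spacing `2` are disjoint, and at least `(m / 5)^d`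
of them fit into the cube of side `m`. -/
lemma exists_latticeBox_card {m : ℝ} (hm : 1 ≤ m) :
    ∃ J : ℕ, (J : ℝ) ≤ (m - 1) / 4 ∧ m / 5 ≤ 2 * J + 1 := by
  obtain ⟨J, hJ1, hJ2⟩ : ∃ J : ℕ, (J : ℝ) ≤ (m - 1) / 4 ∧ (m - 1) / 4 < J + 1 :=
    ⟨⌊(m - 1) / 4⌋₊, Nat.floor_le (by linarith), Nat.lt_floor_add_one _⟩
  refine ⟨J, hJ1, ?_⟩
  rcases le_or_gt m 5 with h5 | h5
  · have : (0 : ℝ) ≤ J := by positivity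
    linarith
  · linarith

lemma abs_two_mul_le {m : ℝ} {J : ℕ} (hJ : (J : ℝ) ≤ (m - 1) / 4) {j : Fin d → ℤ}
    (hj : j ∈ latticeBox d J) (i : Fin d) : |2 * (j i : ℝ)| ≤ (m - 1) / 2 := by
  have : |(j i : ℝ)| ≤ J := by exact_mod_cast mem_latticeBox.1 hj i
  rw [abs_mul, abs_two]
  linarith

lemma unit_box_subset {m : ℝ} {J : ℕ} (hJ : (J : ℝ) ≤ (m - 1) / 4) {j : Fin d → ℤ}
    (hj : j ∈ latticeBox d J) : box (1 / 2) (site 2 (0 : E d) j) ⊆ box (m / 2) 0 := by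
  intro y hy i
  have h1 := abs_le.1 (hy i)
  have h2 := abs_le.1 (abs_two_mul_le hJ hj i)
  simp only [site_apply, PiLp.zero_apply, zero_add] at h1
  rw [PiLp.zero_apply, sub_zero, abs_le]
  constructor <;> linarith

lemma pairwiseDisjoint_unit_box (T : Set (Fin d → ℤ)) :
    PairwiseDisjoint T fun j => box (1 / 2) (site 2 (0 : E d) j) := by
  intro j _ j' _ hjj
  refine Set.disjoint_left.2 fun y hy hy' => hjj (funext fun i => ?_)
  have h1 := abs_le.1 (hy i)
  have h2 := abs_le.1 (hy' i)
  simp only [site_apply, PiLp.zero_apply, zero_add] at h1 h2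
  have h3 : (j i : ℝ) < j' i + 1 := by linarith
  have h4 : (j' i : ℝ) < j i + 1 := by linarith
  have h3' : j i < j' i + 1 := by exact_mod_cast h3
  have h4' : j' i < j i + 1 := by exact_mod_cast h4
  omega

/-- An event of small probability, centred at a suitable point, captures only a small part of the
points in the unit cube. -/
lemma exists_lintegral_count_shift_le [IsProbabilityMeasure P] (hL : IsEnvironment P Lam)
    {ε c : ℝ} (hε : 0 < ε) (hc : 0 < c) :
    ∃ η : ℝ, 0 < η ∧ ∀ (m l : ℝ) (X : Ω → Measure (E d)) (A : Set (Measure (E d))), 1 ≤ m → 0 ≤ l →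
      c ≤ l * m ^ d → IsCox P Lam l X → (∀ ω, IsPointConfiguration (X ω)) → MeasurableSet A →
      P (X ⁻¹' A) ≤ ENNReal.ofReal η →
      ∃ t ∈ box (m / 2) (0 : E d), ∫⁻ ω in {ω | shift (-t) (X ω) ∈ A}, X ω (box (1 / 2) 0) ∂P ≤
        ENNReal.ofReal (ε * l) := by
  obtain ⟨η, hη, h⟩ := exists_setLIntegral_count_le hL (ε := ε / 5 ^ d) (by positivity) hc
  refine ⟨η, hη, fun m l X A hm hl hcl hX hpc hA hPA => ?_⟩
  have hm0 : 0 < m := by linarith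
  obtain ⟨J, hJ1, hJ2⟩ := exists_latticeBox_card hm
  have hcard : (m / 5) ^ d ≤ (2 * J + 1 : ℝ) ^ d := by gcongr
  -- Otherwise, by stationarity, each of the disjoint unit cubes would contain more than `ε l`
  -- points in the mean on the event `X ∈ A`, and their sum would exceed the bound for the large
  -- cube.
  by_contra! hcon
  have key (j) (hj : j ∈ latticeBox d J) : ENNReal.ofReal (ε * l) <
      ∫⁻ ω in X ⁻¹' A, X ω (box (1 / 2) (site 2 0 j)) ∂P := by
    refine (hcon (site 2 0 j) fun i => ?_).trans_eq ?_
    · have := abs_two_mul_le hJ1 hj i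
      simp only [site_apply, PiLp.zero_apply, zero_add, sub_zero]
      linarith
    · have hφ : Measurable fun ν : Measure (E d) =>
          A.indicator (fun ν => ν (box (1 / 2) (site 2 0 j))) ν :=
        (Measure.measurable_coe (measurableSet_box _ _)).indicator hA
      have h1 := hX.lintegral_shift hpc hL hφ (-site 2 0 j)
      rw [← lintegral_indicator (hX.measurable hA)]
      have hAm : MeasurableSet {ω | shift (-site 2 0 j) (X ω) ∈ A} :=
        ((measurable_shift (-site 2 0 j)).comp hX.measurable) hA
      rw [← lintegral_indicator hAm]
      refine Eq.trans ?_ h1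
      refine lintegral_congr fun ω => ?_
      by_cases hω : shift (-site 2 0 j) (X ω) ∈ A
      · rw [indicator_of_mem hω, indicator_of_mem (by exact hω), shift_box, add_neg_cancel]
      · rw [indicator_of_notMem hω, indicator_of_notMem (by exact hω)]
  have hsum : ∑ j ∈ latticeBox d J, ∫⁻ ω in X ⁻¹' A, X ω (box (1 / 2) (site 2 0 j)) ∂P ≤
      ∫⁻ ω in X ⁻¹' A, X ω (box (m / 2) 0) ∂P := by
    rw [← lintegral_finsetSum _ fun j _ =>
      show Measurable fun ω => X ω (box (1 / 2) (site 2 0 j)) from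
        (Measure.measurable_coe (measurableSet_box _ _)).comp hX.measurable]
    refine lintegral_mono fun ω => ?_
    rw [← measure_biUnion_finset (pairwiseDisjoint_unit_box _) fun j _ => measurableSet_box _ _]
    exact measure_mono (iUnion₂_subset fun j hj => unit_box_subset hJ1 hj)
  have hlt : (latticeBox d J).card • ENNReal.ofReal (ε * l) <
      ∑ j ∈ latticeBox d J, ∫⁻ ω in X ⁻¹' A, X ω (box (1 / 2) (site 2 0 j)) ∂P := by
    have hne : (latticeBox d J).Nonempty := ⟨0, mem_latticeBox.2 fun i => by simp⟩
    rw [← Finset.sum_const]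
    exact ENNReal.sum_lt_sum_of_nonempty hne key
  have hle := hlt.trans_le (hsum.trans (h m l X _ hm hl hcl hX hPA))
  rw [card_latticeBox, nsmul_eq_mul, ← ENNReal.ofReal_natCast,
    ← ENNReal.ofReal_mul (by positivity)] at hle
  have hlt' := (ENNReal.ofReal_lt_ofReal_iff_of_nonneg (by positivity)).1 hle
  have : ε / 5 ^ d * (l * m ^ d) = (m / 5) ^ d * (ε * l) := by rw [div_pow]; field_simp
  rw [this] at hlt'
  push_cast at hlt'
  have : (m / 5) ^ d * (ε * l) ≤ (2 * J + 1 : ℝ) ^ d * (ε * l) := by gcongr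
  linarith

end

/-! ### The bad event and its probability -/

/-- The configuration seen from `z` in the window of half side length `ρ`. -/
noncomputable def view (ρ : ℝ) (z : E d) (ν : Measure (E d)) : Measure (E d) :=
  (shift z ν).restrict (box ρ 0)

/-- The configuration seen from the site `u` in the window of half side length `6 g` lies
outside `G`. -/
def siteBad (G : Set (Measure (E d))) (g : ℝ) (u : Fin d → ℤ) : Set (Measure (E d)) :=
  view (6 * g) (site g 0 u) ⁻¹' Gᶜ

lemma measurable_view (ρ : ℝ) (z : E d) : Measurable (view ρ z : Measure (E d) → Measure (E d)) :=
  (measurable_restrict (measurableSet_box _ _)).comp (measurable_shift z)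

@[simp] lemma view_zero (ρ : ℝ) (z : E d) : view ρ z 0 = 0 := by
  rw [view, shift, Measure.map_zero, Measure.restrict_zero]

lemma view_restrict {ρ ρ' : ℝ} (h : ρ ≤ ρ') (z : E d) (ν : Measure (E d)) :
    view ρ z (ν.restrict (box ρ' z)) = view ρ z ν := by
  ext s hs
  rw [view, view, Measure.restrict_apply hs, Measure.restrict_apply hs, shift_apply, shift_apply,
    Measure.restrict_apply ((hs.inter (measurableSet_box _ _)).preimage (by fun_prop))]
  congr 1
  refine inter_eq_left.2 ?_
  rw [preimage_inter, box_shift]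
  exact inter_subset_right.trans (box_subset h z)

/-- At some scale beyond the `n₀`-th one, some site near the origin is the root of a tree with bad
leaves. -/
def badEvent (G : Set (Measure (E d))) (g : ℝ) (n₀ : ℕ) : Set (Measure (E d)) :=
  ⋃ k, ⋃ j ∈ offsets d, ⋃ F ∈ trees (n₀ + k) ((1000 ^ (n₀ + k) : ℤ) • j),
    ⋂ u ∈ F, siteBad G g u

section Deterministic

variable {G : Set (Measure (E d))} {g r : ℝ} {n₀ : ℕ}

lemma measurableSet_siteBad (hG : MeasurableSet G) (u : Fin d → ℤ) :
    MeasurableSet (siteBad G g u) :=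
  measurable_view _ _ hG.compl

lemma measurableSet_badEvent (hG : MeasurableSet G) : MeasurableSet (badEvent G g n₀) :=
  MeasurableSet.iUnion fun _ => Finset.measurableSet_biUnion _ fun _ _ =>
    Finset.measurableSet_biUnion _ fun _ _ => Finset.measurableSet_biInter _ fun u _ =>
      measurableSet_siteBad hG u

lemma uniq_of_notMem_badEvent (hd : 2 ≤ d) (hg : 0 < g) (hr : r ≤ g / 5)
    (hG : ∀ ν, IsPointConfiguration ν → ν.restrict (box (6 * g) 0) ∈ G → Uniq r (atoms ν) g 0)
    {ν : Measure (E d)} (hν : IsPointConfiguration ν) (hb : ν ∉ badEvent G g n₀) {n : ℕ}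
    (hn : n₀ ≤ n) {j : Fin d → ℤ} (hj : ∀ i, |j i| ≤ 7000) :
    Uniq r (atoms ν) (g * 1000 ^ n) (site (g * 1000 ^ n) 0 j) := by
  obtain ⟨k, rfl⟩ := Nat.exists_eq_add_of_le hn
  by_contra hcon
  have hs := site_site g (0 : E d) (n₀ + k) 0 j
  have h0 : site g (0 : E d) 0 = 0 := by ext i; simp
  rw [h0, zero_add] at hs
  rw [hs] at hcon
  obtain ⟨F, hF, hFu⟩ := exists_tree_of_not_uniq hd hg hr hcon
  refine hb ?_
  simp only [badEvent, mem_iUnion, mem_iInter]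
  refine ⟨k, j, mem_offsets.2 hj, F, hF, fun u hu hgood => hFu u hu ?_⟩
  exact uniq_shift.1 (hG _ (hν.shift _) hgood)

end Deterministic

section

variable {Ω : Type*} [MeasurableSpace Ω] {P : Measure Ω}
  {Lam : Ω → Measure (E d)} {l : ℝ} {X : Ω → Measure (E d)} {R : E d → Ω → ℝ≥0∞}

/-- Points in the unit cube are counted without regard to `S` when the recentred configuration is in
`A`. Since only this measurable error term is split off the integral, `S` and `T` need not be
measurable. -/
lemma palmExpectation_le_add (hX : IsCox P Lam l X) (hl : 0 < l)
    (hc : ∀ ω, IsPointConfiguration (X ω))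
    {A S T : Set (Measure (E d))} (hA : MeasurableSet A) {t : E d} {ε : ℝ}
    (hAt : ∫⁻ ω in {ω | shift (-t) (X ω) ∈ A}, X ω (box (1 / 2) 0) ∂P ≤ ENNReal.ofReal (ε * l))
    (h : ∀ ω, ∀ x ∈ atoms (X ω), x ∈ box (1 / 2) 0 → shift (-t) (X ω) ∉ A →
      shift x (X ω) ∈ S → shift x (X ω) ∈ T) :
    palmExpectation P l X (S.indicator 1) ≤ palmExpectation P l X (T.indicator 1) +
      ENNReal.ofReal ε := by
  have hAm : MeasurableSet {ω | shift (-t) (X ω) ∈ A} :=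
    ((measurable_shift (-t)).comp hX.measurable) hA
  have hbox : cube 1 (0 : E d) = box (1 / 2) 0 := rfl
  have hQ : Measurable fun ω => X ω (box (1 / 2) 0) :=
    (Measure.measurable_coe (measurableSet_box _ _)).comp hX.measurable
  have hl0 : ENNReal.ofReal l ≠ 0 := (ENNReal.ofReal_pos.2 hl).ne'
  have key : ∫⁻ ω, ∫⁻ x in cube 1 (0 : E d), S.indicator 1 (shift x (X ω)) ∂(X ω) ∂P ≤
      ∫⁻ ω, ∫⁻ x in cube 1 (0 : E d), T.indicator 1 (shift x (X ω)) ∂(X ω) ∂P +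
        ENNReal.ofReal (ε * l) := by
    refine le_trans ?_ (add_le_add_right hAt _)
    rw [← lintegral_indicator hAm, ← lintegral_add_right _ (hQ.indicator hAm)]
    refine lintegral_mono fun ω => ?_
    by_cases hω : shift (-t) (X ω) ∈ A
    · rw [indicator_of_mem (by exact hω)]
      refine le_trans ?_ le_add_self
      rw [← setLIntegral_one, hbox]
      exact lintegral_mono fun x => indicator_le_self _ _ _
    · refine le_trans ?_ le_self_add
      refine lintegral_mono_ae ?_
      have hat : ∀ᵐ x ∂(X ω), x ∈ atoms (X ω) := by
        by_contra hcon
        obtain ⟨x, hx, hx'⟩ := (hc ω).exists_atom (B := (atoms (X ω))ᶜ) hcon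
        exact hx' hx
      filter_upwards [ae_restrict_of_ae hat, ae_restrict_mem (measurableSet_box (1 / 2) (0 : E d))]
        with x hx hx'
      by_cases hS : shift x (X ω) ∈ S
      · rw [indicator_of_mem hS, indicator_of_mem (h ω x hx hx' hω hS)]
      · rw [indicator_of_notMem hS]; exact zero_le
  unfold palmExpectation
  refine (mul_le_mul_right key _).trans ?_
  rw [mul_add]
  gcongr
  rw [mul_comm ε, ENNReal.ofReal_mul hl.le, ← mul_assoc,
    ENNReal.inv_mul_cancel hl0 ENNReal.ofReal_ne_top, one_mul]

variable [IsProbabilityMeasure P]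

lemma IsCox.measure_shift (h : IsCox P Lam l X) (hc : ∀ ω, IsPointConfiguration (X ω))
    (hL : IsEnvironment P Lam) {A : Set (Measure (E d))} (hA : MeasurableSet A) (t : E d) :
    P {ω | shift t (X ω) ∈ A} = P {ω | X ω ∈ A} := by
  have h1 := Measure.map_apply (μ := P) h.measurable hA
  have h2 := Measure.map_apply (μ := P) ((measurable_shift t).comp h.measurable) hA
  exact h2.symm.trans ((congrArg (fun μ => μ A) (h.map_shift hc hL t)).trans h1)

lemma site_injective {g : ℝ} (hg : 0 < g) (b : E d) : Function.Injective (site g b) := by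
  intro u v huv
  funext i
  have := congrArg (fun y : E d => y i) huv
  simp only [site_apply, add_right_inj] at this
  exact_mod_cast mul_left_cancel₀ hg.ne' this

lemma le_abs_site_sub {g : ℝ} (hg : 0 < g) (b : E d) {u v : Fin d → ℤ} {i : Fin d} {k : ℤ}
    (h : k ≤ |u i - v i|) : k * g ≤ |site g b u i - site g b v i| := by
  have h' : (k : ℝ) ≤ |(u i : ℝ) - v i| := by exact_mod_cast h
  simp only [site_apply, add_sub_add_left_eq_sub, ← mul_sub, abs_mul, abs_of_pos hg]
  rw [mul_comm]
  exact mul_le_mul_of_nonneg_left h' hg.le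

lemma disjoint_cube {n : ℝ} {x y : E d} {i : Fin d} (h : n < |x i - y i|) :
    Disjoint (cube n x) (cube n y) := by
  refine Set.disjoint_left.2 fun w hw hw' => h.not_ge ?_
  have h1 := abs_le.1 (hw i)
  have h2 := abs_le.1 (hw' i)
  rw [abs_le]
  constructor <;> linarith

/-- The constants fit together: `n ≥ 12 g` makes the cube of side `n` contain the window of half
side `6 g`, and `n ≤ 20 g` makes the separation `64 g` exceed `3 n`. -/
lemma IsCox.measure_siteBad_inter_le (h : IsCox P Lam l X) (hc : ∀ ω, IsPointConfiguration (X ω))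
    (hL : IsEnvironment P Lam) (hR : IsStabilizing P Lam R) {G : Set (Measure (E d))}
    (hG : MeasurableSet G) (hG0 : 0 ∉ G) {g : ℝ} (hg : 0 < g) {n : ℕ} (hn1 : 12 * g ≤ n)
    (hn2 : (n : ℝ) ≤ 20 * g) {p₁ p₂ : ℝ≥0∞}
    (hp₁ : P {ω | (X ω).restrict (box (6 * g) 0) ∉ G} ≤ p₁)
    (hp₂ : ∀ z, P (smallRadii R n z n)ᶜ ≤ p₂) {F : Finset (Fin d → ℤ)}
    (hF : ∀ u ∈ F, ∀ v ∈ F, u ≠ v → ∃ i, 64 ≤ |u i - v i|) :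
    P (X ⁻¹' ⋂ u ∈ F, siteBad G g u) ≤ (p₁ + p₂) ^ F.card := by
  classical
  have hn : 1 ≤ n := by
    have : (0 : ℝ) < n := by linarith
    exact_mod_cast this
  have hinj := site_injective hg (0 : E d)
  have hsep : ∀ x ∈ F.image (site g (0 : E d)), ∀ y ∈ F.image (site g (0 : E d)), x ≠ y →
      ∃ i, 3 * (n : ℝ) < |x i - y i| := by
    intro x hx y hy hxy
    obtain ⟨u, hu, rfl⟩ := Finset.mem_image.1 hx
    obtain ⟨v, hv, rfl⟩ := Finset.mem_image.1 hy
    obtain ⟨i, hi⟩ := hF u hu v hv fun h => hxy (by rw [h])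
    have := le_abs_site_sub hg (0 : E d) hi
    refine ⟨i, lt_of_lt_of_le ?_ this⟩
    push_cast
    linarith
  have hview (z : E d) (ν : Measure (E d)) :
      view (6 * g) z (ν.restrict (cube n z)) = view (6 * g) z ν :=
    view_restrict (by linarith) z ν
  have hprob (z : E d) : P {ω | (X ω).restrict (cube n z) ∉ view (6 * g) z ⁻¹' G} ≤ p₁ := by
    have h1 := h.measure_shift hc hL (A := (fun ν => ν.restrict (box (6 * g) 0)) ⁻¹' Gᶜ)
      ((measurable_restrict (measurableSet_box _ _)) hG.compl) z
    refine le_trans (le_of_eq ?_) hp₁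
    simp only [mem_preimage, mem_compl_iff] at h1
    simp only [mem_preimage, hview]
    simp only [view]
    exact h1
  have key := h.measure_biInter_le hc hL hR hn (φ := F.image (site g (0 : E d)))
    (fun x hx y hy hxy => (hsep x hx y hy hxy).elim fun i hi => hi.trans_le (abs_sub_le_dist x y i))
    (fun x hx y hy hxy => (hsep x hx y hy hxy).elim fun i hi => disjoint_cube (i := i)
      (by have : (0 : ℝ) ≤ n := n.cast_nonneg
          linarith))
    (C₀ := fun z => view (6 * g) z ⁻¹' G) (fun z => measurable_view _ z hG)
    (fun z h0 => hG0 (by rwa [mem_preimage, view_zero] at h0))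
    (p := p₁ + p₂) (fun z _ => add_le_add (hprob z) (hp₂ z))
  rw [Finset.card_image_of_injective _ hinj] at key
  refine (measure_mono fun ω hω => ?_).trans key
  rw [mem_iInter₂]
  intro z hz
  obtain ⟨u, hu, rfl⟩ := Finset.mem_image.1 hz
  have hω' := (mem_iInter₂.1 hω) u hu
  rw [siteBad, mem_preimage, mem_compl_iff] at hω'
  simp only [Set.mem_ofPred_eq, mem_preimage, hview]
  exact hω'

/-- Put `N = 14001^d` and `x = N² (p₁ + p₂) ≤ 1/2`. The union bound over trees of height `k` gives
`x^(2^k) ≤ x 2^(-k)` for each root; there are `N` roots, and the geometric series over the scales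
contributes the factor `2`. -/
theorem IsCox.measure_badEvent_le (h : IsCox P Lam l X) (hc : ∀ ω, IsPointConfiguration (X ω))
    (hL : IsEnvironment P Lam) (hR : IsStabilizing P Lam R) {G : Set (Measure (E d))}
    (hG : MeasurableSet G) (hG0 : 0 ∉ G) {g : ℝ} (hg : 0 < g) {n : ℕ} (hn1 : 12 * g ≤ n)
    (hn2 : (n : ℝ) ≤ 20 * g) {p₁ p₂ : ℝ≥0∞}
    (hp₁ : P {ω | (X ω).restrict (box (6 * g) 0) ∉ G} ≤ p₁)
    (hp₂ : ∀ z, P (smallRadii R n z n)ᶜ ≤ p₂)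
    (hp : (14001 ^ d) ^ 2 * (p₁ + p₂) ≤ 1 / 2) (n₀ : ℕ) :
    P (X ⁻¹' badEvent G g n₀) ≤
      14001 ^ d * (2 * ((14001 ^ d) ^ 2 * (p₁ + p₂)) * (1 / 2) ^ n₀) := by
  set N : ℝ≥0∞ := 14001 ^ d with hN
  set x := N ^ 2 * (p₁ + p₂) with hx
  have hN1 : 1 ≤ N ^ 2 := one_le_pow₀ (one_le_pow₀ (by norm_num))
  have htree (k : ℕ) (y : Fin d → ℤ) :
      P (X ⁻¹' ⋃ F ∈ trees k y, ⋂ u ∈ F, siteBad G g u) ≤ x ^ 2 ^ k := by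
    rw [preimage_iUnion₂]
    refine (measure_biUnion_finset_le _ _).trans ?_
    calc ∑ F ∈ trees k y, P (X ⁻¹' ⋂ u ∈ F, siteBad G g u)
        ≤ ∑ F ∈ trees k y, (p₁ + p₂) ^ 2 ^ k := Finset.sum_le_sum fun F hF => by
          rw [← card_of_mem_trees hF]
          exact h.measure_siteBad_inter_le hc hL hR hG hG0 hg hn1 hn2 hp₁ hp₂
            fun u hu v hv huv => separated_of_mem_trees hF hu hv huv
      _ = (trees k y).card * (p₁ + p₂) ^ 2 ^ k := by rw [Finset.sum_const, nsmul_eq_mul]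
      _ ≤ (N ^ 2) ^ 2 ^ k * (p₁ + p₂) ^ 2 ^ k := by
          gcongr
          have := card_trees_le k y
          calc ((trees k y).card : ℝ≥0∞) ≤ N ^ 2 * (trees k y).card :=
                le_mul_of_one_le_left' hN1
            _ ≤ _ := by rw [hN]; exact_mod_cast this
      _ = x ^ 2 ^ k := (mul_pow _ _ _).symm
  have hpow (k : ℕ) : x ^ 2 ^ k ≤ x * (1 / 2) ^ k := by
    have h2 : 2 ^ k = (2 ^ k - 1) + 1 := (Nat.sub_add_cancel Nat.one_le_two_pow).symm
    rw [h2, pow_succ, mul_comm]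
    refine mul_le_mul_right ((pow_le_pow_left' hp _).trans ?_) _
    exact pow_le_pow_right_of_le_one' (by simp) (by have := Nat.lt_two_pow_self (n := k); omega)
  have hscale (k : ℕ) : P (X ⁻¹' ⋃ j ∈ offsets d, ⋃ F ∈ trees k ((1000 ^ k : ℤ) • j),
      ⋂ u ∈ F, siteBad G g u) ≤ N * (x * (1 / 2) ^ k) := by
    rw [preimage_iUnion₂]
    refine (measure_biUnion_finset_le _ _).trans ?_
    refine (Finset.sum_le_sum fun j _ => (htree k _).trans (hpow k)).trans ?_
    rw [Finset.sum_const, card_offsets, nsmul_eq_mul, hN]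
    push_cast
    rfl
  rw [badEvent, preimage_iUnion]
  refine (measure_iUnion_le _).trans ((ENNReal.tsum_le_tsum fun k => hscale (n₀ + k)).trans ?_)
  simp only [pow_add, ENNReal.tsum_mul_left]
  have : ∑' k : ℕ, (1 / 2 : ℝ≥0∞) ^ k = 2 := by
    rw [ENNReal.tsum_geometric, one_div, ENNReal.one_sub_inv_two, inv_inv]
  rw [this]
  refine le_of_eq ?_
  ring

end

/-! ### Stabilization radii in general cubes, and large clusters that are infinite -/

section

variable {Ω : Type*} [MeasurableSpace Ω] {P : Measure Ω}
  {Lam : Ω → Measure (E d)} {l : ℝ} {X : Ω → Measure (E d)} {R : E d → Ω → ℝ≥0∞}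

/-- Only rational translations preserve the set of rational points over which the supremum is taken,
so stationarity of the radii is used only for rational `t`. -/
lemma radiusSup_eq_shift {Ω : Type*} {R : E d → Ω → ℝ≥0∞} (b : ℝ) {t : E d}
    (ht : t ∈ ratPoints d) (ω : Ω) :
    radiusSup R b t ω = ⨆ y ∈ cube b 0 ∩ ratPoints d, R (y + t) ω := by
  refine le_antisymm (iSup₂_le fun y hy => ?_) (iSup₂_le fun y hy => ?_)
  · refine le_trans (le_of_eq ?_) (le_iSup₂ (y - t) ⟨fun i => ?_, fun i => ?_⟩)
    · rw [sub_add_cancel]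
    · simpa using hy.1 i
    · obtain ⟨q, hq⟩ := hy.2 i
      obtain ⟨q', hq'⟩ := ht i
      exact ⟨q - q', by rw [PiLp.sub_apply, hq, hq']; push_cast; rfl⟩
  · refine le_iSup₂ (f := fun y _ => R y ω) (y + t) ⟨fun i => ?_, fun i => ?_⟩
    · simpa using hy.1 i
    · obtain ⟨q, hq⟩ := hy.2 i
      obtain ⟨q', hq'⟩ := ht i
      exact ⟨q + q', by rw [PiLp.add_apply, hq, hq']; push_cast; rfl⟩

lemma measure_smallRadii_compl_eq (hR : IsStabilizing P Lam R) (b c : ℝ) {t : E d}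
    (ht : t ∈ ratPoints d) : P (smallRadii R b t c)ᶜ = P (smallRadii R b 0 c)ᶜ := by
  set Φ : Measure (E d) × (E d → ℝ≥0∞) → ℝ≥0∞ :=
    fun p => ⨆ y ∈ cube b 0 ∩ ratPoints d, p.2 y with hΦ
  have hΦm : Measurable Φ := Measurable.biSup _ ((countable_ratPoints d).mono inter_subset_right)
    fun y _ => (measurable_pi_apply y).comp measurable_snd
  have h := ((hR.jointly_stationary t).comp hΦm).measure_mem_eq
    (measurableSet_Ici (a := ENNReal.ofReal c))
  have e1 : (smallRadii R b t c)ᶜ =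
      {ω | ENNReal.ofReal c ≤ ⨆ y ∈ cube b 0 ∩ ratPoints d, R (y + t) ω} := by
    ext ω
    rw [smallRadii, mem_compl_iff, Set.mem_ofPred_eq, Set.mem_ofPred_eq, not_lt,
      radiusSup_eq_shift b ht]
  have e2 : (smallRadii R b 0 c)ᶜ = {ω | ENNReal.ofReal c ≤ radiusSup R b 0 ω} := by
    ext ω
    rw [smallRadii, mem_compl_iff, Set.mem_ofPred_eq, Set.mem_ofPred_eq, not_lt]
  rw [e1, e2]
  exact h

/-- One cube of side `b` per orthant around `z` covers the cube of side `n ≤ 7 b / 5`. Each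
coordinate of its centre may be offset by any amount between `b / 5` and `b / 2`, which leaves room
for rational centres. -/
lemma measure_smallRadii_compl_le (hR : IsStabilizing P Lam R) {n b c : ℝ} (hb : 0 < b)
    (hn : n ≤ 7 / 5 * b) (hc : c ≤ n) (z : E d) :
    P (smallRadii R n z n)ᶜ ≤ 2 ^ d * P (smallRadii R b 0 c)ᶜ := by
  have h1 (i : Fin d) : ∃ q : ℚ, z i + b / 5 < q ∧ (q : ℝ) < z i + b / 2 :=
    exists_rat_btwn (by linarith)
  have h2 (i : Fin d) : ∃ q : ℚ, z i - b / 2 < q ∧ (q : ℝ) < z i - b / 5 :=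
    exists_rat_btwn (by linarith)
  choose q hq1 hq2 using h1
  choose q' hq1' hq2' using h2
  set t : (Fin d → Bool) → E d := fun σ =>
    WithLp.toLp 2 fun i => bif σ i then (q i : ℝ) else (q' i : ℝ) with ht
  have hti (σ : Fin d → Bool) (i : Fin d) : t σ i = bif σ i then (q i : ℝ) else (q' i : ℝ) := rfl
  have htr (σ) : t σ ∈ ratPoints d := by
    intro i
    rw [hti]
    cases σ i
    · exact ⟨q' i, rfl⟩
    · exact ⟨q i, rfl⟩
  have hcov : cube n z ⊆ ⋃ σ, cube b (t σ) := by
    intro y hy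
    refine mem_iUnion.2 ⟨fun i => decide (z i ≤ y i), fun i => ?_⟩
    have hyi := abs_le.1 (hy i)
    have := hq1 i
    have := hq2 i
    have := hq1' i
    have := hq2' i
    rw [hti, abs_le]
    by_cases hzy : z i ≤ y i
    · rw [decide_eq_true hzy]
      simp only [cond_true]
      constructor <;> linarith
    · rw [decide_eq_false hzy]
      simp only [cond_false]
      constructor <;> linarith
  have hsub : (smallRadii R n z n)ᶜ ⊆ ⋃ σ, (smallRadii R b (t σ) c)ᶜ := by
    intro ω hω
    obtain ⟨σ, hσ⟩ := exists_eq_ciSup_of_finite (f := fun σ => radiusSup R b (t σ) ω)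
    refine mem_iUnion.2 ⟨σ, ?_⟩
    rw [smallRadii, mem_compl_iff, Set.mem_ofPred_eq, not_lt] at hω ⊢
    rw [hσ]
    refine (ENNReal.ofReal_le_ofReal hc).trans (hω.trans (iSup₂_le fun y hy => ?_))
    obtain ⟨τ, hτ⟩ := mem_iUnion.1 (hcov hy.1)
    exact (le_iSup₂ (f := fun y (_ : y ∈ cube b (t τ) ∩ ratPoints d) => R y ω) y ⟨hτ, hy.2⟩).trans
      (le_iSup (fun σ => radiusSup R b (t σ) ω) τ)
  refine (measure_mono hsub).trans ((measure_iUnion_le _).trans ?_)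
  rw [tsum_fintype, Finset.sum_congr rfl fun σ _ => measure_smallRadii_compl_eq hR b c (htr σ)]
  simp

lemma shift_shift (s t : E d) (ν : Measure (E d)) : shift s (shift t ν) = shift (t + s) ν := by
  rw [shift, shift, shift, Measure.map_map (by fun_prop) (by fun_prop)]
  congr 1
  funext y
  simp only [Function.comp_apply]
  abel

variable [IsProbabilityMeasure P]

/-- If unique crossings are likely on the scale `m`, then a cluster that is large compared with `m`
is likely to be infinite. -/
theorem exists_connectedToBoundary_le (hd : 2 ≤ d) (hL : IsEnvironment P Lam)
    (hR : IsStabilizing P Lam R) {ε c : ℝ} (hε : 0 < ε) (hc : 0 < c) :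
    ∃ n₀ : ℕ, ∀ (m r l a : ℝ) (X : Ω → Measure (E d)) (G : Set (Measure (E d))) (n : ℕ)
      (p₁ p₂ : ℝ≥0∞), 1 ≤ m → r ≤ m / 10 → 0 < l → c ≤ l * m ^ d →
      IsCox P Lam l X → (∀ ω, IsPointConfiguration (X ω)) → MeasurableSet G → 0 ∉ G →
      (∀ ν, IsPointConfiguration ν → ν.restrict (box (6 * (m / 2)) 0) ∈ G →
        Uniq r (atoms ν) (m / 2) 0) →
      6 * m ≤ n → (n : ℝ) ≤ 10 * m →
      P {ω | (X ω).restrict (box (6 * (m / 2)) 0) ∉ G} ≤ p₁ →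
      (∀ z, P (smallRadii R n z n)ᶜ ≤ p₂) → (14001 ^ d) ^ 2 * (p₁ + p₂) ≤ 1 / 2 →
      8 * m * 1000 ^ n₀ ≤ a →
      palmExpectation P l X ({ν | ConnectedToBoundary a r ν}.indicator 1) ≤
        palmExpectation P l X ({ν | ConnectedToInfinity r ν}.indicator 1) + ENNReal.ofReal ε := by
  obtain ⟨η, hη, hA⟩ := exists_lintegral_count_shift_le hL hε hc
  -- The bound of `IsCox.measure_badEvent_le` with its largest admissible value `1/2` inserted, so
  -- that `n₀` depends neither on the scale nor on the intensity.
  have htend : Tendsto (fun n₀ : ℕ => (14001 ^ d : ℝ≥0∞) * (2 * (1 / 2) * (1 / 2) ^ n₀)) atTop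
      (𝓝 ((14001 ^ d : ℝ≥0∞) * (2 * (1 / 2) * 0))) := by
    refine ENNReal.Tendsto.const_mul (ENNReal.Tendsto.const_mul
      (ENNReal.tendsto_pow_atTop_nhds_zero_of_lt_one (by simp)) (Or.inr ?_)) (Or.inr ?_)
    · exact ENNReal.mul_ne_top (by simp) (by simp)
    · exact ENNReal.pow_ne_top (by simp)
  rw [mul_zero, mul_zero] at htend
  obtain ⟨n₀, hn₀⟩ := ((tendsto_order.1 htend).2 _ (ENNReal.ofReal_pos.2 hη)).exists
  refine ⟨n₀, fun m r l a X G n p₁ p₂ hm hr hl hcl hX hpc hG hG0 hGu hn1 hn2 hp₁ hp₂ hp ha => ?_⟩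
  have hm0 : 0 < m := by linarith
  have hbad := hX.measure_badEvent_le hpc hL hR hG hG0 (g := m / 2) (by positivity)
    (n := n) (by linarith) (by linarith) hp₁ hp₂ hp n₀
  obtain ⟨t, ht, htA⟩ := hA m l X (badEvent G (m / 2) n₀) hm hl.le hcl hX hpc
    (measurableSet_badEvent hG) (hbad.trans (le_trans (by gcongr) hn₀.le))
  refine palmExpectation_le_add hX hl hpc (measurableSet_badEvent hG) htA
    fun ω x hx hxb hbad hS => ?_
  have hxx : shift x (X ω) = shift (x + t) (shift (-t) (X ω)) := by
    rw [shift_shift]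
    congr 1
    abel
  rw [Set.mem_ofPred_eq, hxx] at hS ⊢
  rw [connectedToBoundary_shift] at hS
  rw [connectedToInfinity_shift]
  obtain ⟨hxa, y, hxy, hy⟩ := hS
  refine ⟨hxa, ?_⟩
  have hT : (1 : ℝ) ≤ 1000 ^ n₀ := one_le_pow₀ (by norm_num)
  have hmT : m ≤ m * 1000 ^ n₀ := le_mul_of_one_le_right hm0.le hT
  have hxt (i) : |(x + t) i| ≤ m := by
    have h1 := abs_le.1 (hxb i)
    have h2 := abs_le.1 (ht i)
    simp only [PiLp.zero_apply, sub_zero] at h1 h2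
    rw [PiLp.add_apply, abs_le]
    constructor <;> linarith
  -- The cluster of `x + t` has a point at sup distance more than `a / 2 - r ≥ 3.9 m 1000^n₀` from
  -- `x + t`, which is itself within `m` of the centre. So it leaves the cube of half side `5 (m /
  -- 2) 1000^n₀`.
  refine infinite_of_exits (g := m / 2) (b := 0) hd (by positivity) (n₀ := n₀) (fun n hn j hj =>
    uniq_of_notMem_badEvent hd (by positivity) (by linarith) hGu ((hpc ω).shift _) hbad hn hj)
    hxa (fun i => ?_) ⟨y, hxy, fun hyo => hy fun i => ?_⟩
  · rw [PiLp.zero_apply, sub_zero]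
    have := hxt i
    linarith
  · have h1 := abs_lt.1 (hyo i)
    have h2 := abs_le.1 (hxt i)
    rw [PiLp.zero_apply, sub_zero] at h1
    rw [abs_le]
    constructor <;> linarith

/-- If, on the scale `m`, unique crossings by all points near the centre are very likely, then
almost all clusters are infinite. -/
theorem exists_mem_atoms_le (hd : 2 ≤ d) (hL : IsEnvironment P Lam)
    (hR : IsStabilizing P Lam R) {ε c : ℝ} (hε : 0 < ε) (hc : 0 < c) :
    ∃ η : ℝ, 0 < η ∧ ∀ (m r l : ℝ) (X : Ω → Measure (E d)) (G : Set (Measure (E d))) (n : ℕ)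
      (p₁ p₂ : ℝ≥0∞), 1 ≤ m → r ≤ m / 10 → 0 < l → c ≤ l * m ^ d →
      IsCox P Lam l X → (∀ ω, IsPointConfiguration (X ω)) → MeasurableSet G → 0 ∉ G →
      (∀ ν, IsPointConfiguration ν → ν.restrict (box (6 * (m / 2)) 0) ∈ G →
        Uniq r (atoms ν) (m / 2) 0) →
      (∀ ν, IsPointConfiguration ν → ν.restrict (box (6 * (m / 2)) 0) ∈ G →
        ∀ x ∈ atoms ν, x ∈ box (3 * (m / 2)) 0 → Exits r (atoms ν) (m / 2) 0 x) →
      6 * m ≤ n → (n : ℝ) ≤ 10 * m →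
      P {ω | (X ω).restrict (box (6 * (m / 2)) 0) ∉ G} ≤ p₁ →
      (∀ z, P (smallRadii R n z n)ᶜ ≤ p₂) → p₁ + p₂ ≤ ENNReal.ofReal η →
      palmExpectation P l X ({ν | 0 ∈ atoms ν}.indicator 1) ≤
        palmExpectation P l X ({ν | ConnectedToInfinity r ν}.indicator 1) + ENNReal.ofReal ε := by
  obtain ⟨η, hη, hA⟩ := exists_lintegral_count_shift_le hL hε hc
  set N : ℝ := 14001 ^ d with hN
  have hNpos : 0 < N := by positivity
  have hNE : (14001 ^ d : ℝ≥0∞) = ENNReal.ofReal N := by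
    rw [hN, ENNReal.ofReal_pow (by norm_num)]; norm_num
  refine ⟨min (1 / (2 * N ^ 2)) (η / (2 * N ^ 3)), by positivity,
    fun m r l X G n p₁ p₂ hm hr hl hcl hX hpc hG hG0 hGu hGe hn1 hn2 hp₁ hp₂ hp => ?_⟩
  have hm0 : 0 < m := by linarith
  have hp1 : (14001 ^ d : ℝ≥0∞) ^ 2 * (p₁ + p₂) ≤ 1 / 2 := by
    rw [hNE]
    refine (mul_le_mul_right (hp.trans (ENNReal.ofReal_le_ofReal (min_le_left _ _))) _).trans ?_
    rw [← ENNReal.ofReal_pow hNpos.le, ← ENNReal.ofReal_mul (by positivity)]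
    have : N ^ 2 * (1 / (2 * N ^ 2)) = 1 / 2 := by field_simp
    rw [this, ENNReal.ofReal_div_of_pos (by norm_num)]
    simp
  have hp2 : (14001 ^ d : ℝ≥0∞) * (2 * ((14001 ^ d : ℝ≥0∞) ^ 2 * (p₁ + p₂)) * (1 / 2) ^ 0) ≤
      ENNReal.ofReal η := by
    rw [hNE, pow_zero, mul_one]
    calc _ ≤ ENNReal.ofReal N * (ENNReal.ofReal 2 * ((ENNReal.ofReal N) ^ 2 *
          ENNReal.ofReal (η / (2 * N ^ 3)))) := by
          gcongr
          · simp
          · exact hp.trans (ENNReal.ofReal_le_ofReal (min_le_right _ _))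
      _ = ENNReal.ofReal (N * (2 * (N ^ 2 * (η / (2 * N ^ 3))))) := by
          rw [← ENNReal.ofReal_pow hNpos.le, ← ENNReal.ofReal_mul (by positivity),
            ← ENNReal.ofReal_mul (by positivity), ← ENNReal.ofReal_mul (by positivity)]
      _ = ENNReal.ofReal η := by
          congr 1
          field_simp
  have hbad := hX.measure_badEvent_le hpc hL hR hG hG0 (g := m / 2) (by positivity)
    (n := n) (by linarith) (by linarith) hp₁ hp₂ hp1 0
  obtain ⟨t, ht, htA⟩ := hA m l X (badEvent G (m / 2) 0) hm hl.le hcl hX hpc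
    (measurableSet_badEvent hG) (hbad.trans hp2)
  refine palmExpectation_le_add hX hl hpc (measurableSet_badEvent hG) htA
    fun ω x hx hxb hbad _ => ?_
  have hxx : shift x (X ω) = shift (x + t) (shift (-t) (X ω)) := by
    rw [shift_shift]
    congr 1
    abel
  rw [Set.mem_ofPred_eq, hxx, connectedToInfinity_shift]
  have hxa : x + t ∈ atoms (shift (-t) (X ω)) := by
    rw [mem_atoms_shift, add_neg_cancel_right]
    exact hx
  have hxt : x + t ∈ box (3 * (m / 2)) 0 := by
    intro i
    have h1 := abs_le.1 (hxb i)
    have h2 := abs_le.1 (ht i)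
    simp only [PiLp.zero_apply, sub_zero] at h1 h2 ⊢
    rw [PiLp.add_apply, abs_le]
    constructor <;> linarith
  have hpcs := (hpc ω).shift (-t)
  have huniq : ∀ n, 0 ≤ n → ∀ j : Fin d → ℤ, (∀ i, |j i| ≤ 7000) →
      Uniq r (atoms (shift (-t) (X ω))) (m / 2 * 1000 ^ n) (site (m / 2 * 1000 ^ n) 0 j) :=
    fun n hn j hj =>
      uniq_of_notMem_badEvent hd (by positivity) (by linarith) hGu hpcs hbad hn hj
  -- At the lowest scale the tree rooted at the origin is a single leaf, so outside of the bad event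
  -- the central window itself is good.
  have hgood : (shift (-t) (X ω)).restrict (box (6 * (m / 2)) 0) ∈ G := by
    by_contra hcon
    refine hbad ?_
    simp only [badEvent, mem_iUnion, mem_iInter]
    refine ⟨0, 0, mem_offsets.2 fun i => by simp, {0}, by simp [trees], fun u hu => ?_⟩
    rw [Finset.mem_singleton] at hu
    have h0 : site (m / 2) (0 : E d) 0 = 0 := by ext i; simp
    have hs0 (ν : Measure (E d)) : shift 0 ν = ν := by
      simp only [shift, sub_zero]
      exact Measure.map_id
    rw [siteBad, mem_preimage, mem_compl_iff, hu, h0, view, hs0]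
    exact hcon
  refine ⟨hxa, infinite_of_exits (g := m / 2) (b := 0) hd (by positivity) (n₀ := 0) huniq hxa ?_ ?_⟩
  · rwa [pow_zero, mul_one]
  · rw [pow_zero, mul_one]
    exact hGe _ hpcs hgood _ hxa hxt

end

/-! ### Connection radii that are small compared with the crossing scale -/

section

variable {Ω : Type*} [MeasurableSpace Ω] {P : Measure Ω}
  {Lam : Ω → Measure (E d)} {l : ℝ} {X : Ω → Measure (E d)} {R : E d → Ω → ℝ≥0∞}

lemma IsCox.lintegral_count_le (hX : IsCox P Lam l X) (hL : IsEnvironment P Lam) {m : ℝ}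
    (hm : 1 ≤ m) (hl : 0 ≤ l) :
    ∫⁻ ω, X ω (box (m / 2) 0) ∂P ≤ ENNReal.ofReal (l * (6 * m) ^ d) := by
  have h := hX.setLIntegral_count_le hL.measurable (measurableSet_box (m / 2) (0 : E d))
    (isBounded_box _ _) MeasurableSet.univ
  rw [preimage_univ, Measure.restrict_univ] at h
  rw [ENNReal.ofReal_mul hl]
  exact h.trans (mul_le_mul_right (lintegral_box_le hL hm 0) _)

lemma IsCox.measure_count_ne_zero_le (hX : IsCox P Lam l X) (hc : ∀ ω, IsPointConfiguration (X ω))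
    (hL : IsEnvironment P Lam) {m : ℝ} (hm : 1 ≤ m) (hl : 0 ≤ l) :
    P {ω | X ω (box (m / 2) 0) ≠ 0} ≤ ENNReal.ofReal (l * (6 * m) ^ d) := by
  have hQ : Measurable fun ω => X ω (box (m / 2) 0) :=
    (Measure.measurable_coe (measurableSet_box _ _)).comp hX.measurable
  have h1 := meas_ge_le_lintegral_div (μ := P) hQ.aemeasurable (ε := 1) one_ne_zero
    ENNReal.one_ne_top
  rw [div_one] at h1
  refine (measure_mono fun ω hω => ?_).trans (h1.trans (hX.lintegral_count_le hL hm hl))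
  obtain ⟨k, hk⟩ := hc ω _ (measurableSet_box (m / 2) (0 : E d)) (isBounded_box _ _)
  rw [Set.mem_ofPred_eq] at hω ⊢
  rw [hk] at hω ⊢
  have : k ≠ 0 := by rintro rfl; simp at hω
  exact_mod_cast Nat.one_le_iff_ne_zero.2 this

variable [IsProbabilityMeasure P]

/-- The crossing event is not required to be measurable; only its inclusion in a measurable event is
used. -/
lemma measure_compl_le_of_lt {A B : Set Ω} {q : ℝ} (hB : MeasurableSet B) (hq : 0 ≤ q)
    (hA : q < P.real A) (hAB : A ⊆ B) : P Bᶜ ≤ ENNReal.ofReal (1 - q) := by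
  have h1 : ENNReal.ofReal q ≤ P B := by
    refine le_trans ?_ (measure_mono hAB)
    rw [ENNReal.ofReal_le_iff_le_toReal (measure_ne_top P A)]
    exact hA.le
  rw [prob_compl_eq_one_sub hB, ENNReal.ofReal_sub _ hq, ENNReal.ofReal_one]
  exact tsub_le_tsub_left h1 1

lemma uniq_of_restrict_mem {r g : ℝ} (hg : 0 < g) (hr : r ≤ g) {ν : Measure (E d)}
    (hν : IsPointConfiguration ν)
    (h : ν.restrict (box (6 * g) 0) ∈ uniqEvent r g (box (6 * g) 0)) : Uniq r (atoms ν) g 0 := by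
  have hW := measurableSet_box (6 * g) (0 : E d)
  rw [← uniq_iff_uniqEvent hW (isBounded_box _ _) (hν.restrict hW), atoms_restrict, inter_assoc,
    inter_self] at h
  exact h.of_inter hg hr subset_rfl

lemma zero_notMem_uniqEvent {r g : ℝ} : (0 : Measure (E d)) ∉ uniqEvent r g (box (6 * g) 0) := by
  intro h
  have h0 : IsPointConfiguration (0 : Measure (E d)) := fun B _ _ => ⟨0, by simp⟩
  rw [← uniq_iff_uniqEvent (measurableSet_box _ _) (isBounded_box _ _) h0] at h
  obtain ⟨x, hx, -⟩ := h.exists_exits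
  exact hx.1 (by simp)

lemma CrossingEvent.restrict_mem {r s : ℝ} (hr : 0 < r) (hrs : r ≤ s / 10) {ν : Measure (E d)}
    (hν : IsPointConfiguration ν) (h : CrossingEvent r s ν) :
    ν.restrict (box (6 * (s / 2)) 0) ∈ uniqEvent r (s / 2) (box (6 * (s / 2)) 0) := by
  have hW := measurableSet_box (6 * (s / 2)) (0 : E d)
  rw [← uniq_iff_uniqEvent hW (isBounded_box _ _) (hν.restrict hW), atoms_restrict, inter_assoc,
    inter_self]
  exact h.uniq hr hrs (hν.finite_atoms (isBounded_box _ _))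

/-- The case of connection radii that are small compared with the crossing scale. -/
theorem exists_connectedToBoundary_le_of_crossing (hd : 2 ≤ d) (hL : IsEnvironment P Lam)
    (hR : IsStabilizing P Lam R) {q : ℝ} (hq0 : 0 < q)
    (hq : (14001 ^ d : ℝ≥0∞) ^ 2 *
      (ENNReal.ofReal (1 - q) + 2 ^ d * ENNReal.ofReal (1 - q)) ≤ 1 / 2)
    {ε : ℝ} (hε : 0 < ε) :
    ∃ n₀ : ℕ, ∀ (s r l a : ℝ) (X : Ω → Measure (E d)), 1 ≤ s → 0 < r → r ≤ s / 10 → 0 ≤ l →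
      IsCox P Lam l X → (∀ ω, IsPointConfiguration (X ω)) →
      q < P.real (smallRadii R (5 * s) 0 s) → q < P.real {ω | CrossingEvent r s (X ω)} →
      8 * s * 1000 ^ n₀ ≤ a →
      palmExpectation P l X ({ν | ConnectedToBoundary a r ν}.indicator 1) ≤
        palmExpectation P l X ({ν | ConnectedToInfinity r ν}.indicator 1) + ENNReal.ofReal ε := by
  obtain ⟨n₀, hn₀⟩ := exists_connectedToBoundary_le hd hL hR hε (c := q / 12 ^ d) (by positivity)
  refine ⟨n₀, fun s r l a X hs hr hrs hl hX hpc hrad hcross ha => ?_⟩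
  have hs0 : 0 < s := by linarith
  set W : Set (E d) := box (6 * (s / 2)) 0 with hW
  have hWm : MeasurableSet W := measurableSet_box _ _
  -- Crossings force a point in `Q_{2s}`, so the mean number of points there is at least `q` by
  -- Markov's inequality. This bounds `l s^d` from below.
  have hcl : q / 12 ^ d ≤ l * s ^ d := by
    have h1 : ENNReal.ofReal q ≤ ENNReal.ofReal (l * (6 * (2 * s)) ^ d) := by
      refine le_trans ?_ (hX.measure_count_ne_zero_le hpc hL (m := 2 * s) (by linarith) hl)
      have h2 : ENNReal.ofReal q ≤ P {ω | CrossingEvent r s (X ω)} := by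
        rw [ENNReal.ofReal_le_iff_le_toReal (measure_ne_top P _)]
        exact hcross.le
      refine h2.trans (measure_mono fun ω hω => ?_)
      have hu := uniq_of_restrict_mem (by positivity) (by linarith) (hpc ω)
        (CrossingEvent.restrict_mem hr hrs (hpc ω) hω)
      obtain ⟨x, hx, hxb, -⟩ := hu.exists_exits
      rw [Set.mem_ofPred_eq, (hpc ω).exists_atom_iff]
      exact ⟨x, hx, box_subset (by linarith) _ hxb⟩
    have h3 := (ENNReal.ofReal_le_ofReal_iff (by positivity)).1 h1
    rw [div_le_iff₀ (by positivity)]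
    calc q ≤ _ := h3
      _ = l * s ^ d * 12 ^ d := by rw [mul_assoc l, ← mul_pow]; ring
  have hl0 : 0 < l := by
    have h4 : 0 < l * s ^ d := lt_of_lt_of_le (by positivity) hcl
    exact pos_of_mul_pos_left h4 (by positivity)
  have hGm : MeasurableSet (uniqEvent r (s / 2) W) := measurableSet_uniqEvent hWm
  have hp₁ : P {ω | (X ω).restrict W ∉ uniqEvent r (s / 2) W} ≤ ENNReal.ofReal (1 - q) := by
    refine measure_compl_le_of_lt (B := {ω | (X ω).restrict W ∈ uniqEvent r (s / 2) W})
      (((measurable_restrict hWm).comp hX.measurable) hGm) hq0.le hcross fun ω hω => ?_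
    exact CrossingEvent.restrict_mem hr hrs (hpc ω) hω
  have hp₂ : P (smallRadii R (5 * s) 0 s)ᶜ ≤ ENNReal.ofReal (1 - q) :=
    measure_compl_le_of_lt (measurableSet_smallRadii hR.measurable _ _ _) hq0.le hrad subset_rfl
  -- Since `s ≥ 1`, `⌈6 s⌉ ≤ 7 s`, which is exactly what `measure_smallRadii_compl_le` allows for
  -- cubes of side `5 s`.
  have hn1 : 6 * s ≤ (⌈6 * s⌉₊ : ℝ) := Nat.le_ceil _
  have hn2 : (⌈6 * s⌉₊ : ℝ) < 6 * s + 1 := Nat.ceil_lt_add_one (by positivity)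
  exact hn₀ s r l a X (uniqEvent r (s / 2) W) ⌈6 * s⌉₊ _
      (2 ^ d * ENNReal.ofReal (1 - q)) hs hrs hl0 hcl hX hpc
    hGm zero_notMem_uniqEvent
    (fun ν hν h => uniq_of_restrict_mem (by positivity) (by linarith) hν h) hn1 (by linarith) hp₁
    (fun z => (measure_smallRadii_compl_le hR (by positivity) (by linarith) (by linarith) z).trans
      (mul_le_mul_right hp₂ _)) hq ha

end

/-! ### The Laplace transform of the mass of a large cube -/

section

variable {Ω : Type*} [MeasurableSpace Ω] {P : Measure Ω}
  {Lam : Ω → Measure (E d)} {R : E d → Ω → ℝ≥0∞}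

lemma le_lintegral_box (hL : IsEnvironment P Lam) {m : ℝ} (hm : 1 ≤ m) :
    ENNReal.ofReal ((m / 5) ^ d) ≤ ∫⁻ ω, Lam ω (box (m / 2) 0) ∂P := by
  obtain ⟨J, hJ1, hJ2⟩ := exists_latticeBox_card hm
  have hle (ω) : ∑ j ∈ latticeBox d J, Lam ω (box (1 / 2) (site 2 0 j)) ≤
      Lam ω (box (m / 2) 0) := by
    rw [← measure_biUnion_finset (pairwiseDisjoint_unit_box _) fun j _ => measurableSet_box _ _]
    exact measure_mono (iUnion₂_subset fun j hj => unit_box_subset hJ1 hj)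
  refine le_trans ?_ (lintegral_mono hle)
  rw [lintegral_finsetSum _ fun j _ => show Measurable fun ω => Lam ω (box (1 / 2) (site 2 0 j))
    from (Measure.measurable_coe (measurableSet_box _ _)).comp hL.measurable]
  simp only [lintegral_unit_box hL, Finset.sum_const, card_latticeBox, nsmul_eq_mul, mul_one]
  rw [← ENNReal.ofReal_natCast]
  refine ENNReal.ofReal_le_ofReal ?_
  push_cast
  gcongr

/-- The number of points that stay within a scale, truncated and restricted to small radii. -/
noncomputable def truncMass (Lam : Ω → Measure (E d)) (R : E d → Ω → ℝ≥0∞) (n M : ℕ) (x : E d)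
    (ω : Ω) : ℝ≥0 :=
  (smallRadii R n x n).indicator
    (fun ω => (min ((Lam ω).restrict (cube n x) univ) M).toNNReal) ω

lemma measurable_truncMass (hL : Measurable Lam) (hR : ∀ x, Measurable (R x)) (n M : ℕ) (x : E d) :
    Measurable (truncMass Lam R n M x) := by
  refine Measurable.indicator (Measurable.ennreal_toNNReal ?_) (measurableSet_smallRadii hR _ _ _)
  exact ((Measure.measurable_coe MeasurableSet.univ).comp
    ((measurable_restrict (measurableSet_box _ _)).comp hL)).min measurable_const

lemma coe_truncMass {Ω : Type*} {Lam : Ω → Measure (E d)} {R : E d → Ω → ℝ≥0∞} (n M : ℕ)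
    (x : E d) (ω : Ω) :
    (truncMass Lam R n M x ω : ℝ≥0∞) =
      (smallRadii R n x n).indicator (fun ω => min (Lam ω (cube n x)) M) ω := by
  unfold truncMass
  by_cases hω : ω ∈ smallRadii R n x n
  · rw [indicator_of_mem hω, indicator_of_mem hω, Measure.restrict_apply_univ,
      ENNReal.coe_toNNReal (ne_top_of_le_ne_top (ENNReal.natCast_ne_top M) (min_le_right _ _))]
  · rw [indicator_of_notMem hω, indicator_of_notMem hω, ENNReal.coe_zero]

lemma truncMass_le {Ω : Type*} {Lam : Ω → Measure (E d)} {R : E d → Ω → ℝ≥0∞}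
    (n M : ℕ) (x : E d) (ω : Ω) : truncMass Lam R n M x ω ≤ M := by
  rw [← ENNReal.coe_le_coe, coe_truncMass]
  refine (indicator_le_self _ _ _).trans ((min_le_right _ _).trans ?_)
  simp

lemma coe_truncMass_le {Ω : Type*} {Lam : Ω → Measure (E d)} {R : E d → Ω → ℝ≥0∞}
    (n M : ℕ) (x : E d) (ω : Ω) :
    (truncMass Lam R n M x ω : ℝ≥0∞) ≤ Lam ω (cube n x) := by
  rw [coe_truncMass]
  exact (indicator_le_self _ _ _).trans (min_le_left _ _)

lemma lintegral_truncMass (hR : IsStabilizing P Lam R) (n M : ℕ) {x : E d} (hx : x ∈ ratPoints d) :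
    ∫⁻ ω, truncMass Lam R n M x ω ∂P = ∫⁻ ω, truncMass Lam R n M 0 ω ∂P := by
  classical
  set Φ : Measure (E d) × (E d → ℝ≥0∞) → ℝ≥0∞ := fun p =>
    {p : Measure (E d) × (E d → ℝ≥0∞) | ⨆ y ∈ cube n 0 ∩ ratPoints d, p.2 y <
      ENNReal.ofReal n}.indicator (fun p => min (p.1 (cube n 0)) M) p with hΦ
  have hΦm : Measurable Φ := by
    refine Measurable.indicator (((Measure.measurable_coe (measurableSet_box _ _)).comp
      measurable_fst).min measurable_const) (measurableSet_lt ?_ measurable_const)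
    exact Measurable.biSup _ ((countable_ratPoints d).mono inter_subset_right)
      fun y _ => (measurable_pi_apply y).comp measurable_snd
  have h := ((hR.jointly_stationary x).comp hΦm).lintegral_eq
  have e0 (ω) : (truncMass Lam R n M 0 ω : ℝ≥0∞) = Φ (Lam ω, fun y => R y ω) := by
    rw [coe_truncMass]
    rfl
  have e1 (ω) : (truncMass Lam R n M x ω : ℝ≥0∞) =
      Φ (shift x (Lam ω), fun y => R (y + x) ω) := by
    have hc : cube (n : ℝ) x = box (n / 2) x := rfl
    have hc0 : cube (n : ℝ) (0 : E d) = box (n / 2) 0 := rfl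
    have hS : ω ∈ smallRadii R n x n ↔
        (shift x (Lam ω), fun y => R (y + x) ω) ∈ {p : Measure (E d) × (E d → ℝ≥0∞) |
          ⨆ y ∈ cube n 0 ∩ ratPoints d, p.2 y < ENNReal.ofReal n} := by
      rw [smallRadii, Set.mem_ofPred_eq, Set.mem_ofPred_eq, radiusSup_eq_shift _ hx]
    rw [coe_truncMass]
    simp only [hΦ]
    by_cases hω : ω ∈ smallRadii R n x n
    · rw [indicator_of_mem hω, indicator_of_mem (hS.1 hω), hc, hc0, shift_box, zero_add]
    · rw [indicator_of_notMem hω, indicator_of_notMem (mt hS.2 hω)]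
  simp only [e0, e1]
  exact h

/-- For large `n` the radii are small with probability close to one, and uniform integrability keeps
three quarters of the lower bound on the mean. Truncation at a high level `M` costs at most another
quarter, by monotone convergence. -/
lemma exists_le_lintegral_truncMass [IsProbabilityMeasure P] (hL : IsEnvironment P Lam)
    (hR : IsStabilizing P Lam R) :
    ∃ n M : ℕ, 1 ≤ n ∧ 1 ≤ M ∧
      ENNReal.ofReal ((n / 5) ^ d / 2) ≤ ∫⁻ ω, truncMass Lam R n M 0 ω ∂P := by
  obtain ⟨η, hη, hη'⟩ := exists_setLIntegral_unit_box_le hL (ε := 1 / (4 * 30 ^ d)) (by positivity)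
  have hev : ∀ᶠ n : ℕ in atTop, 1 - η < P.real (smallRadii R n (0 : E d) n) :=
    (tendsto_order.1 hR.tendsto_one).1 _ (by linarith)
  obtain ⟨n, hn, hn1⟩ := (hev.and (eventually_ge_atTop 1)).exists
  have hn1' : (1 : ℝ) ≤ n := by exact_mod_cast hn1
  set S := smallRadii R n (0 : E d) n with hS
  have hSm : MeasurableSet S := measurableSet_smallRadii hR.measurable _ _ _
  have hQm : Measurable fun ω => Lam ω (cube n 0) :=
    (Measure.measurable_coe (measurableSet_box _ _)).comp hL.measurable
  have hSc : P Sᶜ ≤ ENNReal.ofReal η := by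
    have h1 : P.real Sᶜ ≤ η := by rw [probReal_compl_eq_one_sub hSm]; linarith
    rw [← ENNReal.ofReal_toReal (measure_ne_top P Sᶜ)]
    exact ENNReal.ofReal_le_ofReal h1
  have hbad : ∫⁻ ω in Sᶜ, Lam ω (cube n 0) ∂P ≤ ENNReal.ofReal ((n / 5) ^ d / 4) := by
    refine (setLIntegral_box_le hL.measurable (fun t => hη' _ t hSc) hn1' 0).trans ?_
    rw [← ENNReal.ofReal_mul (by positivity)]
    refine ENNReal.ofReal_le_ofReal (le_of_eq ?_)
    have : (30 : ℝ) ^ d = 6 ^ d * 5 ^ d := by rw [← mul_pow]; norm_num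
    rw [this, mul_pow, div_pow]
    field_simp
  have hgood : ENNReal.ofReal ((n / 5) ^ d * (3 / 4)) ≤ ∫⁻ ω in S, Lam ω (cube n 0) ∂P := by
    have h1 := le_lintegral_box hL hn1'
    rw [← lintegral_add_compl (fun ω => Lam ω (box ((n : ℝ) / 2) 0)) hSm] at h1
    have h2 := h1.trans (add_le_add_right hbad _)
    refine ENNReal.le_of_add_le_add_right (a := ENNReal.ofReal ((n / 5) ^ d / 4))
      ENNReal.ofReal_ne_top (le_trans (le_of_eq ?_) h2)
    rw [← ENNReal.ofReal_add (by positivity) (by positivity)]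
    congr 1
    ring
  have hmono : Tendsto (fun M : ℕ => ∫⁻ ω in S, min (Lam ω (cube n 0)) M ∂P) atTop
      (𝓝 (∫⁻ ω in S, Lam ω (cube n 0) ∂P)) := by
    refine lintegral_tendsto_of_tendsto_of_monotone
      (fun M => (hQm.min measurable_const).aemeasurable)
      (Eventually.of_forall fun ω M M' h => min_le_min_left _ (by exact_mod_cast h))
      (Eventually.of_forall fun ω => ?_)
    have h3 : Tendsto (fun M : ℕ => min (Lam ω (cube n 0)) (M : ℝ≥0∞)) atTop
        (𝓝 (min (Lam ω (cube n 0)) ⊤)) :=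
      tendsto_const_nhds.min ENNReal.tendsto_nat_nhds_top
    rwa [min_top_right] at h3
  have hlt : ENNReal.ofReal ((n / 5) ^ d / 2) < ∫⁻ ω in S, Lam ω (cube n 0) ∂P := by
    refine lt_of_lt_of_le ?_ hgood
    rw [ENNReal.ofReal_lt_ofReal_iff (by positivity)]
    have : 0 < ((n : ℝ) / 5) ^ d := by positivity
    linarith
  obtain ⟨M, hM, hM1⟩ := (((tendsto_order.1 hmono).1 _ hlt).and (eventually_ge_atTop 1)).exists
  refine ⟨n, M, hn1, hM1, hM.le.trans (le_of_eq ?_)⟩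
  rw [← lintegral_indicator hSm]
  exact lintegral_congr fun ω => (coe_truncMass n M 0 ω).symm

lemma exp_neg_add_half_le {u : ℝ} (h0 : 0 ≤ u) (h1 : u ≤ 1) : Real.exp (-u) + u / 2 ≤ 1 := by
  have h2 := Real.add_one_le_exp u
  have h3 : Real.exp (-u) ≤ 1 / (u + 1) := by
    rw [Real.exp_neg, ← one_div]
    exact one_div_le_one_div_of_le (by linarith) h2
  have h4 : 1 / (u + 1) ≤ 1 - u / 2 := by
    rw [div_le_iff₀ (by linarith)]
    nlinarith
  linarith

/-- As `b Y ≤ 1`, the bound `exp (-u) ≤ 1 - u / 2` on `[0, 1]` can be averaged, and `1 - b w / 2 ≤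
exp (-b w / 2)`. -/
lemma lintegral_exp_neg_le [IsProbabilityMeasure P] {Y : Ω → ℝ≥0} (hY : Measurable Y) {M : ℕ}
    (hM : ∀ ω, Y ω ≤ M) {w : ℝ} (hw : ENNReal.ofReal w ≤ ∫⁻ ω, Y ω ∂P) {b : ℝ}
    (hb : 0 ≤ b) (hbM : b * M ≤ 1) :
    ∫⁻ ω, ENNReal.ofReal (Real.exp (-(b * Y ω))) ∂P ≤ ENNReal.ofReal (Real.exp (-(b * w / 2))) := by
  have h1 : ∫⁻ ω, ENNReal.ofReal (Real.exp (-(b * Y ω))) ∂P + ENNReal.ofReal (b / 2 * w) ≤ 1 := by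
    calc _ ≤ ∫⁻ ω, ENNReal.ofReal (Real.exp (-(b * Y ω))) ∂P +
          ∫⁻ ω, ENNReal.ofReal (b / 2) * Y ω ∂P := by
          rw [lintegral_const_mul _ hY.coe_nnreal_ennreal, ENNReal.ofReal_mul (by positivity)]
          gcongr
      _ = ∫⁻ ω, (ENNReal.ofReal (Real.exp (-(b * Y ω))) + ENNReal.ofReal (b / 2) * Y ω) ∂P := by
          rw [lintegral_add_right _ (hY.coe_nnreal_ennreal.const_mul _)]
      _ ≤ ∫⁻ ω, 1 ∂P := by
          refine lintegral_mono fun ω => ?_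
          rw [← ENNReal.ofReal_coe_nnreal, ← ENNReal.ofReal_mul (by positivity),
            ← ENNReal.ofReal_add (by positivity) (by positivity), ← ENNReal.ofReal_one]
          refine ENNReal.ofReal_le_ofReal ?_
          have h2 : (Y ω : ℝ) ≤ M := by exact_mod_cast hM ω
          have h3 : b * Y ω ≤ 1 := (mul_le_mul_of_nonneg_left h2 hb).trans hbM
          have := exp_neg_add_half_le (u := b * Y ω) (by positivity) h3
          linarith
      _ = 1 := by simp
  refine (ENNReal.le_sub_of_add_le_right ENNReal.ofReal_ne_top h1).trans ?_
  rcases le_or_gt 0 w with hw0 | hw0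
  · rw [← ENNReal.ofReal_one, ← ENNReal.ofReal_sub _ (by positivity)]
    refine ENNReal.ofReal_le_ofReal ?_
    have := Real.add_one_le_exp (-(b * w / 2))
    linarith
  · refine tsub_le_self.trans ?_
    rw [← ENNReal.ofReal_one]
    refine ENNReal.ofReal_le_ofReal (Real.one_le_exp ?_)
    nlinarith

open Classical in
/-- The Laplace transform of the mass of a large cube decays exponentially in its volume, up to
a negligible error. -/
theorem eventually_lintegral_exp_neg_le [IsProbabilityMeasure P] (hd : 2 ≤ d)
    (hL : IsEnvironment P Lam) (hR : IsStabilizing P Lam R) {τ : ℝ} (hτ : 0 < τ) :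
    ∀ᶠ ρ : ℝ in atTop, ∀ l : ℝ, 0 ≤ l →
      ∫⁻ ω, ENNReal.ofReal (Real.exp (-(l.toNNReal * (Lam ω (box ρ 0)).toNNReal : ℝ≥0))) ∂P ≤
        ENNReal.ofReal (max (Real.exp (-(l * (ρ / 20) ^ d / 4))) τ) := by
  obtain ⟨n, M, hn, hM, hnM⟩ := exists_le_lintegral_truncMass hL hR
  have hn' : (1 : ℝ) ≤ n := by exact_mod_cast hn
  have hM' : (1 : ℝ) ≤ M := by exact_mod_cast hM
  have hτ' : ∀ᶠ ρ : ℝ in atTop, Real.exp (-(1 / M * (ρ / 20) ^ d / 4)) < τ := by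
    have h1 : Tendsto (fun ρ : ℝ => 1 / M * (ρ / 20) ^ d / 4) atTop atTop := by
      refine Tendsto.atTop_div_const (by norm_num) (Tendsto.const_mul_atTop (by positivity) ?_)
      exact (tendsto_pow_atTop (by omega)).comp (tendsto_id.atTop_div_const (by norm_num))
    exact (tendsto_order.1 (Real.tendsto_exp_neg_atTop_nhds_zero.comp h1)).2 _ hτ
  filter_upwards [hτ', eventually_ge_atTop (5 * n : ℝ)] with ρ hρτ hρ l hl
  obtain ⟨J, hJ1, hJ2⟩ : ∃ J : ℕ, (J : ℝ) ≤ (ρ - n / 2) / (4 * n) ∧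
      (ρ - n / 2) / (4 * n) < J + 1 :=
    ⟨⌊(ρ - n / 2) / (4 * n)⌋₊, Nat.floor_le (div_nonneg (by linarith) (by positivity)),
      Nat.lt_floor_add_one _⟩
  rw [le_div_iff₀ (by positivity)] at hJ1
  rw [div_lt_iff₀ (by positivity)] at hJ2
  have hcard : ρ / (4 * n) ≤ 2 * J + 1 := by
    rw [div_le_iff₀ (by positivity)]
    linarith
  have h4n : (0 : ℝ) < 4 * n := by positivity
  -- Cubes of side `n` centred at the sites of a lattice with spacing `4 n > 3 n`: their truncated
  -- masses are independent.
  set φ : Finset (E d) := (latticeBox d J).image (site (4 * n) 0) with hφ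
  have hφcard : φ.card = (2 * J + 1) ^ d := by
    rw [hφ, Finset.card_image_of_injective _ (site_injective h4n 0), card_latticeBox]
  have hsep : ∀ x ∈ φ, ∀ y ∈ φ, x ≠ y → ∃ i, 4 * (n : ℝ) ≤ |x i - y i| := by
    intro x hx y hy hxy
    obtain ⟨u, hu, rfl⟩ := Finset.mem_image.1 hx
    obtain ⟨v, hv, rfl⟩ := Finset.mem_image.1 hy
    have huv : u ≠ v := fun h => hxy (by rw [h])
    obtain ⟨i, hi⟩ := Function.ne_iff.1 huv
    have h1 : (1 : ℤ) ≤ |u i - v i| := Int.one_le_abs (sub_ne_zero.2 hi)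
    have h2 := le_abs_site_sub h4n (0 : E d) h1
    refine ⟨i, ?_⟩
    rwa [Int.cast_one, one_mul] at h2
  have hrat : ∀ x ∈ φ, x ∈ ratPoints d := by
    intro x hx i
    obtain ⟨u, hu, rfl⟩ := Finset.mem_image.1 hx
    exact ⟨4 * n * u i, by simp⟩
  have hsubset : ∀ x ∈ φ, cube n x ⊆ box ρ 0 := by
    intro x hx y hy i
    obtain ⟨u, hu, rfl⟩ := Finset.mem_image.1 hx
    have h1 := abs_le.1 (hy i)
    have h2 : |(u i : ℝ)| ≤ J := by exact_mod_cast mem_latticeBox.1 hu i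
    have h3 := abs_le.1 h2
    simp only [site_apply, PiLp.zero_apply, zero_add] at h1
    rw [PiLp.zero_apply, sub_zero, abs_le]
    constructor <;> nlinarith
  have hdisj : PairwiseDisjoint (φ : Set (E d)) fun x => cube (n : ℝ) x := by
    intro x hx y hy hxy
    obtain ⟨i, hi⟩ := hsep x hx y hy hxy
    exact disjoint_cube (i := i) (by linarith)
  have hind := hR.indep n hn (fun ν => (min (ν univ) M).toNNReal)
    (((Measure.measurable_coe MeasurableSet.univ).min measurable_const).ennreal_toNNReal)
    ⟨M, fun ν => by
      rw [← ENNReal.coe_le_coe,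
        ENNReal.coe_toNNReal (ne_top_of_le_ne_top (ENNReal.natCast_ne_top M) (min_le_right _ _))]
      exact (min_le_right _ _).trans (by simp)⟩ φ
    (fun x hx y hy hxy => (hsep x hx y hy hxy).elim fun i hi =>
      lt_of_lt_of_le (by linarith) (hi.trans (abs_sub_le_dist x y i)))
  -- The cap at `1 / M` makes `lintegral_exp_neg_le` applicable. Where it is active, a large `ρ`
  -- already yields the bound `τ`, whatever `l` is.
  set b := min l (1 / M) with hb
  have hb0 : 0 ≤ b := le_min hl (by positivity)
  have hbM : b * M ≤ 1 := by
    calc b * M ≤ 1 / M * M := by gcongr; exact min_le_right _ _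
      _ = 1 := by field_simp
  have hind' := hind.comp (fun _ (y : ℝ≥0) => ENNReal.ofReal (Real.exp (-(b * y)))) fun _ => by
    fun_prop
  have hint : ∀ᵐ ω ∂P, Lam ω (box ρ 0) ≠ ∞ := by
    have h1 : Measurable fun ω => Lam ω (box ρ 0) :=
      (Measure.measurable_coe (measurableSet_box _ _)).comp hL.measurable
    have h2 := lintegral_box_le hL (m := 2 * ρ) (by linarith) 0
    rw [mul_div_cancel_left₀ ρ two_ne_zero] at h2
    filter_upwards [ae_lt_top h1 (ne_top_of_le_ne_top ENNReal.ofReal_ne_top h2)] with ω hω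
    exact hω.ne
  have hle : ∀ᵐ ω ∂P,
      ENNReal.ofReal (Real.exp (-(l.toNNReal * (Lam ω (box ρ 0)).toNNReal : ℝ≥0))) ≤
      ∏ x : φ, ENNReal.ofReal (Real.exp (-(b * truncMass Lam R n M x ω))) := by
    filter_upwards [hint] with ω hω
    rw [← ENNReal.ofReal_prod_of_nonneg fun x _ => (Real.exp_pos _).le, ← Real.exp_sum]
    refine ENNReal.ofReal_le_ofReal (Real.exp_le_exp.2 ?_)
    rw [Finset.sum_neg_distrib, ← Finset.mul_sum, neg_le_neg_iff,
      Finset.sum_coe_sort φ fun x => (truncMass Lam R n M x ω : ℝ)]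
    have h1 : ((∑ x ∈ φ, truncMass Lam R n M x ω : ℝ≥0) : ℝ≥0∞) ≤ Lam ω (box ρ 0) := by
      rw [ENNReal.ofNNReal_finsetSum]
      refine (Finset.sum_le_sum fun x _ => coe_truncMass_le n M x ω).trans ?_
      rw [← measure_biUnion_finset hdisj fun x _ => measurableSet_box _ _]
      exact measure_mono (iUnion₂_subset hsubset)
    have h2 : (∑ x ∈ φ, truncMass Lam R n M x ω) ≤ (Lam ω (box ρ 0)).toNNReal := by
      rw [← ENNReal.coe_le_coe, ENNReal.coe_toNNReal hω]
      exact h1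
    have h3 : ∑ x ∈ φ, (truncMass Lam R n M x ω : ℝ) ≤ (Lam ω (box ρ 0)).toNNReal := by
      exact_mod_cast h2
    push_cast
    rw [Real.coe_toNNReal l hl]
    exact mul_le_mul (min_le_left _ _) h3 (Finset.sum_nonneg fun x _ => NNReal.coe_nonneg _) hl
  have hmain : ∫⁻ ω, ENNReal.ofReal
      (Real.exp (-(l.toNNReal * (Lam ω (box ρ 0)).toNNReal : ℝ≥0))) ∂P ≤
      ENNReal.ofReal (Real.exp (-(b * ((n / 5) ^ d / 2) / 2))) ^ φ.card := by
    calc _ ≤ ∫⁻ ω, ∏ x : φ, ENNReal.ofReal (Real.exp (-(b * truncMass Lam R n M x ω))) ∂P :=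
          lintegral_mono_ae hle
      _ = ∏ x : φ, ∫⁻ ω, ENNReal.ofReal (Real.exp (-(b * truncMass Lam R n M x ω))) ∂P := by
          refine lintegral_prod_eq_prod_lintegral_of_indepFun _ _ hind' fun x => ?_
          have := measurable_truncMass hL.measurable hR.measurable n M (x : E d)
          exact (show Measurable fun y : ℝ≥0 => ENNReal.ofReal (Real.exp (-(b * y))) by
            fun_prop).comp this
      _ ≤ ∏ _x : φ, ENNReal.ofReal (Real.exp (-(b * ((n / 5) ^ d / 2) / 2))) := by
          refine Finset.prod_le_prod' fun x _ => ?_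
          refine lintegral_exp_neg_le (measurable_truncMass hL.measurable hR.measurable n M _)
            (truncMass_le n M _) ?_ hb0 hbM
          rw [lintegral_truncMass hR n M (hrat x x.2)]
          exact hnM
      _ = _ := by simp
  refine hmain.trans ?_
  rw [← ENNReal.ofReal_pow (Real.exp_pos _).le, ← Real.exp_nat_mul]
  refine ENNReal.ofReal_le_ofReal ?_
  have hexp : Real.exp (φ.card * -(b * ((n / 5) ^ d / 2) / 2)) ≤
      Real.exp (-(b * (ρ / 20) ^ d / 4)) := by
    refine Real.exp_le_exp.2 ?_
    have h1 : (ρ / (4 * n)) ^ d ≤ (φ.card : ℝ) := by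
      rw [hφcard]
      push_cast
      have : 0 ≤ ρ / (4 * n) := div_nonneg (by linarith) h4n.le
      gcongr
    have h2 : (ρ / 20) ^ d = (ρ / (4 * n)) ^ d * (n / 5) ^ d := by
      rw [← mul_pow]
      congr 1
      field_simp
      ring
    have h3 : (ρ / (4 * n)) ^ d * (b * (n / 5) ^ d) ≤ φ.card * (b * (n / 5) ^ d) := by gcongr
    rw [h2]
    linarith
  refine hexp.trans ?_
  rcases le_total l (1 / M) with h | h
  · rw [hb, min_eq_left h]
    exact le_max_left _ _
  · rw [hb, min_eq_right h]
    exact hρτ.le.trans (le_max_right _ _)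

end

/-! ### Fully occupied windows -/

/-- Every cube of a grid of cubes around the origin carries mass. -/
def occupied (d : ℕ) (ρ : ℝ) (J : ℕ) : Set (Measure (E d)) :=
  ⋂ j ∈ latticeBox d J, {ν | ν (box ρ (site (2 * ρ) 0 j)) ≠ 0}

lemma measurableSet_occupied (ρ : ℝ) (J : ℕ) : MeasurableSet (occupied d ρ J) :=
  Finset.measurableSet_biInter _ fun _ _ =>
    (Measure.measurable_coe (measurableSet_box _ _)) (measurableSet_singleton 0).compl

lemma zero_notMem_occupied (ρ : ℝ) (J : ℕ) : (0 : Measure (E d)) ∉ occupied d ρ J := by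
  intro h
  have := mem_iInter₂.1 h 0 (mem_latticeBox.2 fun i => by simp)
  exact this (by simp)

lemma dist_le_of_abs_sub_le {x y : E d} {c : ℝ} (hc : 0 ≤ c) (h : ∀ i, |x i - y i| ≤ c) :
    dist x y ≤ d * c := by
  rw [EuclideanSpace.dist_eq, Real.sqrt_le_left (by positivity)]
  calc ∑ i, dist (x i) (y i) ^ 2 ≤ ∑ _i : Fin d, c ^ 2 := by
        refine Finset.sum_le_sum fun i _ => ?_
        rw [Real.dist_eq]
        exact pow_le_pow_left₀ (abs_nonneg _) (h i) 2
    _ = d * c ^ 2 := by simp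
    _ ≤ (d * c) ^ 2 := by
        rw [mul_pow]
        have : (d : ℝ) ≤ (d : ℝ) ^ 2 := by exact_mod_cast Nat.le_self_pow two_ne_zero d
        gcongr

lemma exists_mem_box_site {ρ : ℝ} (hρ : 0 < ρ) {J : ℕ} {y : E d}
    (hy : y ∈ openBox ((2 * J + 1) * ρ) 0) :
    ∃ j ∈ latticeBox d J, y ∈ box ρ (site (2 * ρ) 0 j) := by
  have h1 (i) := abs_le.1 (abs_sub_round (y i / (2 * ρ)))
  have hmul (i) : y i / (2 * ρ) * (2 * ρ) = y i := div_mul_cancel₀ _ (by positivity)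
  refine ⟨fun i => round (y i / (2 * ρ)), mem_latticeBox.2 fun i => ?_, fun i => ?_⟩
  · have h2 := abs_lt.1 (hy i)
    rw [PiLp.zero_apply, sub_zero] at h2
    have h3 : y i / (2 * ρ) < J + 1 / 2 := by rw [div_lt_iff₀ (by positivity)]; linarith
    have h4 : -(J + 1 / 2) < y i / (2 * ρ) := by rw [lt_div_iff₀ (by positivity)]; linarith
    have h5 := h1 i
    have h6 : (round (y i / (2 * ρ)) : ℝ) < J + 1 := by linarith
    have h7 : -((J : ℝ) + 1) < round (y i / (2 * ρ)) := by linarith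
    have h6' : round (y i / (2 * ρ)) < (J : ℤ) + 1 := by exact_mod_cast h6
    have h7' : -((J : ℤ) + 1) < round (y i / (2 * ρ)) := by exact_mod_cast h7
    rw [abs_le]
    omega
  · have h5 := h1 i
    have h8 := hmul i
    simp only [site_apply, PiLp.zero_apply, zero_add]
    rw [abs_le]
    constructor <;> nlinarith

/-- In an occupied window, all the points are linked. -/
lemma exists_linked_of_occupied (hd : 2 ≤ d) {ρ r : ℝ} (hρ : 0 < ρ) (hr : d * (4 * ρ) < r)
    {J : ℕ} {ν : Measure (E d)} (hν : IsPointConfiguration ν) (h : ν ∈ occupied d ρ J) :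
    ∃ v : (Fin d → ℤ) → E d,
      (∀ j ∈ latticeBox d J, v j ∈ atoms ν ∧ v j ∈ box ρ (site (2 * ρ) 0 j)) ∧
      ∀ j ∈ latticeBox d J, ∀ x ∈ atoms ν, x ∈ openBox ((2 * J + 1) * ρ) 0 →
        Linked r (atoms ν) x (v j) := by
  have hex : ∀ j : Fin d → ℤ, ∃ v : E d, j ∈ latticeBox d J →
      v ∈ atoms ν ∧ v ∈ box ρ (site (2 * ρ) 0 j) := by
    intro j
    by_cases hj : j ∈ latticeBox d J
    · obtain ⟨v, hv, hv'⟩ := hν.exists_atom (mem_iInter₂.1 h j hj)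
      exact ⟨v, fun _ => ⟨hv, hv'⟩⟩
    · exact ⟨0, fun h => absurd h hj⟩
  choose v hv using hex
  have hd0 : 0 < d := by omega
  -- With radius `-1` nothing is removed, so `latticePath_holed` shows that the full lattice cube is
  -- connected.
  have hall : ∀ j ∈ latticeBox d J, j ∈ holed (J : ℤ) (-1) 0 := fun j hj =>
    ⟨mem_latticeBox.1 hj, ⟨0, hd0⟩, lt_of_lt_of_le (by norm_num) (abs_nonneg _)⟩
  have hback : ∀ j ∈ holed (J : ℤ) (-1) 0, j ∈ latticeBox d J := fun j hj =>
    mem_latticeBox.2 hj.1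
  have hlink : ∀ j ∈ latticeBox d J, ∀ j' ∈ latticeBox d J, Linked r (atoms ν) (v j) (v j') := by
    intro j hj j' hj'
    have hpath := latticePath_holed hd (J := J) (c := -1) (by positivity) (by omega) 0
      (hall j hj) (hall j' hj')
    refine Relation.ReflTransGen.lift v ?_ _ _ hpath
    rintro a _ ⟨ha, hb, i, e, he, rfl⟩
    obtain ⟨hva, hva'⟩ := hv a (hback a ha)
    obtain ⟨hvb, hvb'⟩ := hv _ (hback _ hb)
    refine ⟨hva, hvb, (dist_le_of_abs_sub_le (c := 4 * ρ) (by positivity) fun k => ?_).trans_lt hr⟩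
    have h1 := abs_le.1 (hva' k)
    have h2 := abs_le.1 (hvb' k)
    simp only [site_apply, PiLp.zero_apply, zero_add, Pi.add_apply] at h1 h2
    have h3 : |((Pi.single i e : Fin d → ℤ) k : ℝ)| ≤ 1 := by
      rcases eq_or_ne k i with rfl | hk
      · rw [Pi.single_eq_same]
        rcases he with h | h <;> rw [h] <;> simp
      · rw [Pi.single_eq_of_ne hk]; simp
    have h4 := abs_le.1 h3
    push_cast at h2
    rw [abs_le]
    constructor <;> nlinarith
  refine ⟨v, hv, fun j hj x hx hxb => ?_⟩
  obtain ⟨j', hj', hxj⟩ := exists_mem_box_site hρ hxb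
  obtain ⟨hva, hva'⟩ := hv j' hj'
  refine Relation.ReflTransGen.head ⟨hx, hva, ?_⟩ (hlink j' hj' j hj)
  refine (dist_le_of_abs_sub_le (c := 4 * ρ) (by positivity) fun k => ?_).trans_lt hr
  have h1 := abs_le.1 (hxj k)
  have h2 := abs_le.1 (hva' k)
  rw [abs_le]
  constructor <;> linarith

/-- The grid of cubes used at connection radius `r`. -/
def window (d : ℕ) (r : ℝ) : Set (Measure (E d)) := occupied d (r / (5 * d)) (75 * d - 1)

section Window

variable {r : ℝ} {ν : Measure (E d)}

/-- The grid fills the cube of half side `30 r = 6 (10 r / 2)`, up to a margin of `r / (5 d)` at its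
boundary. -/
lemma window_size (hd : 2 ≤ d) (r : ℝ) :
    (2 * ((75 * d - 1 : ℕ) : ℝ) + 1) * (r / (5 * d)) = 30 * r - r / (5 * d) := by
  have hd0 : (0 : ℝ) < d := by positivity
  have : ((75 * d - 1 : ℕ) : ℝ) = 75 * d - 1 := by
    rw [Nat.cast_sub (by omega)]; push_cast; ring
  rw [this]
  field_simp
  ring

lemma window_mesh (hd : 2 ≤ d) (hr : 0 < r) : 0 < r / (5 * d) ∧ r / (5 * d) ≤ r / 10 := by
  have hd' : (2 : ℝ) ≤ d := by exact_mod_cast hd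
  refine ⟨by positivity, ?_⟩
  exact div_le_div_of_nonneg_left hr.le (by norm_num) (by linarith)

lemma exists_linked_of_window (hd : 2 ≤ d) (hr : 0 < r) (hν : IsPointConfiguration ν)
    (h : ν.restrict (box (6 * (10 * r / 2)) 0) ∈ window d r) :
    ∃ x₀ ∈ atoms ν, x₀ ∈ box (6 / 5 * (10 * r / 2)) 0 ∧ ∃ y ∉ openBox (5 * (10 * r / 2)) (0 : E d),
      ∀ x ∈ atoms ν, x ∈ box (3 * (10 * r / 2)) 0 → Linked r (atoms ν) x y := by
  set W : Set (E d) := box (6 * (10 * r / 2)) 0 with hW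
  have hWm : MeasurableSet W := measurableSet_box _ _
  obtain ⟨hρ0, hρ1⟩ := window_mesh hd hr
  have hd0 : (0 : ℝ) < d := by positivity
  set ρ := r / (5 * d) with hρ
  set J := 75 * d - 1 with hJ
  have hsize := window_size hd r
  rw [← hρ, ← hJ] at hsize
  -- Points in the same or in neighbouring cubes differ by at most `4 ρ` in each coordinate; the
  -- mesh is chosen to make their distance at most `4 r / 5`.
  have hstep : d * (4 * ρ) < r := by
    have : d * (4 * ρ) = 4 / 5 * r := by rw [hρ]; field_simp
    linarith
  obtain ⟨v, hv, hlink⟩ := exists_linked_of_occupied hd hρ0 hstep (hν.restrict hWm) h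
  rw [atoms_restrict] at hv hlink
  have h0 : (0 : Fin d → ℤ) ∈ latticeBox d J := mem_latticeBox.2 fun i => by simp
  have h1 : (fun _ => (J : ℤ) : Fin d → ℤ) ∈ latticeBox d J := mem_latticeBox.2 fun i => by simp
  have hx0 : v 0 ∈ box (6 / 5 * (10 * r / 2)) 0 := by
    intro i
    have := (hv 0 h0).2 i
    simp only [site_apply, PiLp.zero_apply, Pi.zero_apply, Int.cast_zero, mul_zero, zero_add,
      sub_zero] at this ⊢
    linarith
  refine ⟨v 0, (hv 0 h0).1.1, hx0, v fun _ => J, ?_, fun x hx hxb => ?_⟩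
  · intro hy
    have h2 := abs_lt.1 (hy ⟨0, by omega⟩)
    have h3 := abs_le.1 ((hv _ h1).2 ⟨0, by omega⟩)
    simp only [site_apply, PiLp.zero_apply, zero_add, sub_zero, Int.cast_natCast] at h2 h3
    nlinarith
  · refine (hlink _ h1 x ⟨hx, box_subset (by linarith) _ hxb⟩ fun i => ?_).mono inter_subset_left
    refine (hxb i).trans_lt ?_
    rw [hsize]
    linarith

lemma uniq_of_window (hd : 2 ≤ d) (hr : 0 < r) (hν : IsPointConfiguration ν)
    (h : ν.restrict (box (6 * (10 * r / 2)) 0) ∈ window d r) :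
    Uniq r (atoms ν) (10 * r / 2) 0 := by
  obtain ⟨x₀, hx₀, hx₀b, y, hy, hlink⟩ := exists_linked_of_window hd hr hν h
  refine ⟨⟨x₀, hx₀, hx₀b, y, hlink x₀ hx₀ (box_subset (by linarith) _ hx₀b), hy⟩, ?_⟩
  intro x hx x' hx' hxb hxb' _ _
  exact (hlink x hx hxb).trans (hlink x' hx' hxb').symm

lemma exits_of_window (hd : 2 ≤ d) (hr : 0 < r) (hν : IsPointConfiguration ν)
    (h : ν.restrict (box (6 * (10 * r / 2)) 0) ∈ window d r) {x : E d} (hx : x ∈ atoms ν)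
    (hxb : x ∈ box (3 * (10 * r / 2)) 0) : Exits r (atoms ν) (10 * r / 2) 0 x := by
  obtain ⟨-, -, -, y, hy, hlink⟩ := exists_linked_of_window hd hr hν h
  exact ⟨y, hlink x hx hxb, hy⟩

end Window

lemma exists_atom_of_crossingEvent {r s : ℝ} {ν : Measure (E d)} (h : CrossingEvent r s ν) :
    ∃ x ∈ atoms ν, ∃ y ∈ atoms ν, dist x y < r ∧ ∃ z ∈ segment ℝ x y, z ∈ cube s 0 := by
  obtain ⟨C, ⟨⟨w, hw, rfl⟩, -, -⟩, -, z, hz, hzs⟩ := h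
  obtain ⟨⟨x, hx, y, hy, hxy, hzxy⟩, -⟩ := connectedComponentIn_subset _ _ hz
  exact ⟨x, hx, y, hy, hxy, z, hzxy, hzs⟩

lemma mem_box_of_mem_segment {r ρ : ℝ} {b x y z : E d} (hxy : dist x y ≤ r) (hz : z ∈ segment ℝ x y)
    (hzb : z ∈ box ρ b) : x ∈ box (ρ + r) b := by
  intro i
  have h1 : dist x z ≤ r := by
    rw [segment_eq_image_lineMap] at hz
    obtain ⟨t, ht, rfl⟩ := hz
    rw [dist_left_lineMap, Real.norm_of_nonneg ht.1]
    exact (mul_le_of_le_one_left dist_nonneg ht.2).trans hxy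
  have h2 := abs_le.1 ((abs_sub_le_dist x z i).trans h1)
  have h3 := abs_le.1 (hzb i)
  rw [abs_le]
  constructor <;> linarith

section

variable {Ω : Type*} [MeasurableSpace Ω] {P : Measure Ω} [IsProbabilityMeasure P]
  {Lam : Ω → Measure (E d)} {R : E d → Ω → ℝ≥0∞}

/-- A union bound over the `(150 d - 1)^d` grid cubes. The probability that one of them is empty is
the Laplace transform of its mass. -/
lemma eventually_measure_notMem_window_le (hd : 2 ≤ d) (hL : IsEnvironment P Lam)
    (hR : IsStabilizing P Lam R) {τ : ℝ} (hτ : 0 < τ) :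
    ∀ᶠ r : ℝ in atTop, ∀ (l : ℝ) (X : Ω → Measure (E d)), 0 ≤ l → IsCox P Lam l X →
      (∀ ω, IsPointConfiguration (X ω)) →
      P {ω | (X ω).restrict (box (6 * (10 * r / 2)) 0) ∉ window d r} ≤
        ENNReal.ofReal ((150 * d) ^ d * max (Real.exp (-(l * r ^ d / (4 * (100 * d) ^ d)))) τ) := by
  have hd0 : (0 : ℝ) < d := by positivity
  have hlim : Tendsto (fun r : ℝ => r / (5 * d)) atTop atTop :=
    tendsto_id.atTop_div_const (by positivity)
  filter_upwards [hlim.eventually (eventually_lintegral_exp_neg_le hd hL hR hτ),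
    eventually_gt_atTop 0] with r hlap hr l X hl hX hpc
  obtain ⟨hρ0, hρ1⟩ := window_mesh hd hr
  have hsize := window_size hd r
  set ρ := r / (5 * d) with hρ
  set J := 75 * d - 1 with hJ
  set W : Set (E d) := box (6 * (10 * r / 2)) 0 with hW
  have hsub : ∀ j ∈ latticeBox d J, box ρ (site (2 * ρ) (0 : E d) j) ⊆ W := by
    intro j hj y hy i
    have h1 := abs_le.1 (hy i)
    have h2 : |(j i : ℝ)| ≤ J := by exact_mod_cast mem_latticeBox.1 hj i
    have h3 := abs_le.1 h2
    simp only [site_apply, PiLp.zero_apply, zero_add, sub_zero] at h1 ⊢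
    rw [abs_le]
    constructor <;> nlinarith
  have hzero (z : E d) : P {ω | X ω (box ρ z) = 0} = P {ω | X ω (box ρ 0) = 0} := by
    have hA : MeasurableSet {ν : Measure (E d) | ν (box ρ 0) = 0} :=
      (Measure.measurable_coe (measurableSet_box _ _)) (measurableSet_singleton 0)
    have := hX.measure_shift hpc hL hA z
    simpa only [Set.mem_ofPred_eq, shift_box, zero_add] using this
  have hcov : {ω | (X ω).restrict W ∉ window d r} ⊆
      ⋃ j ∈ latticeBox d J, {ω | X ω (box ρ (site (2 * ρ) 0 j)) = 0} := by
    intro ω hω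
    by_contra hcon
    refine hω (mem_iInter₂.2 fun j hj => ?_)
    rw [Set.mem_ofPred_eq, Measure.restrict_apply (measurableSet_box _ _),
      inter_eq_left.2 (hsub j hj)]
    intro h0
    exact hcon (mem_iUnion₂.2 ⟨j, hj, h0⟩)
  refine (measure_mono hcov).trans ((measure_biUnion_finset_le _ _).trans ?_)
  rw [Finset.sum_congr rfl fun j _ => hzero (site (2 * ρ) 0 j), Finset.sum_const, card_latticeBox,
    nsmul_eq_mul, hX.measure_count_eq_zero (measurableSet_box _ _) (isBounded_box _ _),
    ENNReal.ofReal_mul (by positivity)]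
  refine mul_le_mul' ?_ ((hlap l hl).trans
    (ENNReal.ofReal_le_ofReal (max_le_max (le_of_eq ?_) le_rfl)))
  · rw [← ENNReal.ofReal_natCast]
    refine ENNReal.ofReal_le_ofReal ?_
    push_cast
    gcongr
    have : ((75 * d - 1 : ℕ) : ℝ) = 75 * d - 1 := by
      rw [Nat.cast_sub (by omega)]; push_cast; ring
    rw [hJ, this]
    linarith
  · congr 2
    rw [hρ, div_div, div_pow]
    have : (5 * (d : ℝ) * 20) = 100 * d := by ring
    rw [this, ← mul_div_assoc, div_div, mul_comm (4 : ℝ)]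

lemma eventually_exists_radii (hR : IsStabilizing P Lam R) {τ : ℝ} (hτ : 0 < τ) :
    ∀ᶠ r : ℝ in atTop, ∃ n : ℕ, 6 * (10 * r) ≤ n ∧ (n : ℝ) ≤ 10 * (10 * r) ∧
      ∀ z, P (smallRadii R n z n)ᶜ ≤ ENNReal.ofReal τ := by
  have hev : ∀ᶠ k : ℕ in atTop, 1 - τ / 2 ^ d < P.real (smallRadii R k (0 : E d) k) :=
    (tendsto_order.1 hR.tendsto_one).1 _ (by have : 0 < τ / 2 ^ d := by positivity
                                             linarith)
  have hlim : Tendsto (fun r : ℝ => ⌈60 * r⌉₊ - 1) atTop atTop :=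
    (tendsto_sub_atTop_nat 1).comp (tendsto_nat_ceil_atTop.comp
      (tendsto_id.const_mul_atTop (by norm_num)))
  filter_upwards [hlim.eventually hev, eventually_ge_atTop 1] with r hk hr
  have hn1 : 60 * r ≤ (⌈60 * r⌉₊ : ℝ) := Nat.le_ceil _
  have hn2 : (⌈60 * r⌉₊ : ℝ) < 60 * r + 1 := Nat.ceil_lt_add_one (by positivity)
  have hn3 : 1 ≤ ⌈60 * r⌉₊ := Nat.one_le_ceil_iff.2 (by positivity)
  set n := ⌈60 * r⌉₊ with hn
  have hcast : ((n - 1 : ℕ) : ℝ) = n - 1 := by rw [Nat.cast_sub hn3]; simp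
  refine ⟨n, by linarith, by linarith, fun z => ?_⟩
  refine (measure_smallRadii_compl_le hR (b := (n - 1 : ℕ)) (c := (n - 1 : ℕ)) ?_ ?_ ?_ z).trans ?_
  · rw [hcast]; linarith
  · rw [hcast]; linarith
  · rw [hcast]; linarith
  · have hm : MeasurableSet (smallRadii R ((n - 1 : ℕ) : ℝ) (0 : E d) ((n - 1 : ℕ) : ℝ)) :=
      measurableSet_smallRadii hR.measurable _ _ _
    have h1 : P.real (smallRadii R ((n - 1 : ℕ) : ℝ) (0 : E d) ((n - 1 : ℕ) : ℝ))ᶜ ≤ τ / 2 ^ d := by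
      rw [probReal_compl_eq_one_sub hm]
      linarith
    rw [← ENNReal.ofReal_toReal (measure_ne_top P _)]
    refine (mul_le_mul_right (ENNReal.ofReal_le_ofReal h1) _).trans (le_of_eq ?_)
    have h2 : (2 : ℝ≥0∞) ^ d = ENNReal.ofReal (2 ^ d) := by
      rw [ENNReal.ofReal_pow (by norm_num)]; norm_num
    rw [h2, ← ENNReal.ofReal_mul (by positivity)]
    congr 1
    field_simp

/-- If crossings are likely at scales that are not larger than the connection radius, then there
are many points within the connection radius. -/
lemma le_mul_pow_of_crossingEvent (hL : IsEnvironment P Lam) {q Y : ℝ} (hq0 : 0 ≤ q)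
    (hq : 1 - q ≤ Real.exp (-(2 * 72 ^ d * Y)) / 2) {r s l : ℝ} (hr : 1 ≤ r)
    (hrs : s ≤ 10 * r) (hl : 0 ≤ l) {X : Ω → Measure (E d)} (hX : IsCox P Lam l X)
    (hpc : ∀ ω, IsPointConfiguration (X ω))
    (hcross : q < P.real {ω | CrossingEvent r s (X ω)}) : Y ≤ l * r ^ d := by
  set Q : Set (E d) := box (6 * r) 0 with hQ
  have hQm : MeasurableSet Q := measurableSet_box _ _
  have hLQ : Measurable fun ω => Lam ω Q := (Measure.measurable_coe hQm).comp hL.measurable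
  have h1 : P {ω | X ω Q = 0} ≤ ENNReal.ofReal (1 - q) := by
    have := measure_compl_le_of_lt (P := P) (B := {ω | X ω Q ≠ 0})
      (((Measure.measurable_coe hQm).comp hX.measurable) (measurableSet_singleton 0).compl) hq0
      hcross fun ω hω => by
        obtain ⟨x, hx, y, hy, hxy, z, hz, hzs⟩ := exists_atom_of_crossingEvent hω
        rw [Set.mem_ofPred_eq, (hpc ω).exists_atom_iff]
        exact ⟨x, hx, box_subset (by linarith) _ (mem_box_of_mem_segment hxy.le hz hzs)⟩
    refine (measure_mono fun ω hω => ?_).trans this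
    exact fun h => h hω
  -- By Markov's inequality `Lam Q < 2 D` has probability at least `1/2`, so `Q` is empty with
  -- probability at least `exp (-2 l D) / 2`. Crossings rule this out up to probability `1 - q`, and
  -- comparing exponents gives `Y ≤ l r^d`.
  set D : ℝ := (72 * r) ^ d with hD
  have hDpos : 0 < D := by positivity
  have hmark : P {ω | ENNReal.ofReal (2 * D) ≤ Lam ω Q} ≤ ENNReal.ofReal (1 / 2) := by
    refine (meas_ge_le_lintegral_div hLQ.aemeasurable (ENNReal.ofReal_pos.2 (by positivity)).ne'
      ENNReal.ofReal_ne_top).trans ?_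
    rw [ENNReal.div_le_iff (ENNReal.ofReal_pos.2 (by positivity)).ne' ENNReal.ofReal_ne_top,
      ← ENNReal.ofReal_mul (by positivity)]
    have h2 := lintegral_box_le hL (m := 12 * r) (by linarith) 0
    have h3 : 12 * r / 2 = 6 * r := by ring
    rw [h3] at h2
    refine h2.trans (ENNReal.ofReal_le_ofReal (le_of_eq ?_))
    have h4 : 6 * (12 * r) = 72 * r := by ring
    rw [h4, ← hD]
    ring
  set S := {ω | Lam ω Q < ENNReal.ofReal (2 * D)} with hS
  have hSm : MeasurableSet S := measurableSet_lt hLQ measurable_const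
  have hSP : ENNReal.ofReal (1 / 2) ≤ P S := by
    have hSc : P Sᶜ ≤ ENNReal.ofReal (1 / 2) := by
      refine (measure_mono fun ω hω => ?_).trans hmark
      rw [hS, mem_compl_iff, Set.mem_ofPred_eq, not_lt] at hω
      exact hω
    have h5 := measure_add_measure_compl (μ := P) hSm
    rw [measure_univ] at h5
    refine ENNReal.le_of_add_le_add_right (a := ENNReal.ofReal (1 / 2)) ENNReal.ofReal_ne_top ?_
    calc ENNReal.ofReal (1 / 2) + ENNReal.ofReal (1 / 2) = 1 := by
          rw [← ENNReal.ofReal_add (by norm_num) (by norm_num)]; norm_num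
      _ = P S + P Sᶜ := h5.symm
      _ ≤ _ := by gcongr
  have hlow : ENNReal.ofReal (Real.exp (-(l * (2 * D))) / 2) ≤ P {ω | X ω Q = 0} := by
    rw [hX.measure_count_eq_zero hQm (isBounded_box _ _)]
    calc ENNReal.ofReal (Real.exp (-(l * (2 * D))) / 2)
        = ENNReal.ofReal (Real.exp (-(l * (2 * D)))) * ENNReal.ofReal (1 / 2) := by
          rw [← ENNReal.ofReal_mul (Real.exp_pos _).le]; congr 1; ring
      _ ≤ ENNReal.ofReal (Real.exp (-(l * (2 * D)))) * P S := by gcongr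
      _ = ∫⁻ _ω in S, ENNReal.ofReal (Real.exp (-(l * (2 * D)))) ∂P := (setLIntegral_const _ _).symm
      _ ≤ ∫⁻ ω in S, ENNReal.ofReal
            (Real.exp (-(l.toNNReal * (Lam ω Q).toNNReal : ℝ≥0))) ∂P := by
          refine setLIntegral_mono' hSm fun ω hω => ?_
          refine ENNReal.ofReal_le_ofReal (Real.exp_le_exp.2 (neg_le_neg ?_))
          push_cast
          rw [Real.coe_toNNReal l hl]
          refine mul_le_mul_of_nonneg_left ?_ hl
          exact ENNReal.toReal_le_of_le_ofReal (by positivity) (le_of_lt hω)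
      _ ≤ _ := setLIntegral_le_lintegral _ _
  have h6 := (hlow.trans h1).trans (ENNReal.ofReal_le_ofReal hq)
  rw [ENNReal.ofReal_le_ofReal_iff (by positivity)] at h6
  have h7 : Real.exp (-(l * (2 * D))) ≤ Real.exp (-(2 * 72 ^ d * Y)) := by linarith
  rw [Real.exp_le_exp, neg_le_neg_iff, hD, mul_pow] at h7
  have h8 : (0 : ℝ) < 2 * 72 ^ d := by positivity
  refine le_of_mul_le_mul_left ?_ h8
  linarith

end

/-! ### Many points are needed for crossings at small scales -/

lemma exists_mem_box_site_univ {ρ : ℝ} (hρ : 0 < ρ) (y : E d) :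
    ∃ j : Fin d → ℤ, y ∈ box ρ (site (2 * ρ) 0 j) := by
  refine ⟨fun i => round (y i / (2 * ρ)), fun i => ?_⟩
  have h1 := abs_le.1 (abs_sub_round (y i / (2 * ρ)))
  have h2 : y i / (2 * ρ) * (2 * ρ) = y i := div_mul_cancel₀ _ (by positivity)
  simp only [site_apply, PiLp.zero_apply, zero_add]
  rw [abs_le]
  constructor <;> nlinarith

/-- The pairs of grid cubes that contain points within distance `r` whose segment comes close to
the origin. -/
def closePairs (d : ℕ) (r s : ℝ) : Set ((Fin d → ℤ) × (Fin d → ℤ)) :=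
  {p | ∃ x ∈ box (s / 4) (site (2 * (s / 4)) (0 : E d) p.1),
    ∃ y ∈ box (s / 4) (site (2 * (s / 4)) (0 : E d) p.2),
      dist x y < r ∧ ∃ z ∈ segment ℝ x y, z ∈ box (s / 2) 0}

/-- A measurable relaxation of the event that some edge of the Gilbert graph comes close to the
origin. -/
def edgeEvent (d : ℕ) (r s : ℝ) : Set (Measure (E d)) :=
  ⋃ p ∈ closePairs d r s, {ν | ν (box (s / 4) (site (2 * (s / 4)) 0 p.1)) ≠ 0} ∩
    {ν | ν (box (s / 4) (site (2 * (s / 4)) 0 p.2)) ≠ 0}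

lemma measurableSet_edgeEvent (r s : ℝ) : MeasurableSet (edgeEvent d r s) :=
  MeasurableSet.biUnion (to_countable _) fun _ _ =>
    ((Measure.measurable_coe (measurableSet_box _ _)) (measurableSet_singleton 0).compl).inter
      ((Measure.measurable_coe (measurableSet_box _ _)) (measurableSet_singleton 0).compl)

lemma CrossingEvent.mem_edgeEvent {r s : ℝ} (hs : 0 < s) {ν : Measure (E d)}
    (hν : IsPointConfiguration ν) (h : CrossingEvent r s ν) : ν ∈ edgeEvent d r s := by
  obtain ⟨x, hx, y, hy, hxy, z, hz, hzs⟩ := exists_atom_of_crossingEvent h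
  obtain ⟨j, hj⟩ := exists_mem_box_site_univ (ρ := s / 4) (by positivity) x
  obtain ⟨j', hj'⟩ := exists_mem_box_site_univ (ρ := s / 4) (by positivity) y
  refine mem_iUnion₂.2 ⟨(j, j'), ⟨x, hj, y, hj', hxy, z, hz, hzs⟩, ?_, ?_⟩
  · exact hν.exists_atom_iff.2 ⟨x, hx, hj⟩
  · exact hν.exists_atom_iff.2 ⟨y, hy, hj'⟩

/-- Exchanging the endpoints for points of the configuration in the same grid cubes moves every
point of the segment by at most `s / 2` in each coordinate. -/
lemma exists_of_mem_edgeEvent {r s : ℝ} {ν : Measure (E d)}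
    (hν : IsPointConfiguration ν) (h : ν ∈ edgeEvent d r s) :
    ∃ x ∈ atoms ν, ∃ y ∈ atoms ν, x ∈ box (r + s) 0 ∧ y ∈ box (r + s) 0 ∧
      ∃ z ∈ segment ℝ x y, z ∈ box s 0 := by
  obtain ⟨⟨j, j'⟩, ⟨x, hx, y, hy, hxy, z, hz, hzs⟩, h1, h2⟩ := mem_iUnion₂.1 h
  obtain ⟨x', hx', hxj⟩ := hν.exists_atom h1
  obtain ⟨y', hy', hyj⟩ := hν.exists_atom h2
  have hxx (i) : |x' i - x i| ≤ s / 2 := by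
    have := abs_le.1 (hx i)
    have := abs_le.1 (hxj i)
    rw [abs_le]; constructor <;> linarith
  have hyy (i) : |y' i - y i| ≤ s / 2 := by
    have := abs_le.1 (hy i)
    have := abs_le.1 (hyj i)
    rw [abs_le]; constructor <;> linarith
  have hxb := mem_box_of_mem_segment hxy.le hz hzs
  have hyb := mem_box_of_mem_segment (r := r) (x := y) (y := x) (by rw [dist_comm]; exact hxy.le)
    (by rwa [segment_symm]) hzs
  refine ⟨x', hx', y', hy', fun i => ?_, fun i => ?_, ?_⟩
  · have := abs_le.1 (hxb i)
    have := abs_le.1 (hxx i)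
    rw [abs_le]; constructor <;> linarith
  · have := abs_le.1 (hyb i)
    have := abs_le.1 (hyy i)
    rw [abs_le]; constructor <;> linarith
  · obtain ⟨a, b, ha, hb, hab, rfl⟩ := hz
    refine ⟨a • x' + b • y', ⟨a, b, ha, hb, hab, rfl⟩, fun i => ?_⟩
    have h3 := abs_le.1 (hzs i)
    have h4 := abs_le.1 (hxx i)
    have h5 := abs_le.1 (hyy i)
    have h6 : a * (s / 2) + b * (s / 2) = s / 2 := by rw [← add_mul, hab, one_mul]
    simp only [PiLp.add_apply, PiLp.smul_apply, smul_eq_mul, PiLp.zero_apply, sub_zero] at h3 ⊢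
    have h7 := mul_le_mul_of_nonneg_left h4.1 ha
    have h8 := mul_le_mul_of_nonneg_left h4.2 ha
    have h9 := mul_le_mul_of_nonneg_left h5.1 hb
    have h10 := mul_le_mul_of_nonneg_left h5.2 hb
    rw [abs_le]
    constructor <;> linarith

/-- Three collinear points have vanishing determinant of differences. For points `(a, a²)` on the
parabola, this determinant is the Vandermonde product, and coordinate errors of size `s` change it
by at most `16 r s` after scaling by `r`. -/
lemma abs_vandermonde_le {a b c r s A B x₀ x₁ t t' t'' : ℝ} (hr : 0 < r) (hs : 0 < s) (hsr : s ≤ r)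
    (ha : 0 ≤ a ∧ a ≤ 1) (hb : 0 ≤ b ∧ b ≤ 1) (hc : 0 ≤ c ∧ c ≤ 1)
    (ha₀ : |x₀ + t * A - r * a| ≤ s) (hb₀ : |x₀ + t' * A - r * b| ≤ s)
    (hc₀ : |x₀ + t'' * A - r * c| ≤ s) (ha₁ : |x₁ + t * B - r * a ^ 2| ≤ s)
    (hb₁ : |x₁ + t' * B - r * b ^ 2| ≤ s) (hc₁ : |x₁ + t'' * B - r * c ^ 2| ≤ s) :
    r * |(b - a) * (c - a) * (c - b)| ≤ 16 * s := by
  have hdiff {u v : ℝ} (hu : |u| ≤ s) (hv : |v| ≤ s) : |u - v| ≤ 2 * s :=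
    (abs_sub _ _).trans (by linarith)
  obtain ⟨e₁, he₁⟩ : ∃ e, e = x₀ + t' * A - r * b - (x₀ + t * A - r * a) := ⟨_, rfl⟩
  obtain ⟨e₂, he₂⟩ : ∃ e, e = x₁ + t'' * B - r * c ^ 2 - (x₁ + t * B - r * a ^ 2) := ⟨_, rfl⟩
  obtain ⟨e₃, he₃⟩ : ∃ e, e = x₀ + t'' * A - r * c - (x₀ + t * A - r * a) := ⟨_, rfl⟩
  obtain ⟨e₄, he₄⟩ : ∃ e, e = x₁ + t' * B - r * b ^ 2 - (x₁ + t * B - r * a ^ 2) := ⟨_, rfl⟩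
  have b₁ : |e₁| ≤ 2 * s := he₁ ▸ hdiff hb₀ ha₀
  have b₂ : |e₂| ≤ 2 * s := he₂ ▸ hdiff hc₁ ha₁
  have b₃ : |e₃| ≤ 2 * s := he₃ ▸ hdiff hc₀ ha₀
  have b₄ : |e₄| ≤ 2 * s := he₄ ▸ hdiff hb₁ ha₁
  have hid : r * (r * ((b - a) * (c - a) * (c - b))) =
      r * (c - a) * e₄ + r * (b ^ 2 - a ^ 2) * e₃ + e₃ * e₄ -
        (r * (b - a) * e₂ + r * (c ^ 2 - a ^ 2) * e₁ + e₁ * e₂) := by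
    rw [he₁, he₂, he₃, he₄]; ring
  have hterm (p e : ℝ) (hp : |p| ≤ 1) (he : |e| ≤ 2 * s) : |r * p * e| ≤ 2 * (r * s) := by
    rw [abs_mul, abs_mul, abs_of_pos hr]
    calc r * |p| * |e| ≤ r * 1 * (2 * s) := by gcongr
      _ = 2 * (r * s) := by ring
  have hee (e e' : ℝ) (he : |e| ≤ 2 * s) (he' : |e'| ≤ 2 * s) : |e * e'| ≤ 4 * (r * s) := by
    rw [abs_mul]
    calc |e| * |e'| ≤ (2 * s) * (2 * s) := by gcongr
      _ = 4 * (s * s) := by ring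
      _ ≤ 4 * (r * s) := by gcongr
  have hsq {p p' : ℝ} (hp : 0 ≤ p ∧ p ≤ 1) (hp' : 0 ≤ p' ∧ p' ≤ 1) : |p - p'| ≤ 1 :=
    abs_le.2 ⟨by linarith [hp.1, hp'.2], by linarith [hp.2, hp'.1]⟩
  have hsq2 {p : ℝ} (hp : 0 ≤ p ∧ p ≤ 1) : 0 ≤ p ^ 2 ∧ p ^ 2 ≤ 1 :=
    ⟨sq_nonneg _, pow_le_one₀ hp.1 hp.2⟩
  have t1 := hterm _ _ (hsq hc ha) b₄
  have t2 := hterm _ _ (hsq (hsq2 hb) (hsq2 ha)) b₃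
  have t3 := hee _ _ b₃ b₄
  have t4 := hterm _ _ (hsq hb ha) b₂
  have t5 := hterm _ _ (hsq (hsq2 hc) (hsq2 ha)) b₁
  have t6 := hee _ _ b₁ b₂
  have hup : |r * (r * ((b - a) * (c - a) * (c - b)))| ≤ 16 * (r * s) := by
    rw [hid]
    refine (abs_sub _ _).trans ?_
    have u1 := abs_add_three (r * (c - a) * e₄) (r * (b ^ 2 - a ^ 2) * e₃) (e₃ * e₄)
    have u2 := abs_add_three (r * (b - a) * e₂) (r * (c ^ 2 - a ^ 2) * e₁) (e₁ * e₂)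
    linarith
  rw [abs_mul, abs_mul, abs_of_pos hr] at hup
  refine le_of_mul_le_mul_left ?_ hr
  linarith

/-- The Vandermonde product of three distinct multiples of `1/n` is at least `n^(-3)`, since its
numerator is a nonzero integer. The constant `17` exceeds the `16` of `abs_vandermonde_le`. -/
lemma not_collinear_near_parabola {n : ℕ} {i j k : ℕ} (hi : i < n) (hj : j < n) (hk : k < n)
    (hij : i ≠ j) (hik : i ≠ k) (hjk : j ≠ k) {r s : ℝ} (hs : 0 < s) (hrs : 17 * n ^ 3 * s ≤ r)
    {A B x₀ x₁ : ℝ} {t : ℕ → ℝ}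
    (h0 : ∀ m ∈ ({i, j, k} : Finset ℕ), |x₀ + t m * A - r * (m / n)| ≤ s)
    (h1 : ∀ m ∈ ({i, j, k} : Finset ℕ), |x₁ + t m * B - r * (m / n) ^ 2| ≤ s) : False := by
  have hn : 0 < n := by omega
  have hn' : (1 : ℝ) ≤ n := by exact_mod_cast hn
  have hn3 : (1 : ℝ) ≤ (n : ℝ) ^ 3 := one_le_pow₀ hn'
  have hsr : s ≤ r := by nlinarith
  have hr : 0 < r := by linarith
  have hunit (m : ℕ) (hm : m < n) : 0 ≤ (m / n : ℝ) ∧ (m / n : ℝ) ≤ 1 :=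
    ⟨by positivity, by rw [div_le_one (by positivity)]; exact_mod_cast hm.le⟩
  have hV : 1 / (n : ℝ) ^ 3 ≤
      |((j / n : ℝ) - i / n) * ((k / n : ℝ) - i / n) * ((k / n : ℝ) - j / n)| := by
    have h2 : (1 : ℤ) ≤ |((j : ℤ) - i) * ((k : ℤ) - i) * ((k : ℤ) - j)| :=
      Int.one_le_abs (mul_ne_zero (mul_ne_zero (by omega) (by omega)) (by omega))
    have h3 : (1 : ℝ) ≤ |((j : ℝ) - i) * ((k : ℝ) - i) * ((k : ℝ) - j)| := by exact_mod_cast h2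
    have h4 : ((j / n : ℝ) - i / n) * ((k / n : ℝ) - i / n) * ((k / n : ℝ) - j / n) =
        ((j : ℝ) - i) * ((k : ℝ) - i) * ((k : ℝ) - j) / n ^ 3 := by
      field_simp
    rw [h4, abs_div, abs_of_pos (show (0 : ℝ) < (n : ℝ) ^ 3 by positivity)]
    gcongr
  have hup := abs_vandermonde_le hr hs hsr (hunit i hi) (hunit j hj) (hunit k hk)
    (h0 i (by simp)) (h0 j (by simp)) (h0 k (by simp)) (h1 i (by simp)) (h1 j (by simp))
    (h1 k (by simp))
  have h5 : r * (1 / (n : ℝ) ^ 3) ≤ 16 * s := (mul_le_mul_of_nonneg_left hV hr.le).trans hup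
  rw [mul_one_div, div_le_iff₀ (by positivity)] at h5
  have h7 : 0 < s * (n : ℝ) ^ 3 := by positivity
  linarith

/-- Points on a parabola. -/
noncomputable def parabola (d : ℕ) (r : ℝ) (n i : ℕ) : E d :=
  WithLp.toLp 2 fun k => if (k : ℕ) = 0 then r * (i / n)
    else if (k : ℕ) = 1 then r * (i / n) ^ 2 else 0

lemma abs_parabola_le {r : ℝ} (hr : 0 ≤ r) {n i : ℕ} (hi : i < n) (k : Fin d) :
    |parabola d r n i k| ≤ r := by
  have h : (parabola d r n i) k = if (k : ℕ) = 0 then r * (i / n) else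
    if (k : ℕ) = 1 then r * (i / n : ℝ) ^ 2 else 0 := rfl
  have h0 : 0 ≤ (i / n : ℝ) := by positivity
  have h1 : (i / n : ℝ) ≤ 1 := by
    rw [div_le_one (by exact_mod_cast (by omega : 0 < n))]
    exact_mod_cast hi.le
  rw [h]
  split_ifs
  · rw [abs_of_nonneg (by positivity)]; exact mul_le_of_le_one_right hr h1
  · rw [abs_of_nonneg (by positivity)]; exact mul_le_of_le_one_right hr (pow_le_one₀ h0 h1)
  · simpa using hr

-- Each counted index provides a pair of points in the cube of half side `3 r` whose segment comes
-- within `s` of that point of the parabola in each coordinate. There are at most `B²` pairs, and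
-- one segment comes that close to at most two of the points.
open Classical in
lemma card_filter_edgeEvent_le (hd : 2 ≤ d) {r s : ℝ} {n : ℕ} (hs : 0 < s)
    (hrs : 17 * n ^ 3 * s ≤ r) {ν : Measure (E d)} (hν : IsPointConfiguration ν) {B : ℕ}
    (hB : ν (box (3 * r) 0) ≤ B) :
    ((Finset.range n).filter fun i => shift (parabola d r n i) ν ∈ edgeEvent d r s).card ≤
      2 * B ^ 2 := by
  rcases Nat.eq_zero_or_pos n with rfl | hn
  · simp
  have hn' : (1 : ℝ) ≤ n := by exact_mod_cast hn
  have hn3 : (1 : ℝ) ≤ (n : ℝ) ^ 3 := one_le_pow₀ hn'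
  have hsr : s ≤ r := by nlinarith
  have hr : 0 < r := by linarith
  have hfin := hν.finite_atoms (isBounded_box (3 * r) (0 : E d))
  set F : Finset (E d) := hfin.toFinset with hF
  have hFB : F.card ≤ B := by
    have h1 : (F.card : ℝ≥0∞) ≤ B := by
      calc (F.card : ℝ≥0∞) = ∑ x ∈ F, 1 := by simp
        _ ≤ ∑ x ∈ F, ν {x} := Finset.sum_le_sum fun x hx =>
            hν.one_le_of_mem_atoms (hfin.mem_toFinset.1 hx).1
        _ = ν F := by rw [sum_measure_singleton]
        _ ≤ ν (box (3 * r) 0) := measure_mono fun x hx => (hfin.mem_toFinset.1 hx).2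
        _ ≤ B := hB
    exact_mod_cast h1
  set S := (Finset.range n).filter fun i => shift (parabola d r n i) ν ∈ edgeEvent d r s with hS
  have hex : ∀ i, ∃ p : E d × E d, i ∈ S → (p.1 ∈ F ∧ p.2 ∈ F) ∧
      ∃ z ∈ segment ℝ p.1 p.2, z ∈ box s (parabola d r n i) := by
    intro i
    by_cases hi : i ∈ S
    · obtain ⟨hin, hie⟩ := Finset.mem_filter.1 hi
      obtain ⟨x, hx, y, hy, hxb, hyb, z, hz, hzb⟩ := exists_of_mem_edgeEvent (hν.shift _) hie
      have hbox {w : E d} (hw : w ∈ box (r + s) 0) : w + parabola d r n i ∈ box (3 * r) 0 := by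
        intro k
        have h1 := abs_le.1 (hw k)
        have h2 := abs_le.1 (abs_parabola_le hr.le (Finset.mem_range.1 hin) k)
        simp only [PiLp.zero_apply, sub_zero, PiLp.add_apply] at h1 ⊢
        rw [abs_le]; constructor <;> linarith
      refine ⟨(x + parabola d r n i, y + parabola d r n i), fun _ =>
        ⟨⟨hfin.mem_toFinset.2 ⟨mem_atoms_shift.1 hx, hbox hxb⟩,
          hfin.mem_toFinset.2 ⟨mem_atoms_shift.1 hy, hbox hyb⟩⟩, z + parabola d r n i, ?_, ?_⟩⟩
      · obtain ⟨a, b, ha, hb, hab, rfl⟩ := hz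
        refine ⟨a, b, ha, hb, hab, ?_⟩
        simp only [smul_add]
        rw [add_add_add_comm, ← add_smul, hab, one_smul]
      · intro k
        have := hzb k
        simpa using this
    · exact ⟨0, fun h => absurd h hi⟩
  choose p hp using hex
  have hcard := Finset.card_le_mul_card_image_of_maps_to (s := S) (t := F ×ˢ F) (f := p)
    (fun i hi => Finset.mem_product.2 (hp i hi).1) 2 fun w _ => by
      by_contra! hcon
      obtain ⟨i, hi, j, hj, k, hk, hij, hik, hjk⟩ := Finset.two_lt_card.1 hcon
      have key : ∀ m, ∃ t : ℝ, m ∈ S.filter (fun i => p i = w) →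
          (∀ c : Fin d, |w.1 c + t * (w.2 c - w.1 c) - parabola d r n m c| ≤ s) := by
        intro m
        by_cases hm : m ∈ S.filter (fun i => p i = w)
        · obtain ⟨hmS, hmw⟩ := Finset.mem_filter.1 hm
          obtain ⟨-, z, hz, hzb⟩ := hp m hmS
          rw [hmw] at hz
          obtain ⟨a, b, ha, hb, hab, rfl⟩ := hz
          refine ⟨b, fun _ c => ?_⟩
          have h1 := hzb c
          simp only [PiLp.add_apply, PiLp.smul_apply, smul_eq_mul] at h1
          have h2 : a = 1 - b := by linarith
          rw [h2] at h1
          convert h1 using 2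
          ring
        · exact ⟨0, fun h => absurd h hm⟩
      choose t ht using key
      have hall : ∀ m ∈ ({i, j, k} : Finset ℕ), m ∈ S.filter (fun i => p i = w) := by
        intro m hm
        simp only [Finset.mem_insert, Finset.mem_singleton] at hm
        rcases hm with rfl | rfl | rfl <;> assumption
      have hlt (m : ℕ) (hm : m ∈ S.filter (fun i => p i = w)) : m < n :=
        Finset.mem_range.1 (Finset.mem_filter.1 (Finset.mem_filter.1 hm).1).1
      exact not_collinear_near_parabola (hlt i hi) (hlt j hj) (hlt k hk) hij hik hjk hs hrs
        (fun m hm => ht m (hall m hm) ⟨0, by omega⟩) (fun m hm => ht m (hall m hm) ⟨1, by omega⟩)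
  refine hcard.trans ?_
  rw [Finset.card_product, sq]
  gcongr

section

variable {Ω : Type*} [MeasurableSpace Ω] {P : Measure Ω} [IsProbabilityMeasure P]
  {Lam : Ω → Measure (E d)}

open Classical in
/-- If crossings are likely at scales that are small compared with the connection radius, then
there are very many points within the connection radius. -/
lemma exists_le_mul_pow_of_crossingEvent (hd : 2 ≤ d) (hL : IsEnvironment P Lam) (C : ℝ) :
    ∃ ρ : ℝ, 1 ≤ ρ ∧ ∀ (r s l : ℝ) (X : Ω → Measure (E d)), 1 ≤ s → ρ * s ≤ r → 0 ≤ l →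
      IsCox P Lam l X → (∀ ω, IsPointConfiguration (X ω)) →
      3 / 4 ≤ P.real {ω | CrossingEvent r s (X ω)} → C ≤ l * r ^ d := by
  obtain ⟨B, hB⟩ := exists_nat_ge (max 1 (4 * 36 ^ d * C))
  have hB1 : (1 : ℝ) ≤ B := (le_max_left _ _).trans hB
  have hB2 : 4 * 36 ^ d * C ≤ B := (le_max_right _ _).trans hB
  -- In the mean, at least `3 n / 4` of the `n` translated edge events occur. With at most `B`
  -- points no more than `2 B²` of them can, and having `B` points or more has probability at most
  -- `1/4` if `l r^d < C`. Then `3 n / 4 ≤ 2 B² + n / 4`, which is false for this `n`.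
  set n := 4 * B ^ 2 + 1 with hn
  have hn1 : (1 : ℝ) ≤ n := by exact_mod_cast (by omega : 1 ≤ n)
  have hn3 : (1 : ℝ) ≤ (n : ℝ) ^ 3 := one_le_pow₀ hn1
  refine ⟨17 * n ^ 3, by linarith, fun r s l X hs hrs hl hX hpc hcross => ?_⟩
  by_contra! hcon
  have hs0 : 0 < s := by linarith
  have hr1 : 1 ≤ r := by nlinarith
  set Q : Set (E d) := box (3 * r) 0 with hQ
  have hQm : MeasurableSet Q := measurableSet_box _ _
  have hXQ : Measurable fun ω => X ω Q := (Measure.measurable_coe hQm).comp hX.measurable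
  have hmany : P {ω | (B : ℝ≥0∞) ≤ X ω Q} ≤ ENNReal.ofReal (1 / 4) := by
    have hB0 : (B : ℝ≥0∞) ≠ 0 := by
      have : (0 : ℝ) < B := by linarith
      exact_mod_cast this.ne'
    refine (meas_ge_le_lintegral_div hXQ.aemeasurable hB0 (ENNReal.natCast_ne_top B)).trans ?_
    rw [ENNReal.div_le_iff hB0 (ENNReal.natCast_ne_top B)]
    have h1 := hX.lintegral_count_le hL (m := 6 * r) (by linarith) hl
    have h2 : 6 * r / 2 = 3 * r := by ring
    rw [h2] at h1
    refine h1.trans ?_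
    rw [← ENNReal.ofReal_natCast, ← ENNReal.ofReal_mul (by norm_num)]
    refine ENNReal.ofReal_le_ofReal ?_
    have h3 : l * (6 * (6 * r)) ^ d = 36 ^ d * (l * r ^ d) := by
      rw [← mul_assoc, mul_pow]; norm_num; ring
    rw [h3]
    have h4 : (36 : ℝ) ^ d * (l * r ^ d) ≤ 36 ^ d * C := by gcongr
    linarith
  have hev (i : ℕ) : ENNReal.ofReal (3 / 4) ≤
      P {ω | shift (parabola d r n i) (X ω) ∈ edgeEvent d r s} := by
    rw [hX.measure_shift hpc hL (measurableSet_edgeEvent r s)]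
    rw [ENNReal.ofReal_le_iff_le_toReal (measure_ne_top P _)]
    refine hcross.trans (measureReal_mono fun ω hω => ?_)
    exact CrossingEvent.mem_edgeEvent hs0 (hpc ω) hω
  have hmeas (i : ℕ) : MeasurableSet {ω | shift (parabola d r n i) (X ω) ∈ edgeEvent d r s} :=
    ((measurable_shift _).comp hX.measurable) (measurableSet_edgeEvent r s)
  have hmB : MeasurableSet {ω | (B : ℝ≥0∞) ≤ X ω Q} := measurableSet_le measurable_const hXQ
  have hpt (ω : Ω) : ∑ i ∈ Finset.range n,
      {ω | shift (parabola d r n i) (X ω) ∈ edgeEvent d r s}.indicator (1 : Ω → ℝ≥0∞) ω ≤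
      (2 * B ^ 2 : ℕ) + n * {ω | (B : ℝ≥0∞) ≤ X ω Q}.indicator 1 ω := by
    have h1 : ∑ i ∈ Finset.range n,
        {ω | shift (parabola d r n i) (X ω) ∈ edgeEvent d r s}.indicator (1 : Ω → ℝ≥0∞) ω =
        ((Finset.range n).filter fun i =>
          shift (parabola d r n i) (X ω) ∈ edgeEvent d r s).card := by
      rw [Finset.card_filter]
      push_cast
      refine Finset.sum_congr rfl fun i _ => ?_
      by_cases h : shift (parabola d r n i) (X ω) ∈ edgeEvent d r s
      · rw [indicator_of_mem (by exact h), if_pos h]; rfl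
      · rw [indicator_of_notMem (by exact h), if_neg h]
    rw [h1]
    by_cases h2 : (B : ℝ≥0∞) ≤ X ω Q
    · rw [indicator_of_mem (by exact h2)]
      refine le_trans ?_ le_add_self
      rw [Pi.one_apply, mul_one]
      exact_mod_cast (Finset.card_filter_le _ _).trans (by simp)
    · refine le_trans ?_ le_self_add
      exact_mod_cast card_filter_edgeEvent_le hd hs0 hrs (hpc ω) (not_le.1 h2).le
  have hint := lintegral_mono (μ := P) hpt
  rw [lintegral_finsetSum _ fun i _ => measurable_one.indicator (hmeas i),
    lintegral_add_left measurable_const, lintegral_const, measure_univ, mul_one,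
    lintegral_const_mul _ (measurable_one.indicator hmB), lintegral_indicator_one hmB,
    Finset.sum_congr rfl fun i _ => lintegral_indicator_one (hmeas i)] at hint
  have hfinal : ENNReal.ofReal (n * (3 / 4)) ≤ ENNReal.ofReal (2 * B ^ 2 + n * (1 / 4)) := by
    calc ENNReal.ofReal (n * (3 / 4)) = ∑ _i ∈ Finset.range n, ENNReal.ofReal (3 / 4) := by
          rw [Finset.sum_const, Finset.card_range, nsmul_eq_mul, ENNReal.ofReal_mul (by positivity),
            ENNReal.ofReal_natCast]
      _ ≤ _ := Finset.sum_le_sum fun i _ => hev i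
      _ ≤ _ := hint
      _ ≤ (2 * B ^ 2 : ℕ) + n * ENNReal.ofReal (1 / 4) := by gcongr
      _ = _ := by
          have h5 : (2 * (B : ℝ) ^ 2) = ((2 * B ^ 2 : ℕ) : ℝ) := by push_cast; rfl
          rw [ENNReal.ofReal_add (by positivity) (by positivity), h5, ENNReal.ofReal_natCast,
            ENNReal.ofReal_mul (by positivity), ENNReal.ofReal_natCast]
  rw [ENNReal.ofReal_le_ofReal_iff (by positivity)] at hfinal
  have hncast : (n : ℝ) = 4 * B ^ 2 + 1 := by rw [hn]; push_cast; ring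
  rw [hncast] at hfinal
  linarith

end

section

variable {Ω : Type*} [MeasurableSpace Ω] {P : Measure Ω} {Lam : Ω → Measure (E d)} {l : ℝ}
  {X X' : Ω → Measure (E d)} {R : E d → Ω → ℝ≥0∞}

/-! ### The Palm distribution -/

lemma palmExpectation_congr (h : X' =ᵐ[P] X) (f : Measure (E d) → ℝ≥0∞) :
    palmExpectation P l X' f = palmExpectation P l X f := by
  unfold palmExpectation
  congr 1
  refine lintegral_congr_ae ?_
  filter_upwards [h] with ω hω
  rw [hω]

lemma palmExpectation_mono_set {S T : Set (Measure (E d))}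
    (h : ∀ ω x, shift x (X ω) ∈ S → shift x (X ω) ∈ T) :
    palmExpectation P l X (S.indicator 1) ≤ palmExpectation P l X (T.indicator 1) := by
  unfold palmExpectation
  refine mul_le_mul_right (lintegral_mono fun ω => lintegral_mono fun x => ?_) _
  change S.indicator 1 (shift x (X ω)) ≤ T.indicator 1 (shift x (X ω))
  by_cases hS : shift x (X ω) ∈ S
  · rw [indicator_of_mem hS, indicator_of_mem (h ω x hS)]
  · rw [indicator_of_notMem hS]; exact zero_le

lemma palmExpectation_indicator_le_one (hX : IsCox P Lam l X) (hL : IsEnvironment P Lam)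
    (S : Set (Measure (E d))) : palmExpectation P l X (S.indicator 1) ≤ 1 := by
  have h1 : ∫⁻ ω, X ω (box (1 / 2) 0) ∂P ≤ ENNReal.ofReal l := by
    have h := hX.setLIntegral_count_le hL.measurable (measurableSet_box (1 / 2) (0 : E d))
      (isBounded_box _ _) MeasurableSet.univ
    rwa [preimage_univ, Measure.restrict_univ, lintegral_unit_box hL, mul_one] at h
  have h2 : ∫⁻ ω, ∫⁻ x in cube 1 (0 : E d), S.indicator 1 (shift x (X ω)) ∂(X ω) ∂P ≤
      ENNReal.ofReal l := by
    refine (lintegral_mono fun ω => ?_).trans h1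
    refine (lintegral_mono fun x => indicator_le_self S 1 (shift x (X ω))).trans ?_
    simp only [Pi.one_apply]
    rw [setLIntegral_one]
    rfl
  unfold palmExpectation
  exact (mul_le_mul_right h2 _).trans (ENNReal.inv_mul_le_one _)

/-- The Palm version is a configuration with a point at the origin, and its law has total mass one
if `l > 0`. -/
lemma one_le_palmExpectation_mem_atoms (hX : IsCox P Lam l X)
    (hc : ∀ ω, IsPointConfiguration (X ω)) (hL : IsEnvironment P Lam) (hl : 0 < l) :
    1 ≤ palmExpectation P l X ({ν | 0 ∈ atoms ν}.indicator 1) := by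
  have hm : Measurable fun ω => Lam ω (box (1 / 2) 0) :=
    (Measure.measurable_coe (measurableSet_box _ _)).comp hL.measurable
  have h1 : ∫⁻ ω, X ω (box (1 / 2) 0) ∂P = ENNReal.ofReal l := by
    have h := hX.lintegral_comp_count hL.measurable (measurableSet_box (1 / 2) (0 : E d))
      (isBounded_box _ _) MeasurableSet.univ fun x => x
    simp only [preimage_univ, Measure.restrict_univ, poissonWeight, tsum_mul_poissonMeasure] at h
    rw [h]
    calc ∫⁻ ω, ((l.toNNReal * (Lam ω (box (1 / 2) 0)).toNNReal : ℝ≥0) : ℝ≥0∞) ∂P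
        = ∫⁻ ω, ENNReal.ofReal l * Lam ω (box (1 / 2) 0) ∂P := by
          refine lintegral_congr_ae ?_
          filter_upwards [ae_lt_top hm (by rw [lintegral_unit_box hL]; exact ENNReal.one_ne_top)]
            with ω hω
          rw [ENNReal.coe_mul, ENNReal.coe_toNNReal hω.ne]
          rfl
      _ = ENNReal.ofReal l := by
          rw [lintegral_const_mul _ hm, lintegral_unit_box hL, mul_one]
  have h2 : ∫⁻ ω, X ω (box (1 / 2) 0) ∂P ≤
      ∫⁻ ω, ∫⁻ x in cube 1 (0 : E d), {ν | 0 ∈ atoms ν}.indicator 1 (shift x (X ω)) ∂(X ω) ∂P := by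
    refine lintegral_mono fun ω => ?_
    have hat : ∀ᵐ x ∂(X ω), x ∈ atoms (X ω) := by
      by_contra hcon
      obtain ⟨x, hx, hx'⟩ := (hc ω).exists_atom (B := (atoms (X ω))ᶜ) hcon
      exact hx' hx
    have hbox : cube 1 (0 : E d) = box (1 / 2) 0 := rfl
    rw [← setLIntegral_one, hbox]
    refine lintegral_mono_ae ?_
    filter_upwards [ae_restrict_of_ae hat] with x hx
    rw [indicator_of_mem]
    · rfl
    · rw [Set.mem_ofPred_eq, mem_atoms_shift, zero_add]
      exact hx
  unfold palmExpectation
  rw [← ENNReal.inv_mul_cancel (ENNReal.ofReal_pos.2 hl).ne' ENNReal.ofReal_ne_top]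
  gcongr
  exact h1.symm.le.trans h2

lemma connectedToBoundary_of_connectedToInfinity {a r : ℝ} {ν : Measure (E d)}
    (hν : IsPointConfiguration ν) (h : ConnectedToInfinity r ν) : ConnectedToBoundary a r ν := by
  intro hsub
  refine h ((hν.finite_atoms (isBounded_box ((a - 2 * r) / 2) (0 : E d))).subset fun y hy => ?_)
  refine ⟨?_, hsub hy⟩
  obtain ⟨-, hy', -⟩ := hy
  exact hy'

lemma theta_le_thetaBox (hL : IsEnvironment P Lam) (hX : IsCox P Lam l X)
    (a r : ℝ) : theta P X l r ≤ thetaBox P X a l r := by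
  obtain ⟨X', hae, hX', hpc⟩ := hX.exists_regular
  unfold theta thetaBox palmProb
  rw [← palmExpectation_congr hae, ← palmExpectation_congr hae]
  refine ENNReal.toReal_mono
    (ne_top_of_le_ne_top ENNReal.one_ne_top (palmExpectation_indicator_le_one hX' hL _)) ?_
  exact palmExpectation_mono_set fun ω x h =>
    connectedToBoundary_of_connectedToInfinity ((hpc ω).shift x) h

lemma thetaBox_le_theta_add (hL : IsEnvironment P Lam)
    (hX : IsCox P Lam l X) {a r ε : ℝ} (hε : 0 ≤ ε)
    (h : palmExpectation P l X ({ν | ConnectedToBoundary a r ν}.indicator 1) ≤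
      palmExpectation P l X ({ν | ConnectedToInfinity r ν}.indicator 1) + ENNReal.ofReal ε) :
    thetaBox P X a l r ≤ theta P X l r + ε := by
  have hfin := ne_top_of_le_ne_top ENNReal.one_ne_top
    (palmExpectation_indicator_le_one hX hL {ν | ConnectedToInfinity r ν})
  have h1 := ENNReal.toReal_mono (ENNReal.add_ne_top.2 ⟨hfin, ENNReal.ofReal_ne_top⟩) h
  rwa [ENNReal.toReal_add hfin ENNReal.ofReal_ne_top, ENNReal.toReal_ofReal hε] at h1

lemma measureReal_crossingEvent_congr (h : X' =ᵐ[P] X) (r s : ℝ) :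
    P.real {ω | CrossingEvent r s (X' ω)} = P.real {ω | CrossingEvent r s (X ω)} := by
  refine measureReal_congr ?_
  filter_upwards [h] with ω hω
  show CrossingEvent r s (X' ω) = CrossingEvent r s (X ω)
  rw [hω]

variable [IsProbabilityMeasure P]

/-! ### Connection radii that are large compared with the crossing scale -/

/-- The renormalization at scale `10 r`, with occupied windows as good events. The choice of `Y`
brings the contribution of unoccupied windows below `1/4`, and stabilization at large `r` does so
for the radii. -/
theorem exists_eventually_connectedToBoundary_le (hd : 2 ≤ d) (hL : IsEnvironment P Lam)
    (hR : IsStabilizing P Lam R) {Y : ℝ} (hY : 0 < Y)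
    (hYexp : ((14001 : ℝ) ^ d) ^ 2 * ((150 * d) ^ d * Real.exp (-(Y / (4 * (100 * d) ^ d)))) ≤
      1 / 4)
    {ε : ℝ} (hε : 0 < ε) :
    ∃ n₀ : ℕ, ∀ᶠ r : ℝ in atTop, ∀ (l a : ℝ) (X : Ω → Measure (E d)), 0 ≤ l → IsCox P Lam l X →
      (∀ ω, IsPointConfiguration (X ω)) → Y ≤ l * r ^ d → 80 * r * 1000 ^ n₀ ≤ a →
      palmExpectation P l X ({ν | ConnectedToBoundary a r ν}.indicator 1) ≤
        palmExpectation P l X ({ν | ConnectedToInfinity r ν}.indicator 1) + ENNReal.ofReal ε := by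
  obtain ⟨n₀, hn₀⟩ := exists_connectedToBoundary_le hd hL hR hε hY
  have hd0 : (0 : ℝ) < d := by positivity
  set N : ℝ := 14001 ^ d with hN
  have hNpos : 0 < N := by positivity
  set T : ℝ := (150 * d) ^ d with hT
  have hTpos : 0 < T := by positivity
  refine ⟨n₀, ?_⟩
  filter_upwards [eventually_measure_notMem_window_le hd hL hR (τ := 1 / (4 * N ^ 2 * T))
    (by positivity), eventually_exists_radii hR (τ := 1 / (4 * N ^ 2)) (by positivity),
    eventually_ge_atTop 1] with r hwin hrad hr l a X hl hX hpc hYl ha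
  obtain ⟨n, hn1, hn2, hn⟩ := hrad
  have hr0 : 0 < r := by linarith
  have hl0 : 0 < l := pos_of_mul_pos_left (hY.trans_le hYl) (by positivity)
  have hpow : l * r ^ d ≤ l * (10 * r) ^ d := by gcongr; linarith
  refine hn₀ (10 * r) r l a X (window d r) n _ _ (by linarith) (by linarith) hl0
    (hYl.trans hpow) hX hpc (measurableSet_occupied _ _) (zero_notMem_occupied _ _)
    (fun ν hν h => uniq_of_window hd hr0 hν h) hn1 hn2 (hwin l X hl hX hpc) hn ?_ (by linarith)
  have hmax : N ^ 2 * (T * max (Real.exp (-(l * r ^ d / (4 * (100 * d) ^ d))))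
      (1 / (4 * N ^ 2 * T)))
      ≤ 1 / 4 := by
    rcases max_cases (Real.exp (-(l * r ^ d / (4 * (100 * d) ^ d)))) (1 / (4 * N ^ 2 * T))
      with ⟨h, -⟩ | ⟨h, -⟩
    · rw [h]
      refine le_trans ?_ hYexp
      gcongr
    · rw [h]
      refine le_of_eq ?_
      field_simp
  have hNE : (14001 ^ d : ℝ≥0∞) = ENNReal.ofReal N := by
    rw [hN, ENNReal.ofReal_pow (by norm_num)]; norm_num
  rw [hNE, ← ENNReal.ofReal_pow hNpos.le, ← ENNReal.ofReal_add (by positivity) (by positivity),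
    ← ENNReal.ofReal_mul (by positivity)]
  have h12 : (1 / 2 : ℝ≥0∞) = ENNReal.ofReal (1 / 2) := by
    rw [ENNReal.ofReal_div_of_pos (by norm_num)]; simp
  rw [h12]
  refine ENNReal.ofReal_le_ofReal ?_
  have h4 : N ^ 2 * (1 / (4 * N ^ 2)) = 1 / 4 := by field_simp
  rw [mul_add, h4]
  linarith

/-- When `l r^d` is large, windows are so likely to be occupied that the renormalization can start
at its lowest scale, and almost every point belongs to an infinite cluster. -/
theorem exists_eventually_mem_atoms_le (hd : 2 ≤ d) (hL : IsEnvironment P Lam)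
    (hR : IsStabilizing P Lam R) {ε : ℝ} (hε : 0 < ε) :
    ∃ C : ℝ, ∀ᶠ r : ℝ in atTop, ∀ (l : ℝ) (X : Ω → Measure (E d)), 0 ≤ l → IsCox P Lam l X →
      (∀ ω, IsPointConfiguration (X ω)) → C ≤ l * r ^ d →
      1 ≤ palmExpectation P l X ({ν | ConnectedToInfinity r ν}.indicator 1) + ENNReal.ofReal ε := by
  obtain ⟨η, hη, hη'⟩ := exists_mem_atoms_le hd hL hR hε (c := 1) one_pos
  have hd0 : (0 : ℝ) < d := by positivity
  set T : ℝ := (150 * d) ^ d with hT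
  have hTpos : 0 < T := by positivity
  have hlim : Tendsto (fun C : ℝ => Real.exp (-(C / (4 * (100 * d) ^ d)))) atTop (𝓝 0) :=
    Real.tendsto_exp_neg_atTop_nhds_zero.comp (tendsto_id.atTop_div_const (by positivity))
  obtain ⟨C, hC, hC1⟩ := (((tendsto_order.1 hlim).2 (η / (2 * T)) (by positivity)).and
    (eventually_ge_atTop 1)).exists
  refine ⟨C, ?_⟩
  filter_upwards [eventually_measure_notMem_window_le hd hL hR (τ := η / (2 * T))
    (by positivity), eventually_exists_radii hR (τ := η / 2) (by positivity),
    eventually_ge_atTop 1] with r hwin hrad hr l X hl hX hpc hCl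
  obtain ⟨n, hn1, hn2, hn⟩ := hrad
  have hr0 : 0 < r := by linarith
  have hl0 : 0 < l := pos_of_mul_pos_left (zero_lt_one.trans_le (hC1.trans hCl)) (by positivity)
  have hpow : l * r ^ d ≤ l * (10 * r) ^ d := by gcongr; linarith
  refine (one_le_palmExpectation_mem_atoms hX hpc hL hl0).trans ?_
  refine hη' (10 * r) r l X (window d r) n _ _ (by linarith) (by linarith) hl0
    ((hC1.trans hCl).trans hpow) hX hpc (measurableSet_occupied _ _) (zero_notMem_occupied _ _)
    (fun ν hν h => uniq_of_window hd hr0 hν h)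
    (fun ν hν h x hx hxb => exits_of_window hd hr0 hν h hx hxb) hn1 hn2 (hwin l X hl hX hpc) hn ?_
  rw [← ENNReal.ofReal_add (by positivity) (by positivity)]
  refine ENNReal.ofReal_le_ofReal ?_
  have hmax : max (Real.exp (-(l * r ^ d / (4 * (100 * d) ^ d)))) (η / (2 * T)) ≤ η / (2 * T) := by
    refine max_le (le_trans ?_ hC.le) le_rfl
    gcongr
  have h5 : T * max (Real.exp (-(l * r ^ d / (4 * (100 * d) ^ d)))) (η / (2 * T)) ≤
      T * (η / (2 * T)) := by gcongr
  have h6 : T * (η / (2 * T)) = η / 2 := by field_simp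
  linarith

/-! ### Conclusion -/

section Conclusion

variable {X : ℝ → Ω → Measure (E d)} {lam s : ℝ → ℝ}

/-- The finite-volume percolation probabilities do not exceed the percolation probability by
much. -/
theorem exists_eventually_thetaBox_le (hd : 2 ≤ d) (hL : IsEnvironment P Lam)
    (hR : IsStabilizing P Lam R) (hX : ∀ l : ℝ, 0 ≤ l → IsCox P Lam l (X l)) {L : Filter ℝ}
    (hLf : L = 𝓝[>] 0 ∨ L = atTop) (hlam : ∀ r, 0 < r → 0 ≤ lam r) (hs : ∀ r, 0 < r → 1 ≤ s r)
    {q Y : ℝ} (hq : 3 / 4 ≤ q)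
    (hqN : (14001 ^ d : ℝ≥0∞) ^ 2 *
      (ENNReal.ofReal (1 - q) + 2 ^ d * ENNReal.ofReal (1 - q)) ≤ 1 / 2) (hY : 0 < Y)
    (hYexp : ((14001 : ℝ) ^ d) ^ 2 * ((150 * d) ^ d * Real.exp (-(Y / (4 * (100 * d) ^ d)))) ≤
      1 / 4)
    (hqY : 1 - q ≤ Real.exp (-(2 * 72 ^ d * Y)) / 2)
    (hev : ∀ᶠ r in L, q < min (P.real (smallRadii R (5 * s r) 0 (s r)))
      (P.real {ω | CrossingEvent r (s r) (X (lam r) ω)})) {ε : ℝ} (hε : 0 < ε) :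
    ∃ K : ℝ, 0 < K ∧ ∀ᶠ r in L, thetaBox P (X (lam r)) (K * s r) (lam r) r ≤
      theta P (X (lam r)) (lam r) r + ε := by
  obtain ⟨n₁, hn₁⟩ := exists_connectedToBoundary_le_of_crossing hd hL hR (q := q) (by linarith)
    hqN hε
  have hsmall : ∀ K : ℝ, 8 * 1000 ^ n₁ ≤ K → ∀ r, 0 < r → r ≤ s r / 10 →
      q < min (P.real (smallRadii R (5 * s r) 0 (s r)))
        (P.real {ω | CrossingEvent r (s r) (X (lam r) ω)}) →
      thetaBox P (X (lam r)) (K * s r) (lam r) r ≤ theta P (X (lam r)) (lam r) r + ε := by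
    intro K hK r hr hrs hqr
    obtain ⟨X', hae, hX', hpc⟩ := (hX (lam r) (hlam r hr)).exists_regular
    refine thetaBox_le_theta_add hL (hX _ (hlam r hr)) hε.le ?_
    rw [← palmExpectation_congr hae, ← palmExpectation_congr hae]
    refine hn₁ (s r) r (lam r) _ X' (hs r hr) hr hrs (hlam r hr) hX' hpc (lt_min_iff.1 hqr).1 ?_ ?_
    · rw [measureReal_crossingEvent_congr hae]
      exact (lt_min_iff.1 hqr).2
    · have := hs r hr
      nlinarith
  rcases hLf with rfl | rfl
  -- As `r → 0`, the bound `s r ≥ 1` places every small `r` in the regime `r ≤ s r / 10`.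
  · refine ⟨8 * 1000 ^ n₁, by positivity, ?_⟩
    have h10 : ∀ᶠ r : ℝ in 𝓝[>] 0, r < 1 / 10 :=
      nhdsWithin_le_nhds (Iio_mem_nhds (by norm_num))
    filter_upwards [hev, self_mem_nhdsWithin, h10] with r hqr hr hr10
    have := hs r hr
    exact hsmall _ le_rfl r hr (by linarith) hqr
  · obtain ⟨n₂, hn₂⟩ := exists_eventually_connectedToBoundary_le hd hL hR hY hYexp hε
    obtain ⟨C, hC⟩ := exists_eventually_mem_atoms_le hd hL hR hε
    obtain ⟨ρ, hρ, hρC⟩ := exists_le_mul_pow_of_crossingEvent hd hL C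
    refine ⟨max (8 * 1000 ^ n₁) (80 * 1000 ^ n₂ * ρ), by positivity, ?_⟩
    filter_upwards [hev, hn₂, hC, eventually_ge_atTop 1] with r hqr hr₂ hrC hr
    have hr0 : 0 < r := by linarith
    have hs1 := hs r hr0
    rcases le_or_gt r (s r / 10) with hrs | hrs
    · exact hsmall _ (le_max_left _ _) r hr0 hrs hqr
    · obtain ⟨X', hae, hX', hpc⟩ := (hX (lam r) (hlam r hr0)).exists_regular
      have hcross : q < P.real {ω | CrossingEvent r (s r) (X' ω)} := by
        rw [measureReal_crossingEvent_congr hae]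
        exact (lt_min_iff.1 hqr).2
      refine thetaBox_le_theta_add hL (hX _ (hlam r hr0)) hε.le ?_
      rw [← palmExpectation_congr hae, ← palmExpectation_congr hae]
      -- If `ρ s r ≤ r`, the cube of side `K s r` may be too small compared with `r` to say
      -- anything; but then `l r^d ≥ C`, and `θ ≥ 1 - ε`. Otherwise `r < ρ s r`, and the factor `ρ`
      -- in `K` makes the cube large compared with `r`.
      rcases le_or_gt (ρ * s r) r with hρs | hρs
      · refine (palmExpectation_indicator_le_one hX' hL _).trans ?_
        exact hrC (lam r) X' (hlam r hr0) hX' hpc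
          (hρC r (s r) (lam r) X' hs1 hρs (hlam r hr0) hX' hpc (hq.trans hcross.le))
      · refine hr₂ (lam r) _ X' (hlam r hr0) hX' hpc
          (le_mul_pow_of_crossingEvent hL (by linarith) hqY hr (by linarith) (hlam r hr0) hX' hpc
            hcross) ?_
        calc 80 * r * 1000 ^ n₂ ≤ 80 * (ρ * s r) * 1000 ^ n₂ := by gcongr
          _ = 80 * 1000 ^ n₂ * ρ * s r := by ring
          _ ≤ _ := by gcongr; exact le_max_right _ _

end Conclusion

/-- `Y` is fixed first, so that windows are likely to be occupied once `l r^d ≥ Y`. Then `q` is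
taken so close to one that likely crossings start the renormalization and also force `l r^d ≥ Y`.
Both depend only on `d`. -/
lemma exists_threshold (d : ℕ) (hd : 2 ≤ d) : ∃ q Y : ℝ, 3 / 4 ≤ q ∧ q < 1 ∧ 0 < Y ∧
    (14001 ^ d : ℝ≥0∞) ^ 2 * (ENNReal.ofReal (1 - q) + 2 ^ d * ENNReal.ofReal (1 - q)) ≤ 1 / 2 ∧
    ((14001 : ℝ) ^ d) ^ 2 * ((150 * d) ^ d * Real.exp (-(Y / (4 * (100 * d) ^ d)))) ≤ 1 / 4 ∧
    1 - q ≤ Real.exp (-(2 * 72 ^ d * Y)) / 2 := by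
  have hd0 : (0 : ℝ) < d := by positivity
  set N : ℝ := 14001 ^ d with hN
  have hNpos : 0 < N := by positivity
  set T : ℝ := (150 * d) ^ d with hT
  have hTpos : 0 < T := by positivity
  have hlim : Tendsto (fun Y : ℝ => Real.exp (-(Y / (4 * (100 * d) ^ d)))) atTop (𝓝 0) :=
    Real.tendsto_exp_neg_atTop_nhds_zero.comp (tendsto_id.atTop_div_const (by positivity))
  obtain ⟨Y, hY, hY0⟩ := (((tendsto_order.1 hlim).2 (1 / (4 * N ^ 2 * T)) (by positivity)).and
    (eventually_gt_atTop 0)).exists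
  set δ : ℝ := min (1 / 4) (min (1 / (2 * N ^ 2 * (1 + 2 ^ d))) (Real.exp (-(2 * 72 ^ d * Y)) / 2))
    with hδ
  have hδ0 : 0 < δ := by positivity
  have hδ1 : δ ≤ 1 / 4 := min_le_left _ _
  have hδ2 : δ ≤ 1 / (2 * N ^ 2 * (1 + 2 ^ d)) := (min_le_right _ _).trans (min_le_left _ _)
  have hδ3 : δ ≤ Real.exp (-(2 * 72 ^ d * Y)) / 2 := (min_le_right _ _).trans (min_le_right _ _)
  refine ⟨1 - δ, Y, by linarith, by linarith, hY0, ?_, ?_, by linarith⟩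
  · rw [sub_sub_cancel]
    have hNE : (14001 ^ d : ℝ≥0∞) = ENNReal.ofReal N := by
      rw [hN, ENNReal.ofReal_pow (by norm_num)]; norm_num
    have h2 : (2 : ℝ≥0∞) ^ d = ENNReal.ofReal (2 ^ d) := by
      rw [ENNReal.ofReal_pow (by norm_num)]; norm_num
    have h12 : (1 / 2 : ℝ≥0∞) = ENNReal.ofReal (1 / 2) := by
      rw [ENNReal.ofReal_div_of_pos (by norm_num)]; simp
    rw [hNE, h2, h12, ← ENNReal.ofReal_pow hNpos.le, ← ENNReal.ofReal_mul (by positivity),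
      ← ENNReal.ofReal_add (by positivity) (by positivity), ← ENNReal.ofReal_mul (by positivity)]
    refine ENNReal.ofReal_le_ofReal ?_
    rw [le_div_iff₀ (by positivity)] at hδ2
    nlinarith
  · calc N ^ 2 * (T * Real.exp (-(Y / (4 * (100 * d) ^ d)))) ≤
          N ^ 2 * (T * (1 / (4 * N ^ 2 * T))) := by gcongr
      _ = 1 / 4 := by field_simp

end

end CoxPercolation

theorem proposition2p9 (d : ℕ) (hd : 2 ≤ d) :
    ∃ q : ℝ, 0 < q ∧ q < 1 ∧
      ∀ (Ω : Type*) [MeasurableSpace Ω] (P : Measure Ω) [IsProbabilityMeasure P]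
        (Lam : Ω → Measure (CoxPercolation.E d)) (R : CoxPercolation.E d → Ω → ℝ≥0∞)
        (X : ℝ → Ω → Measure (CoxPercolation.E d)),
        CoxPercolation.IsEnvironment P Lam →
        CoxPercolation.IsStabilizing P Lam R →
        (∀ l : ℝ, 0 ≤ l → CoxPercolation.IsCox P Lam l (X l)) →
        ∀ (lam s a : ℝ → ℝ) (L : Filter ℝ),
          (L = 𝓝[>] 0 ∨ L = atTop) →
          (∀ r, 0 < r → 0 ≤ lam r) →
          (MonotoneOn lam (Ioi 0) ∨ AntitoneOn lam (Ioi 0)) →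
          (∀ r, 0 < r → 1 ≤ s r) →
          MonotoneOn s (Ioi 0) →
          AntitoneOn a (Ioi 0) →
          (∀ K : ℝ, 0 < K →
            Tendsto (fun r => CoxPercolation.thetaBox P (X (lam r)) (K * s r) (lam r) r) L
              (𝓝 (a K))) →
          (∀ᶠ r in L,
            q < min (P.real (CoxPercolation.smallRadii R (5 * s r) 0 (s r)))
              (P.real {ω | CoxPercolation.CrossingEvent r (s r) (X (lam r) ω)})) →
          ∃ t : ℝ, Tendsto a atTop (𝓝 t) ∧
            Tendsto (fun r => CoxPercolation.theta P (X (lam r)) (lam r) r) L (𝓝 t) := by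
  obtain ⟨q, Y, hq, hq1, hY, hqN, hYexp, hqY⟩ := CoxPercolation.exists_threshold d hd
  refine ⟨q, by linarith, hq1, ?_⟩
  intro Ω _ P _ Lam R X hL hR hX lam s a L hLf hlam _ hs _ ha hbox hev
  have hpos : ∀ᶠ r in L, 0 < r := by
    rcases hLf with rfl | rfl
    · exact self_mem_nhdsWithin
    · exact eventually_gt_atTop 0
  have hne : L.NeBot := by rcases hLf with rfl | rfl <;> infer_instance
  have ha0 (K : ℝ) (hK : 0 < K) : 0 ≤ a K :=
    ge_of_tendsto' (hbox K hK) fun r => ENNReal.toReal_nonneg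
  -- `a` is monotone on the positive reals only; this modification is monotone and bounded below on
  -- the whole line, and agrees with `a` from `1` on.
  set b : ℝ → ℝ := fun K => a (max K 1) with hb
  have hbanti : Antitone b := fun K K' h =>
    ha (by show (0 : ℝ) < _; positivity) (by show (0 : ℝ) < _; positivity) (max_le_max h le_rfl)
  have hbdd : BddBelow (range b) := ⟨0, by rintro _ ⟨K, rfl⟩; exact ha0 _ (by positivity)⟩
  set t := ⨅ K, b K with ht
  have hbt : Tendsto b atTop (𝓝 t) := tendsto_atTop_ciInf hbanti hbdd
  have hat : Tendsto a atTop (𝓝 t) := by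
    refine hbt.congr' ?_
    filter_upwards [eventually_ge_atTop 1] with K hK
    rw [hb]
    simp only [max_eq_left hK]
  have hta (K : ℝ) (hK : 0 < K) : t ≤ a K := by
    refine (ciInf_le hbdd K).trans ?_
    exact ha hK (by show (0 : ℝ) < _; positivity) (le_max_left _ _)
  refine ⟨t, hat, tendsto_order.2 ⟨fun u hu => ?_, fun u hu => ?_⟩⟩
  -- The gap `t - u` is split in halves: one is the error in the comparison of `θ` with the box
  -- probability, the other is the distance of the box probability from its limit `a K ≥ t`.
  · obtain ⟨K, hK, hKev⟩ := CoxPercolation.exists_eventually_thetaBox_le hd hL hR hX hLf hlam hs hq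
      hqN hY hYexp hqY hev (ε := (t - u) / 2) (by linarith)
    have h1 := (tendsto_order.1 (hbox K hK)).1 (u + (t - u) / 2)
      (lt_of_lt_of_le (by linarith) (hta K hK))
    filter_upwards [hKev, h1] with r hr1 hr2
    linarith
  · obtain ⟨K, hKu, hK⟩ := (((tendsto_order.1 hat).2 u hu).and (eventually_gt_atTop 0)).exists
    filter_upwards [(tendsto_order.1 (hbox K hK)).2 u hKu, hpos] with r hr hr0
    exact (CoxPercolation.theta_le_thetaBox hL (hX _ (hlam r hr0)) _ _).trans_lt hr
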